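/- Let $q_1,q_2>0$ with $Q:=1/q_1+1/q_2\in(1,2)$, and put $p_i:=q_i(2-Q)$, $P:=1/p_1+1/p_2$, $\gamma_0:=q_1/q_2=p_1/p_2$, $\rho(t,s):=(|t|^2+|s|^{2q_2/q_1})^{1/2}$. Let $L_0\ge 0$ be a bounded function on $[-1,1]$, continuous off a finite set and not almost everywhere zero, and let $a(t,s)$, $(t,s)\in\mathbb Z^2$, be real numbers with $a(t,s)=\rho(t,s)^{-q_1}\big(L_0(t/\rho(t,s))+o(1)\big)$ as $|t|+|s|\to\infty$. Let $k$ be an integer with $1\le k<P$, and let $\{\varepsilon(u,v):(u,v)\in\mathbb Z^2\}$ be i.i.d. random variables with mean $0$, variance $1$ and $\mathbb E|\varepsilon(0,0)|^{2k}<\infty$. For a random variable $\xi$ with $\mathbb E|\xi|^m<\infty$ the $m$th Appell polynomial relative to the law of $\xi$ is $A_m(x):=(-i)^m\frac{d^m}{du^m}\big(e^{iux}/\mathbb E e^{iu\xi}\big)\big|_{u=0}$. For sites $w_1,\dots,w_k\in\mathbb Z^2$ the Wick product is ${:}\varepsilon(w_1)\cdots\varepsilon(w_k){:}=\prod_p A_{m_p}(\varepsilon(p))$,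 the product over the distinct sites $p$ among the $w_j$, where $m_p$ is the multiplicity of $p$ and $A_{m_p}$ is relative to the law of $\varepsilon(p)$. Define, for $z\in\mathbb Z^2$, with all series converging in $L^2$, $$Y(z)=\sum_{p\in\mathbb Z^2}a(z-p)\varepsilon(p),\qquad X(z)=A_k(Y(z))\ \ (A_k\text{ relative to the law of }Y(z)),$$ $$Y^{\bullet k}(z)=\sum_{w_1,\dots,w_k\ \text{pairwise distinct}}\ \prod_{j=1}^k a(z-w_j)\,\varepsilon(w_j),\qquad \mathcal Z(z)=\sum_{w_1,\dots,w_k\ \text{not pairwise distinct}}\Big(\prod_{j=1}^k a(z-w_j)\Big){:}\varepsilon(w_1)\cdots\varepsilon(w_k){:}\,,$$ the sums being over ordered $k$-tuples of sites. For a random field $U$ put $S^U_{\lambda,\gamma}:=\sum_{1\le t\le\lambda,\ 1\le s\le\lambda^\gamma}U(t,s)$. Let $a_\infty(t,s):=\rho(t,s)^{-q_1}L_0(t/\rho(t,s))$ on $\mathbb R^2$, $(a_\infty\star a_\infty)(t,s):=\int_{\mathbb R^2}a_\infty(u,v)a_\infty(t+u,s+v)\,du\,dv$, let $\|\cdot\|_k$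 be the norm of $L^2(\mathbb R^{2k})$, and, as functions of $(u_1,v_1,\dots,u_k,v_k)$, $$h:=\int_{(0,1]^2}\prod_{i=1}^k a_\infty(t-u_i,s-v_i)\,dt\,ds,\quad h_+:=\int_0^1\prod_{i=1}^k a_\infty(u_i,s-v_i)\,ds,\quad h_-:=\int_0^1\prod_{i=1}^k a_\infty(t-u_i,v_i)\,dt.$$ Define $H(\gamma)$ and $c(\gamma)$ as follows: * $\gamma=\gamma_0$: $H=1+\gamma_0-\frac{kp_1}{2}$, $\ c=k!\,\|h\|_k^2$; * $\gamma>\gamma_0$, $kp_2<1$: $H=1+\gamma\big(1-\frac{kp_2}{2}\big)$, $\ c=k!\,\|h_+\|_k^2$; * $\gamma>\gamma_0$, $kp_2>1$: $H=1+\frac{\gamma_0}{2}-\frac{kp_1}{2}+\frac{\gamma}{2}$, $\ c=k!\int_{(0,1]^2\times\mathbb R}\big((a_\infty\star a_\infty)(t_1-t_2,s)\big)^k dt_1\,dt_2\,ds$; * $\gamma<\gamma_0$, $kp_1<1$: $H=\gamma+1-\frac{kp_1}{2}$, $\ c=k!\,\|h_-\|_k^2$; * $\gamma<\gamma_0$,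 $kp_1>1$: $H=\gamma\big(1+\frac{1}{2\gamma_0}-\frac{kp_2}{2}\big)+\frac12$, $\ c=k!\int_{\mathbb R\times(0,1]^2}\big((a_\infty\star a_\infty)(t,s_1-s_2)\big)^k dt\,ds_1\,ds_2$. Then $X(z)=Y^{\bullet k}(z)+\mathcal Z(z)$ almost surely for every $z\in\mathbb Z^2$, and for every $\gamma>0$, as $\lambda\to\infty$, $$\mathrm{Var}(S^X_{\lambda,\gamma})\sim\mathrm{Var}(S^{Y^{\bullet k}}_{\lambda,\gamma}),\qquad \mathrm{Var}(S^{\mathcal Z}_{\lambda,\gamma})=O(\lambda^{1+\gamma}).$$ Moreover, except in the boundary cases ($\gamma>\gamma_0$ and $kp_2=1$, or $\gamma<\gamma_0$ and $kp_1=1$), in which $(H(\gamma),c(\gamma))$ is not defined, one has $H(\gamma)\in\big(\frac{1+\gamma}{2},1+\gamma\big)$, $c(\gamma)>0$ and $$\mathrm{Var}(S^{Y^{\bullet k}}_{\lambda,\gamma})\sim c(\gamma)\,\lambda^{2H(\gamma)}.$$ -/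

import Mathlib

open MeasureTheory ProbabilityTheory Filter Topology Asymptotics Set
open scoped ENNReal

noncomputable section

namespace AppellField

/-! ### Anisotropic kernels on the plane -/

/-- The generalized homogeneous function `ρ(t,s) = (|t|² + |s|^(2 q₂ / q₁))^(1/2)`. -/
def rho (q₁ q₂ : ℝ) (x : ℝ × ℝ) : ℝ :=
  Real.sqrt (|x.1| ^ 2 + |x.2| ^ (2 * q₂ / q₁))

/-- The limit kernel `a_∞(t,s) = ρ(t,s)^(-q₁) L₀(t / ρ(t,s))`. -/
def aInf (q₁ q₂ : ℝ) (L₀ : ℝ → ℝ) (x : ℝ × ℝ) : ℝ :=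
  rho q₁ q₂ x ^ (-q₁) * L₀ (x.1 / rho q₁ q₂ x)

/-- The convolution `(ψ₁ ⋆ ψ₂)(x) = ∫ ψ₁(w) ψ₂(x + w) dw` on the plane. -/
def planeConv (ψ₁ ψ₂ : ℝ × ℝ → ℝ) (x : ℝ × ℝ) : ℝ :=
  ∫ w : ℝ × ℝ, ψ₁ w * ψ₂ (x + w)

/-- `f` is continuous on `[-1,1]` off a finite set. -/
def PiecewiseContinuous (f : ℝ → ℝ) : Prop :=
  ∃ F : Set ℝ, F.Finite ∧ ContinuousOn f (Icc (-1) 1 \ F)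

/-! ### Exponents -/

/-- `Q = 1/q₁ + 1/q₂`. -/
def expQ (q₁ q₂ : ℝ) : ℝ := 1 / q₁ + 1 / q₂

/-- `p₁ = q₁ (2 - Q)`. -/
def expP₁ (q₁ q₂ : ℝ) : ℝ := q₁ * (2 - expQ q₁ q₂)

/-- `p₂ = q₂ (2 - Q)`. -/
def expP₂ (q₁ q₂ : ℝ) : ℝ := q₂ * (2 - expQ q₁ q₂)

/-- `P = 1/p₁ + 1/p₂`. -/
def expP (q₁ q₂ : ℝ) : ℝ := 1 / expP₁ q₁ q₂ + 1 / expP₂ q₁ q₂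

/-- `γ₀ = q₁ / q₂ = p₁ / p₂`. -/
def gamma₀ (q₁ q₂ : ℝ) : ℝ := q₁ / q₂

/-- The cases in which the pair `(H(γ), c(γ))` is not defined:
`γ > γ₀` with `k p₂ = 1`, or `γ < γ₀` with `k p₁ = 1`. -/
def IsBoundary (q₁ q₂ : ℝ) (k : ℕ) (γ : ℝ) : Prop :=
  (gamma₀ q₁ q₂ < γ ∧ k * expP₂ q₁ q₂ = 1) ∨ (γ < gamma₀ q₁ q₂ ∧ k * expP₁ q₁ q₂ = 1)

open Classical in
/-- The exponent `H(γ)`. -/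
def hurst (q₁ q₂ : ℝ) (k : ℕ) (γ : ℝ) : ℝ :=
  if γ = gamma₀ q₁ q₂ then
    1 + gamma₀ q₁ q₂ - k * expP₁ q₁ q₂ / 2
  else if gamma₀ q₁ q₂ < γ then
    if k * expP₂ q₁ q₂ < 1 then
      1 + γ * (1 - k * expP₂ q₁ q₂ / 2)
    else
      (1 + gamma₀ q₁ q₂ / 2 - k * expP₁ q₁ q₂ / 2) + γ / 2
  else
    if k * expP₁ q₁ q₂ < 1 then
      γ + (1 - k * expP₁ q₁ q₂ / 2)
    else
      γ * (1 + 1 / (2 * gamma₀ q₁ q₂) - k * expP₂ q₁ q₂ / 2) + 1 / 2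

/-! ### The asymptotic constant -/

/-- `h(x,y;(u,v)_k) = ∫_{(0,x]×(0,y]} ∏ a_∞(t - u_ℓ, s - v_ℓ) dt ds`. -/
def hKer (q₁ q₂ : ℝ) (L₀ : ℝ → ℝ) (k : ℕ) (x y : ℝ) (w : Fin k → ℝ × ℝ) : ℝ :=
  ∫ z in Ioc (0 : ℝ) x ×ˢ Ioc (0 : ℝ) y, ∏ i, aInf q₁ q₂ L₀ (z - w i)

/-- `h₊(y;(u,v)_k) = ∫_0^y ∏ a_∞(u_i, s - v_i) ds`. -/
def hKerPlus (q₁ q₂ : ℝ) (L₀ : ℝ → ℝ) (k : ℕ) (y : ℝ) (w : Fin k → ℝ × ℝ) : ℝ :=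
  ∫ s in Ioc (0 : ℝ) y, ∏ i, aInf q₁ q₂ L₀ ((w i).1, s - (w i).2)

/-- `h₋(x;(u,v)_k) = ∫_0^x ∏ a_∞(t - u_i, v_i) dt`. -/
def hKerMinus (q₁ q₂ : ℝ) (L₀ : ℝ → ℝ) (k : ℕ) (x : ℝ) (w : Fin k → ℝ × ℝ) : ℝ :=
  ∫ t in Ioc (0 : ℝ) x, ∏ i, aInf q₁ q₂ L₀ (t - (w i).1, (w i).2)

/-- The squared norm `‖h‖_k²` in `L²(ℝ^{2k})`. -/
def sqNorm (k : ℕ) (h : (Fin k → ℝ × ℝ) → ℝ) : ℝ :=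
  ∫ w : Fin k → ℝ × ℝ, h w ^ 2

open Classical in
/-- The constant `c(γ)`. The factor `k!` is the one in `E (∫ h d^k W)² = k! ‖h‖_k²`. -/
def asympConst (q₁ q₂ : ℝ) (L₀ : ℝ → ℝ) (k : ℕ) (γ : ℝ) : ℝ :=
  (k.factorial : ℝ) *
    (if γ = gamma₀ q₁ q₂ then
      sqNorm k (hKer q₁ q₂ L₀ k 1 1)
    else if gamma₀ q₁ q₂ < γ then
      if k * expP₂ q₁ q₂ < 1 then
        sqNorm k (hKerPlus q₁ q₂ L₀ k 1)
      else
        ∫ x in (Ioc (0 : ℝ) 1 ×ˢ Ioc (0 : ℝ) 1) ×ˢ (univ : Set ℝ),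
          planeConv (aInf q₁ q₂ L₀) (aInf q₁ q₂ L₀) (x.1.1 - x.1.2, x.2) ^ k
    else
      if k * expP₁ q₁ q₂ < 1 then
        sqNorm k (hKerMinus q₁ q₂ L₀ k 1)
      else
        ∫ x in (univ : Set ℝ) ×ˢ (Ioc (0 : ℝ) 1 ×ˢ Ioc (0 : ℝ) 1),
          planeConv (aInf q₁ q₂ L₀) (aInf q₁ q₂ L₀) (x.1, x.2.1 - x.2.2) ^ k)

/-! ### Appell polynomials and Wick products -/

/-- The `k`th Appell polynomial relative to the distribution `ν`:
`A_k(x) = (-i)^k d^k/du^k (e^{iux} / ∫ e^{iuξ} ν(dξ))` at `u = 0`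
(a real number whenever `ν` has a finite `k`th absolute moment). -/
def appell (ν : Measure ℝ) (k : ℕ) (x : ℝ) : ℝ :=
  ((-Complex.I) ^ k *
    iteratedDeriv k (fun u : ℝ => Complex.exp (Complex.I * u * x) / charFun ν u) 0).re

variable {Ω : Type*} [MeasurableSpace Ω]

/-- The Wick product `:ε(w₁) ⋯ ε(w_k):`, that is, the product over the distinct points `p` among
`w₁, …, w_k` of `A_m(ε(p))`, where `m` is the multiplicity of `p` and `A_m` is relative to the
distribution of `ε(p)`. -/
def wick (μ : Measure Ω) (ε : ℤ × ℤ → Ω → ℝ) {k : ℕ} (w : Fin k → ℤ × ℤ) (ω : Ω) : ℝ :=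
  ∏ p ∈ Finset.univ.image w,
    appell (μ.map (ε p)) (Finset.univ.filter fun i => w i = p).card (ε p ω)

/-! ### Random fields as sums of `L²`-convergent series -/

open Classical in
/-- The class in `L²(μ)` of a square-integrable random variable. -/
def toL2 (μ : Measure Ω) (f : Ω → ℝ) : Lp ℝ 2 μ :=
  if h : MemLp f 2 μ then h.toLp f else 0

/-- The (unconditional) sum in `L²(μ)` of a family of square-integrable random variables. -/
def l2Sum (μ : Measure Ω) {ι : Type*} (f : ι → Ω → ℝ) : Ω → ℝ :=
  ⇑(∑' i, toL2 μ (f i))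

/-- The moving average `Y(z) = ∑_p a(z - p) ε(p)`, `z ∈ ℤ²`. -/
def movingAverage (μ : Measure Ω) (a : ℤ × ℤ → ℝ) (ε : ℤ × ℤ → Ω → ℝ) (z : ℤ × ℤ) : Ω → ℝ :=
  l2Sum μ fun p : ℤ × ℤ => fun ω => a (z - p) * ε p ω

/-- The subordinated field `X(z) = A_k(Y(z))`, with `A_k` relative to the distribution
of `Y(z)`. -/
def appellField (μ : Measure Ω) (a : ℤ × ℤ → ℝ) (ε : ℤ × ℤ → Ω → ℝ) (k : ℕ)
    (z : ℤ × ℤ) (ω : Ω) : ℝ :=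
  appell (μ.map (movingAverage μ a ε z)) k (movingAverage μ a ε z ω)

/-- The off-diagonal part `Y^{•k}(z)`: the sum of `∏ a(z - w_i) ε(w_i)` over all `k`-tuples of
pairwise distinct sites. -/
def offDiagonal (μ : Measure Ω) (a : ℤ × ℤ → ℝ) (ε : ℤ × ℤ → Ω → ℝ) (k : ℕ)
    (z : ℤ × ℤ) : Ω → ℝ :=
  l2Sum μ fun w : {w : Fin k → ℤ × ℤ // Function.Injective w} =>
    fun ω => (∏ i, a (z - w.1 i)) * ∏ i, ε (w.1 i) ω

/-- The diagonal part `𝒵(z)`: the sum of `∏ a(z - w_i) :ε(w₁) ⋯ ε(w_k):` over all `k`-tuples of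
sites that are not pairwise distinct. -/
def diagonal (μ : Measure Ω) (a : ℤ × ℤ → ℝ) (ε : ℤ × ℤ → Ω → ℝ) (k : ℕ)
    (z : ℤ × ℤ) : Ω → ℝ :=
  l2Sum μ fun w : {w : Fin k → ℤ × ℤ // ¬ Function.Injective w} =>
    fun ω => (∏ i, a (z - w.1 i)) * wick μ ε w.1 ω

/-- The partial sum `S_{l,γ} = ∑_{1 ≤ t ≤ l, 1 ≤ s ≤ l^γ} X(t,s)`. -/
def partialSum (X : ℤ × ℤ → Ω → ℝ) (l γ : ℝ) (ω : Ω) : ℝ :=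
  ∑ z ∈ Finset.Icc (1 : ℤ) ⌊l⌋ ×ˢ Finset.Icc (1 : ℤ) ⌊l ^ γ⌋, X z ω

/-! ### Assumptions -/

/-- The `ε(p)`, `p ∈ ℤ²`, are i.i.d. with mean `0`, variance `1` and `E |ε|^{2k} < ∞`. -/
structure NoiseAssumption (μ : Measure Ω) (ε : ℤ × ℤ → Ω → ℝ) (k : ℕ) : Prop where
  indep : iIndepFun ε μ
  ident : ∀ p, IdentDistrib (ε p) (ε 0) μ μ
  mean_zero : ∫ ω, ε 0 ω ∂μ = 0
  var_one : ∫ ω, ε 0 ω ^ 2 ∂μ = 1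
  moment : MemLp (ε 0) ((2 * k : ℕ) : ℝ≥0∞) μ

/-- `q₁, q₂ > 0`, `1 < Q < 2`, the angular function `L₀` is nonnegative, bounded and piecewise
continuous on `[-1,1]`, and
`a(t,s) = ρ(t,s)^(-q₁) (L₀(t / ρ(t,s)) + o(1))` as `|t| + |s| → ∞`. -/
structure CoefAssumption (q₁ q₂ : ℝ) (L₀ : ℝ → ℝ) (a : ℤ × ℤ → ℝ) : Prop where
  q₁_pos : 0 < q₁
  q₂_pos : 0 < q₂
  one_lt : 1 < expQ q₁ q₂
  lt_two : expQ q₁ q₂ < 2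
  nonneg : ∀ u ∈ Icc (-1 : ℝ) 1, 0 ≤ L₀ u
  bounded : ∃ C : ℝ, ∀ u ∈ Icc (-1 : ℝ) 1, L₀ u ≤ C
  piecewise : PiecewiseContinuous L₀
  asymp : ∃ δ : ℤ × ℤ → ℝ, Tendsto δ cofinite (𝓝 0) ∧ ∀ z : ℤ × ℤ, z ≠ 0 →
    a z = rho q₁ q₂ ((z.1 : ℝ), (z.2 : ℝ)) ^ (-q₁) *
      (L₀ ((z.1 : ℝ) / rho q₁ q₂ ((z.1 : ℝ), (z.2 : ℝ))) + δ z)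

end AppellField

end

set_option linter.unusedSectionVars false

noncomputable section

namespace AppellField

/-! ### Appell sequences -/

/-! The proof has an algebraic half, which reduces every variance to sums over words of sites, and
an analytic half, which finds the growth of those sums by scaling.

Algebra. The generating series of the Appell polynomials, exp(tx) divided by the moment series, is
multiplicative over independent sums. Hence for a finite combination of the noise the kth Appell
value is the sum over words w of length k of the coefficient product times the Wick product
(`isAppell_sum_words`). Wick products whose words have different letter sets are orthogonal, and a
word shares its letter set with boundedly many others. So their Gram matrix has bounded row sums
(`gramBound_wickL2`), and series of Wick products with square summable coefficients converge
unconditionally in L². Passing to the limit gives the same expansion for the moving average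
(`appell_average`). Splitting the words into injective and non-injective ones gives the
decomposition of the field into two orthogonal parts, so that variances add.

For a finite set B of sites, the squared coefficients summed over all words give the double sum over
B of r(z' - z)^k, where r is the correlation of the kernel (`hasSum_boxCoeff_sq`). Non-injective
words contribute only O(|B|) (`boxCoeff_not_injective_le`). On injective words the squared norm is
exactly k! times the sum of squares (`norm_sq_wickSum_injective`). Since k < P, the function r^k is
not summable, so the double sum outgrows |B| (`HomogLimit.tendsto_boxSum_atTop`). Therefore the
diagonal part is negligible and the off-diagonal variance is equivalent to k! times the double sum,
for every γ.

Analysis. Written as an integral of step functions, Λ r(z) converges to the correlation of a_∞ when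
z is rescaled by Λ^(1/p₁) and Λ^(1/p₂) (`CoefAssumption.tendsto_corr`), and that limit is strictly
positive off the origin (`CoefAssumption.corrInf_pos`). Its kth power fits the abstract notion
`HomogLimit` with exponents α = k p₁ and β = k p₂. Dominated convergence then gives three regimes: a
balanced box, a long box with a correlation integrable along the long side, and a long box governed
by the correlation on the long axis. Exchanging the coordinates gives the other two cases. Finally
Tonelli's theorem and the triangular density of a difference of two uniform points identify the
limits with the constants c(γ) (`sqNorm_integral_prod`, `lintegral_Ioc_sub`,
`setIntegral_strip_eq`). -/

/-- `A` is the Appell sequence (up to degree `n`) of the moment sequence `m` at the point `x`. -/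
def IsAppell (m : ℕ → ℝ) (x : ℝ) (A : ℕ → ℝ) (n : ℕ) : Prop :=
  ∀ j ≤ n, x ^ j = ∑ i ∈ Finset.range (j + 1), (j.choose i : ℝ) * m (j - i) * A i

lemma IsAppell.eq_sub {m : ℕ → ℝ} {x : ℝ} {A : ℕ → ℝ} {n : ℕ} (h : IsAppell m x A n)
    (h0 : m 0 = 1) {j : ℕ} (hj : j ≤ n) :
    A j = x ^ j - ∑ i ∈ Finset.range j, (j.choose i : ℝ) * m (j - i) * A i := by
  rw [h j hj, Finset.sum_range_succ]
  simp [h0]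

/-- The recursion is triangular with diagonal coefficient m 0 = 1. This uniqueness is how a Wick
series, once shown to satisfy the recursion, is identified with `appell`. -/
lemma IsAppell.unique {m : ℕ → ℝ} {x : ℝ} {A B : ℕ → ℝ} {n : ℕ} (h0 : m 0 = 1)
    (hA : IsAppell m x A n) (hB : IsAppell m x B n) : ∀ j ≤ n, A j = B j := by
  intro j
  induction j using Nat.strong_induction_on with
  | _ j ih =>
    intro hj
    rw [hA.eq_sub h0 hj, hB.eq_sub h0 hj]
    congr 1
    refine Finset.sum_congr rfl fun i hi => ?_
    rw [ih i (Finset.mem_range.1 hi) ((Finset.mem_range.1 hi).le.trans hj)]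

lemma IsAppell.congr_moments {m m' : ℕ → ℝ} {x : ℝ} {A : ℕ → ℝ} {n : ℕ}
    (h : IsAppell m x A n) (hm : ∀ j ≤ n, m j = m' j) : IsAppell m' x A n := by
  intro j hj
  rw [h j hj]
  refine Finset.sum_congr rfl fun i _ => ?_
  rw [hm _ ((Nat.sub_le _ _).trans hj)]

lemma iteratedDeriv_cexp_I_mul (x : ℝ) (j : ℕ) :
    iteratedDeriv j (fun u : ℝ => Complex.exp (Complex.I * u * x)) =
      fun u : ℝ => (Complex.I * x) ^ j * Complex.exp (Complex.I * u * x) := by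
  induction j with
  | zero => simp
  | succ j ih =>
    rw [iteratedDeriv_succ, ih]
    funext u
    have h1 : HasDerivAt (fun u : ℝ => Complex.I * u * x) (Complex.I * x) u := by
      simpa using ((Complex.ofRealCLM.hasDerivAt (x := u)).const_mul Complex.I).mul_const (x : ℂ)
    have h2 := (h1.cexp.const_mul ((Complex.I * x) ^ j)).deriv
    rw [h2, pow_succ]
    ring

/-- The complex Appell values satisfy the Appell recursion. -/
lemma isAppell_appell {ν : Measure ℝ} [IsProbabilityMeasure ν] {n : ℕ} (hν : MemLp id n ν)
    (x : ℝ) : IsAppell (fun j => ∫ y, y ^ j ∂ν) x (fun j => appell ν j x) n := by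
  set e : ℝ → ℂ := fun u => Complex.exp (Complex.I * u * x) with he
  set φ : ℝ → ℂ := charFun ν with hφ
  have hφ0 : φ 0 = 1 := by simp [hφ]
  have hφc : ContDiff ℝ n φ := contDiff_charFun hν
  have hec : ContDiff ℝ n e := by
    have : ContDiff ℝ n fun u : ℝ => (Complex.I * u * x : ℂ) :=
      (contDiff_const.mul Complex.ofRealCLM.contDiff).mul contDiff_const
    exact this.cexp
  -- The characteristic function may vanish away from 0; only derivatives at 0 matter, so a
  -- neighbourhood is enough.
  have hne : ∀ᶠ u in 𝓝 (0 : ℝ), φ u ≠ 0 :=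
    hφc.continuous.continuousAt.eventually_ne (hφ0 ▸ one_ne_zero)
  have hqc : ContDiffAt ℝ n (fun u => e u / φ u) 0 :=
    by
    simp_rw [div_eq_mul_inv]
    exact hec.contDiffAt.mul (hφc.contDiffAt.inv (by rw [hφ0]; exact one_ne_zero))
  set D : ℕ → ℂ := fun j => iteratedDeriv j (fun u => e u / φ u) 0 with hD
  have hprod : (fun u => (e u / φ u) * φ u) =ᶠ[𝓝 0] e := by
    filter_upwards [hne] with u hu
    field_simp
  have hmom : ∀ j ≤ n, iteratedDeriv j φ 0 = Complex.I ^ j * ((∫ y, y ^ j ∂ν : ℝ) : ℂ) := by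
    intro j hj
    rw [hφ, iteratedDeriv_charFun_zero (hν.mono_exponent (by exact_mod_cast hj))]
  -- Leibniz's rule for the jth derivative at 0 of (e/φ)·φ = e is the recursion, up to powers of i.
  have hrec : ∀ j ≤ n, (x : ℂ) ^ j = ∑ i ∈ Finset.range (j + 1),
      (j.choose i : ℂ) * ((∫ y, y ^ (j - i) ∂ν : ℝ) : ℂ) * ((-Complex.I) ^ i * D i) := by
    intro j hj
    have h1 : iteratedDeriv j (fun u => (e u / φ u) * φ u) 0 = (Complex.I * x) ^ j := by
      rw [hprod.iteratedDeriv_eq j, iteratedDeriv_cexp_I_mul]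
      simp
    have hjn : (j : WithTop ℕ∞) ≤ (n : WithTop ℕ∞) := by exact_mod_cast hj
    rw [show (fun u => (e u / φ u) * φ u) = (fun u => e u / φ u) * φ from rfl, iteratedDeriv_mul
      (hqc.of_le hjn) (hφc.contDiffAt.of_le hjn)] at h1
    have h2 : (x : ℂ) ^ j = (-Complex.I) ^ j * (Complex.I * x) ^ j := by
      rw [← mul_pow]
      congr 1
      rw [← mul_assoc]; simp
    rw [h2, ← h1, Finset.mul_sum]
    refine Finset.sum_congr rfl fun i hi => ?_
    have hij : i ≤ j := Nat.lt_succ_iff.1 (Finset.mem_range.1 hi)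
    rw [hmom _ ((Nat.sub_le _ _).trans hj)]
    obtain ⟨d, rfl⟩ := Nat.exists_eq_add_of_le hij
    rw [Nat.add_sub_cancel_left, pow_add]
    have h3 : (-Complex.I) ^ d * Complex.I ^ d = 1 := by
      rw [← mul_pow]; simp
    calc _ = ((-Complex.I) ^ d * Complex.I ^ d) * ((((i + d).choose i : ℕ) : ℂ) *
          ((∫ y, y ^ d ∂ν : ℝ) : ℂ) * ((-Complex.I) ^ i * D i)) := by
          simp only [hD]; ring
      _ = _ := by rw [h3, one_mul]
  have happ : ∀ j, appell ν j x = ((-Complex.I) ^ j * D j).re := fun j => rfl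
  intro j hj
  have h1 := congrArg Complex.re (hrec j hj)
  rw [← Complex.ofReal_pow, Complex.ofReal_re, Complex.re_sum] at h1
  rw [h1]
  refine Finset.sum_congr rfl fun i _ => ?_
  dsimp only
  rw [happ, ← Complex.ofReal_natCast, ← Complex.ofReal_mul, Complex.re_ofReal_mul]

lemma appell_zero (ν : Measure ℝ) [IsProbabilityMeasure ν] (x : ℝ) : appell ν 0 x = 1 := by
  simp [appell]

lemma continuous_appell {ν : Measure ℝ} [IsProbabilityMeasure ν] {n : ℕ} (hν : MemLp id n ν) :
    ∀ j ≤ n, Continuous (appell ν j) := by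
  intro j
  induction j using Nat.strong_induction_on with
  | _ j ih =>
    intro hj
    have : appell ν j = fun x => x ^ j - ∑ i ∈ Finset.range j,
        (j.choose i : ℝ) * (∫ y, y ^ (j - i) ∂ν) * appell ν i x := by
      funext x
      exact (isAppell_appell hν x).eq_sub (by simp) hj
    rw [this]
    refine (continuous_pow j).sub (continuous_finsetSum _ fun i hi => ?_)
    exact continuous_const.mul
      (ih i (Finset.mem_range.1 hi) ((Finset.mem_range.1 hi).le.trans hj))

lemma memLp_pow {ν : Measure ℝ} [IsProbabilityMeasure ν] {n : ℕ}
    (hν : MemLp id ((2 * n : ℕ) : ℝ≥0∞) ν) {j : ℕ} (hj : j ≤ n) :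
    MemLp (fun x : ℝ => x ^ j) 2 ν := by
  rw [memLp_two_iff_integrable_sq (by fun_prop)]
  have h : MemLp id ((2 * j : ℕ) : ℝ≥0∞) ν := hν.mono_exponent (by
    exact_mod_cast Nat.mul_le_mul_left 2 hj)
  refine (h.integrable_norm_pow').congr (ae_of_all _ fun x => ?_)
  simp only [id, Real.norm_eq_abs]
  rw [pow_mul, sq_abs]
  ring

lemma memLp_appell {ν : Measure ℝ} [IsProbabilityMeasure ν] {n : ℕ}
    (hν : MemLp id ((2 * n : ℕ) : ℝ≥0∞) ν) : ∀ j ≤ n, MemLp (appell ν j) 2 ν := by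
  have hν' : MemLp id n ν := hν.mono_exponent (by exact_mod_cast (by omega))
  intro j
  induction j using Nat.strong_induction_on with
  | _ j ih =>
    intro hj
    have : appell ν j = fun x => x ^ j - ∑ i ∈ Finset.range j,
        (j.choose i : ℝ) * (∫ y, y ^ (j - i) ∂ν) * appell ν i x := by
      funext x
      exact (isAppell_appell hν' x).eq_sub (by simp) hj
    rw [this]
    refine (memLp_pow hν hj).sub (memLp_finsetSum _ fun i hi => ?_)
    exact (ih i (Finset.mem_range.1 hi) ((Finset.mem_range.1 hi).le.trans hj)).const_mul _

/-- On integrating the recursion, induction kills every term except i = 0, which cancels the jth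
moment. -/
lemma integral_appell {ν : Measure ℝ} [IsProbabilityMeasure ν] {n : ℕ}
    (hν : MemLp id ((2 * n : ℕ) : ℝ≥0∞) ν) : ∀ j ≤ n, 1 ≤ j → ∫ x, appell ν j x ∂ν = 0 := by
  have hν' : MemLp id n ν := hν.mono_exponent (by exact_mod_cast (by omega))
  have hint : ∀ j ≤ n, Integrable (appell ν j) ν := fun j hj =>
    (memLp_appell hν j hj).integrable (by norm_num)
  intro j
  induction j using Nat.strong_induction_on with
  | _ j ih =>
    intro hj hj1
    have : appell ν j = fun x => x ^ j - ∑ i ∈ Finset.range j,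
        (j.choose i : ℝ) * (∫ y, y ^ (j - i) ∂ν) * appell ν i x := by
      funext x
      exact (isAppell_appell hν' x).eq_sub (by simp) hj
    rw [this, integral_sub ((memLp_pow hν hj).integrable (by norm_num))
      (integrable_finsetSum _ fun i hi =>
        (hint i ((Finset.mem_range.1 hi).le.trans hj)).const_mul _),
      integral_finsetSum _ fun i hi =>
        (hint i ((Finset.mem_range.1 hi).le.trans hj)).const_mul _]
    obtain ⟨j, rfl⟩ := Nat.exists_eq_add_of_le' hj1
    rw [Finset.sum_range_succ', Finset.sum_eq_zero]
    · simp [appell_zero]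
    · intro i hi
      have := Finset.mem_range.1 hi
      rw [integral_const_mul, ih (i + 1) (by omega) (by omega) (by omega), mul_zero]

lemma appell_one {ν : Measure ℝ} [IsProbabilityMeasure ν] {n : ℕ} (hn : 1 ≤ n)
    (hν : MemLp id n ν) (h0 : ∫ x, x ∂ν = 0) (x : ℝ) : appell ν 1 x = x := by
  rw [(isAppell_appell hν x).eq_sub (by simp) hn]
  simp [h0]

/-! ### Generating series of Appell sequences and sums over words -/

/-- The exponential generating series of a sequence. -/
def egf (f : ℕ → ℝ) : PowerSeries ℝ := PowerSeries.mk fun n => f n / n.factorial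

lemma egf_mul (f g : ℕ → ℝ) :
    egf f * egf g =
      egf fun n => ∑ i ∈ Finset.range (n + 1), (n.choose i : ℝ) * f (n - i) * g i := by
  ext n
  rw [mul_comm, PowerSeries.coeff_mul, Finset.Nat.sum_antidiagonal_eq_sum_range_succ_mk]
  simp only [egf, PowerSeries.coeff_mk]
  rw [Finset.sum_div]
  refine Finset.sum_congr rfl fun i hi => ?_
  have hi : i ≤ n := Nat.lt_succ_iff.1 (Finset.mem_range.1 hi)
  rw [Nat.cast_choose ℝ hi]
  field_simp

lemma egf_injective {f g : ℕ → ℝ} (h : egf f = egf g) (n : ℕ) : f n = g n := by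
  have := congrArg (PowerSeries.coeff n) h
  simp only [egf, PowerSeries.coeff_mk] at this
  field_simp at this
  exact this

lemma egf_coeff (φ : PowerSeries ℝ) : (egf fun n => n.factorial * PowerSeries.coeff n φ) = φ := by
  ext n
  simp only [egf, PowerSeries.coeff_mk]
  field_simp

lemma exists_egf (φ : PowerSeries ℝ) : ∃ f, egf f = φ :=
  ⟨_, egf_coeff φ⟩

lemma egf_pow_mul_egf_pow (x y : ℝ) :
    (egf fun n => x ^ n) * (egf fun n => y ^ n) = egf fun n => (x + y) ^ n := by
  rw [egf_mul]
  congr 1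
  funext n
  rw [add_comm x y, add_pow]
  exact Finset.sum_congr rfl fun i _ => by ring

lemma prod_egf_pow {S : Type*} (F : Finset S) (x : S → ℝ) :
    ∏ p ∈ F, (egf fun n => x p ^ n) = egf fun n => (∑ p ∈ F, x p) ^ n := by
  classical
  induction F using Finset.induction_on with
  | empty =>
    ext n
    simp only [Finset.prod_empty, Finset.sum_empty, egf, PowerSeries.coeff_mk,
      PowerSeries.coeff_one]
    split_ifs with h
    · simp [h]
    · simp [h]
  | insert p F hp ih => rw [Finset.prod_insert hp, ih, egf_pow_mul_egf_pow, Finset.sum_insert hp]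

/-- The sum of `∏_p b p (multiplicity of p in w)` over all words `w` of length `n` in `F` is
`n!` times a coefficient of the product of the exponential generating series of the `b p`. -/
lemma sum_words {S : Type*} [DecidableEq S] (F : Finset S) (b : S → ℕ → ℝ) (n : ℕ) :
    ∑ w ∈ Fintype.piFinset fun _ : Fin n => F,
        ∏ p ∈ F, b p (Finset.univ.filter fun i => w i = p).card =
      n.factorial * PowerSeries.coeff n (∏ p ∈ F, egf (b p)) := by
  -- The linear functional Λ replaces the monomial X^m by ∏ b p (m p). Applied to (∑ X_p)^n it is
  -- computed twice: expanding into words gives the left side, the multinomial theorem gives the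
  -- right side.
  set Λ : MvPolynomial S ℝ →ₗ[ℝ] ℝ := (MvPolynomial.basisMonomials S ℝ).constr ℝ
    fun m : S →₀ ℕ => ∏ p ∈ F, b p (m p) with hΛ
  have hΛm : ∀ m : S →₀ ℕ, Λ (MvPolynomial.monomial m 1) = ∏ p ∈ F, b p (m p) := by
    intro m
    have := (MvPolynomial.basisMonomials S ℝ).constr_basis ℝ
      (fun m : S →₀ ℕ => ∏ p ∈ F, b p (m p)) m
    rwa [MvPolynomial.coe_basisMonomials] at this
  have h1 : Λ ((∑ p ∈ F, MvPolynomial.X p) ^ n) = ∑ w ∈ Fintype.piFinset fun _ : Fin n => F,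
        ∏ p ∈ F, b p (Finset.univ.filter fun i => w i = p).card := by
    rw [Finset.sum_pow', map_sum]
    refine Finset.sum_congr rfl fun w _ => ?_
    have : ∏ i, (MvPolynomial.X (w i) : MvPolynomial S ℝ) =
        MvPolynomial.monomial (∑ i, Finsupp.single (w i) 1) 1 := by
      rw [MvPolynomial.monomial_sum_one]
      rfl
    rw [this, hΛm]
    refine Finset.prod_congr rfl fun p _ => ?_
    congr 1
    rw [Finsupp.finsetSum_apply, Finset.card_filter]
    simp [Finsupp.single_apply]
  have h2 : Λ ((∑ p ∈ F, MvPolynomial.X p) ^ n) = ∑ l ∈ F.piAntidiag n,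
      (Nat.multinomial F l : ℝ) * ∏ p ∈ F, b p (l p) := by
    rw [Finset.sum_pow_eq_sum_piAntidiag, map_sum]
    refine Finset.sum_congr rfl fun l _ => ?_
    have : ∏ p ∈ F, (MvPolynomial.X p : MvPolynomial S ℝ) ^ l p =
        MvPolynomial.monomial (∑ p ∈ F, Finsupp.single p (l p)) 1 := by
      rw [MvPolynomial.monomial_sum_one]
      exact Finset.prod_congr rfl fun p _ => MvPolynomial.X_pow_eq_monomial
    rw [this, ← nsmul_eq_mul, map_nsmul, hΛm, nsmul_eq_mul]
    congr 1
    refine Finset.prod_congr rfl fun p hp => ?_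
    congr 1
    rw [Finsupp.finsetSum_apply]
    simp [Finsupp.single_apply, hp]
  rw [← h1, h2, PowerSeries.coeff_prod, Finset.mul_sum]
  symm
  refine Finset.sum_bij (fun l _ => ⇑l) ?_ ?_ ?_ ?_
  · intro l hl
    rw [Finset.mem_finsuppAntidiag] at hl
    rw [Finset.mem_piAntidiag]
    exact ⟨hl.1, fun i hi => hl.2 (Finsupp.mem_support_iff.2 hi)⟩
  · intro l _ l' _ h
    exact DFunLike.coe_injective h
  · intro f hf
    rw [Finset.mem_piAntidiag] at hf
    refine ⟨Finsupp.onFinset F f fun p hp => hf.2 p hp, ?_, rfl⟩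
    rw [Finset.mem_finsuppAntidiag]
    exact ⟨hf.1, Finsupp.support_onFinset_subset⟩
  · intro l hl
    rw [Finset.mem_finsuppAntidiag] at hl
    have h3 := Nat.multinomial_spec F l
    rw [hl.1] at h3
    simp only [egf, PowerSeries.coeff_mk]
    rw [Finset.prod_div_distrib, ← h3]
    push_cast
    have : (∏ p ∈ F, ((l p).factorial : ℝ)) ≠ 0 :=
      Finset.prod_ne_zero_iff.2 fun p _ => by positivity
    field_simp

/-- The recursion is the identity exp(xt) = m(t) A(t) between formal series, which is what makes
Appell sequences multiplicative over independent sums. -/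
lemma isAppell_iff_egf {m A : ℕ → ℝ} {x : ℝ} :
    (∀ n, IsAppell m x A n) ↔ (egf fun n => x ^ n) = egf m * egf A := by
  rw [egf_mul]
  constructor
  · intro h
    congr 1
    funext n
    exact h n n le_rfl
  · intro h n j _
    exact egf_injective h j

/-- The moment series has constant coefficient m 0 = 1, hence is invertible. -/
lemma exists_isAppell {m : ℕ → ℝ} (h0 : m 0 = 1) (x : ℝ) :
    ∃ A : ℕ → ℝ, ∀ n, IsAppell m x A n := by
  obtain ⟨A, hA⟩ := exists_egf ((egf fun n => x ^ n) * (egf m)⁻¹)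
  refine ⟨A, isAppell_iff_egf.2 ?_⟩
  rw [hA, mul_left_comm, PowerSeries.mul_inv_cancel, mul_one]
  simp [egf, h0]

lemma egf_const_pow_mul (c : ℝ) (f : ℕ → ℝ) :
    (egf fun n => c ^ n * f n) = PowerSeries.rescale c (egf f) := by
  ext n
  simp only [egf, PowerSeries.coeff_mk, PowerSeries.coeff_rescale]
  ring

/-- The moments (formally) of `∑_{p ∈ F} c p X_p`, the `X_p` being i.i.d. with moments `m`. -/
def sumMoment {S : Type*} (m : ℕ → ℝ) (c : S → ℝ) (F : Finset S) (j : ℕ) : ℝ :=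
  j.factorial * PowerSeries.coeff j (∏ p ∈ F, egf fun n => c p ^ n * m n)

lemma egf_sumMoment {S : Type*} (m : ℕ → ℝ) (c : S → ℝ) (F : Finset S) :
    egf (sumMoment m c F) = ∏ p ∈ F, egf fun n => c p ^ n * m n :=
  egf_coeff _

lemma sumMoment_zero {S : Type*} {m : ℕ → ℝ} (h0 : m 0 = 1) (c : S → ℝ) (F : Finset S) :
    sumMoment m c F 0 = 1 := by
  simp [sumMoment, egf, h0, map_prod]

lemma prod_word_pow {S : Type*} [DecidableEq S] {F : Finset S} (c : S → ℝ) {j : ℕ}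
    {w : Fin j → S} (hw : ∀ i, w i ∈ F) :
    ∏ i, c (w i) = ∏ p ∈ F, c p ^ (Finset.univ.filter fun i => w i = p).card := by
  rw [← Finset.prod_fiberwise_of_maps_to (s := Finset.univ) (t := F) (g := w) fun i _ => hw i]
  refine Finset.prod_congr rfl fun p _ => ?_
  rw [Finset.prod_congr rfl fun i hi => by rw [(Finset.mem_filter.1 hi).2], Finset.prod_const]

lemma prod_image_word {S : Type*} [DecidableEq S] {F : Finset S} (A : S → ℕ → ℝ)
    (hA : ∀ p, A p 0 = 1) {j : ℕ} {w : Fin j → S} (hw : ∀ i, w i ∈ F) :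
    ∏ p ∈ Finset.univ.image w, A p (Finset.univ.filter fun i => w i = p).card =
      ∏ p ∈ F, A p (Finset.univ.filter fun i => w i = p).card := by
  refine Finset.prod_subset (fun p hp => ?_) fun p _ hp => ?_
  · obtain ⟨i, -, rfl⟩ := Finset.mem_image.1 hp
    exact hw i
  · rw [Finset.card_eq_zero.2, hA]
    refine Finset.filter_eq_empty_iff.2 fun i _ hi => hp ?_
    exact Finset.mem_image.2 ⟨i, Finset.mem_univ i, hi⟩

/-- The Appell sequence of a linear combination of independent variables is the sum of Wick
products over words. -/
lemma isAppell_sum_words {S : Type*} [DecidableEq S] {m : ℕ → ℝ} (h0 : m 0 = 1) (c x : S → ℝ)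
    (F : Finset S) (A : S → ℕ → ℝ) {n : ℕ} (hA : ∀ p, IsAppell m (x p) (A p) n) :
    IsAppell (sumMoment m c F) (∑ p ∈ F, c p * x p)
      (fun j => ∑ w ∈ Fintype.piFinset fun _ : Fin j => F, (∏ i, c (w i)) *
        ∏ p ∈ Finset.univ.image w, A p (Finset.univ.filter fun i => w i = p).card) n := by
  -- The `A p` satisfy the recursion only up to degree n. Full sequences B with the same initial
  -- terms allow the use of identities between formal series; words of length at most n do not see
  -- the difference.
  choose B hB using fun p => exists_isAppell h0 (x p)
  have hBA : ∀ p, ∀ j ≤ n, A p j = B p j := fun p => (hA p).unique h0 (hB p n)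
  have hB0 : ∀ p, B p 0 = 1 := fun p => by simpa using (hB p 0).eq_sub h0 le_rfl
  have hW : ∀ j ≤ n, ∑ w ∈ Fintype.piFinset fun _ : Fin j => F, (∏ i, c (w i)) *
        ∏ p ∈ Finset.univ.image w, A p (Finset.univ.filter fun i => w i = p).card =
      j.factorial * PowerSeries.coeff j (∏ p ∈ F, egf fun n => c p ^ n * B p n) := by
    intro j hj
    rw [← sum_words]
    refine Finset.sum_congr rfl fun w hw => ?_
    have hw : ∀ i, w i ∈ F := Fintype.mem_piFinset.1 hw
    rw [Finset.prod_mul_distrib, ← prod_word_pow c hw, ← prod_image_word B hB0 hw]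
    congr 1
    refine Finset.prod_congr rfl fun p _ => hBA p _ ?_
    exact (Finset.card_le_univ _).trans (by simpa using hj)
  -- The exponential of t ∑ c_p x_p is the product of the exp(c_p x_p t), and the factor at p is the
  -- identity for `B p` with t rescaled by c_p.
  have key : ∀ n, IsAppell (sumMoment m c F) (∑ p ∈ F, c p * x p)
      (fun j => j.factorial * PowerSeries.coeff j (∏ p ∈ F, egf fun n => c p ^ n * B p n)) n := by
    refine isAppell_iff_egf.2 ?_
    have h1 : (egf fun j => j.factorial *
        PowerSeries.coeff j (∏ p ∈ F, egf fun n => c p ^ n * B p n)) =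
        ∏ p ∈ F, egf fun n => c p ^ n * B p n := egf_coeff _
    rw [h1, egf_sumMoment, ← Finset.prod_mul_distrib, ← prod_egf_pow]
    refine Finset.prod_congr rfl fun p _ => ?_
    rw [egf_const_pow_mul, egf_const_pow_mul, ← map_mul, ← isAppell_iff_egf.1 (hB p),
      ← egf_const_pow_mul]
    congr 1
    funext n
    rw [mul_pow]
  intro j hj
  rw [key n j hj]
  refine Finset.sum_congr rfl fun i hi => ?_
  dsimp only
  rw [hW i ((Nat.lt_succ_iff.1 (Finset.mem_range.1 hi)).trans hj)]

/-! ### Almost orthogonal families in a Hilbert space -/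

section AlmostOrthogonal

variable {ι H : Type*} [NormedAddCommGroup H] [InnerProductSpace ℝ H]

/-- Every row of the Gram matrix of `g` is absolutely summable, with sum at most `C`. -/
def GramBound (g : ι → H) (C : ℝ) : Prop :=
  ∀ i (T : Finset ι), ∑ j ∈ T, |inner ℝ (g i) (g j)| ≤ C

lemma GramBound.nonneg {g : ι → H} {C : ℝ} (h : GramBound g C) (i : ι) : 0 ≤ C := by
  simpa using h i ∅

/-- Schur's test: each cross term c_i c_j is split as at most (c_i² + c_j²)/2, and the symmetric
Gram matrix is then summed along rows. -/
lemma GramBound.norm_sum_sq_le {g : ι → H} {C : ℝ} (h : GramBound g C) (c : ι → ℝ)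
    (T : Finset ι) : ‖∑ i ∈ T, c i • g i‖ ^ 2 ≤ C * ∑ i ∈ T, c i ^ 2 := by
  rw [← real_inner_self_eq_norm_sq, sum_inner]
  simp_rw [inner_sum, real_inner_smul_left, real_inner_smul_right]
  have h1 : ∀ i j, c i * (c j * inner ℝ (g i) (g j)) ≤
      c i ^ 2 / 2 * |inner ℝ (g i) (g j)| + c j ^ 2 / 2 * |inner ℝ (g j) (g i)| := by
    intro i j
    rw [real_inner_comm (g i) (g j)]
    have h2 : c i * (c j * inner ℝ (g i) (g j)) ≤ |c i * c j| * |inner ℝ (g i) (g j)| := by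
      rw [← abs_mul, ← mul_assoc]
      exact le_abs_self _
    have h3 : |c i * c j| ≤ c i ^ 2 / 2 + c j ^ 2 / 2 := by
      rw [abs_mul]
      nlinarith [sq_nonneg (|c i| - |c j|), sq_abs (c i), sq_abs (c j)]
    nlinarith [abs_nonneg (inner ℝ (g i) (g j))]
  calc _ ≤ ∑ i ∈ T, ∑ j ∈ T, (c i ^ 2 / 2 * |inner ℝ (g i) (g j)| +
        c j ^ 2 / 2 * |inner ℝ (g j) (g i)|) :=
        Finset.sum_le_sum fun i _ => Finset.sum_le_sum fun j _ => h1 i j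
    _ = ∑ i ∈ T, c i ^ 2 * ∑ j ∈ T, |inner ℝ (g i) (g j)| := by
        simp_rw [Finset.sum_add_distrib]
        rw [Finset.sum_comm (f := fun i j => c j ^ 2 / 2 * |inner ℝ (g j) (g i)|),
          ← Finset.sum_add_distrib]
        refine Finset.sum_congr rfl fun i _ => ?_
        rw [← Finset.sum_add_distrib, Finset.mul_sum]
        exact Finset.sum_congr rfl fun j _ => by ring
    _ ≤ ∑ i ∈ T, c i ^ 2 * C :=
        Finset.sum_le_sum fun i _ => mul_le_mul_of_nonneg_left (h i T) (sq_nonneg _)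
    _ = C * ∑ i ∈ T, c i ^ 2 := by rw [← Finset.sum_mul, mul_comm]

lemma GramBound.summable [CompleteSpace H] {g : ι → H} {C : ℝ} (h : GramBound g C) {c : ι → ℝ}
    (hc : Summable fun i => c i ^ 2) : Summable fun i => c i • g i := by
  rw [summable_iff_vanishing_norm]
  intro e he
  -- An index is needed to know that C is nonnegative.
  rcases isEmpty_or_nonempty ι with hι | ⟨⟨i₀⟩⟩
  · exact ⟨∅, fun t _ => by simpa [Finset.eq_empty_of_isEmpty t] using he⟩
  have hC := h.nonneg i₀
  obtain ⟨s, hs⟩ := summable_iff_vanishing_norm.1 hc (e ^ 2 / (C + 1)) (by positivity)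
  refine ⟨s, fun t ht => ?_⟩
  have h1 := hs t ht
  rw [Real.norm_of_nonneg (Finset.sum_nonneg fun i _ => sq_nonneg _)] at h1
  refine lt_of_pow_lt_pow_left₀ 2 he.le ((h.norm_sum_sq_le c t).trans_lt ?_)
  rw [lt_div_iff₀ (by positivity)] at h1
  have : 0 ≤ ∑ i ∈ t, c i ^ 2 := Finset.sum_nonneg fun i _ => sq_nonneg _
  nlinarith

lemma GramBound.norm_tsum_sq_le [CompleteSpace H] {g : ι → H} {C : ℝ} (h : GramBound g C)
    {c : ι → ℝ} (hc : Summable fun i => c i ^ 2) :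
    ‖∑' i, c i • g i‖ ^ 2 ≤ C * ∑' i, c i ^ 2 :=
  le_of_tendsto_of_tendsto' (((h.summable hc).hasSum.norm).pow 2) (hc.hasSum.mul_left C)
    fun T => by
      rw [← Finset.mul_sum]
      exact h.norm_sum_sq_le c T

lemma GramBound.comp_injective {κ : Type*} {g : ι → H} {C : ℝ} (h : GramBound g C) {f : κ → ι}
    (hf : Function.Injective f) : GramBound (g ∘ f) C := fun i T => by
  simpa using h (f i) (T.map ⟨f, hf⟩)

end AlmostOrthogonal

/-! ### Products of functions of independent variables -/

variable {Ω : Type*} [MeasurableSpace Ω]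

lemma integral_prod_indep {S : Type*} {μ : Measure Ω} [IsProbabilityMeasure μ] {ε : S → Ω → ℝ}
    (hind : iIndepFun ε μ) (hm : ∀ p, AEMeasurable (ε p) μ) (T : Finset S) (f : S → ℝ → ℝ)
    (hf : ∀ p ∈ T, Integrable (f p) (μ.map (ε p))) :
    Integrable (fun ω => ∏ p ∈ T, f p (ε p ω)) μ ∧
      ∫ ω, ∏ p ∈ T, f p (ε p ω) ∂μ = ∏ p ∈ T, ∫ x, f p x ∂(μ.map (ε p)) := by
  have hT : iIndepFun (fun p : T => ε p) μ := hind.precomp Subtype.val_injective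
  have hmap := iIndepFun.map_fun_eq_pi_map (f := fun p : T => ε p) (fun p => hm p) hT
  have hpr : ∀ p, IsProbabilityMeasure (μ.map (ε p)) := fun p =>
    Measure.isProbabilityMeasure_map (hm p)
  have hint : Integrable (fun x : T → ℝ => ∏ p : T, f p (x p))
      (Measure.pi fun p : T => μ.map (ε p)) :=
    Integrable.fintype_prod_dep (f := fun (p : T) x => f p x) fun p => hf p p.2
  rw [← hmap] at hint
  have haem : AEMeasurable (fun ω (p : T) => ε p ω) μ := aemeasurable_pi_lambda _ fun p => hm p
  simp_rw [← Finset.prod_coe_sort T]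
  refine ⟨(integrable_map_measure hint.aestronglyMeasurable haem).1 hint, ?_⟩
  rw [← integral_map (f := fun x : T → ℝ => ∏ p : T, f p (x p)) haem hint.aestronglyMeasurable, hmap]
  exact integral_fintype_prod_eq_prod (fun (p : T) x => f p x)

/-! ### Wick products of the noise -/

section Noise

variable {μ : Measure Ω} [IsProbabilityMeasure μ] {ε : ℤ × ℤ → Ω → ℝ} {k : ℕ}

lemma NoiseAssumption.map_eq (h : NoiseAssumption μ ε k) (p : ℤ × ℤ) :
    μ.map (ε p) = μ.map (ε 0) := (h.ident p).map_eq

lemma NoiseAssumption.aemeasurable (h : NoiseAssumption μ ε k) (p : ℤ × ℤ) :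
    AEMeasurable (ε p) μ := (h.ident p).aemeasurable_fst

lemma NoiseAssumption.isProbabilityMeasure (h : NoiseAssumption μ ε k) (p : ℤ × ℤ) :
    IsProbabilityMeasure (μ.map (ε p)) := Measure.isProbabilityMeasure_map (h.aemeasurable p)

lemma NoiseAssumption.memLp (h : NoiseAssumption μ ε k) :
    MemLp id ((2 * k : ℕ) : ℝ≥0∞) (μ.map (ε 0)) :=
  (memLp_map_measure_iff aestronglyMeasurable_id (h.aemeasurable 0)).2 h.moment

lemma NoiseAssumption.memLp' (h : NoiseAssumption μ ε k) :
    MemLp id (k : ℝ≥0∞) (μ.map (ε 0)) :=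
  have := h.isProbabilityMeasure 0
  h.memLp.mono_exponent (by exact_mod_cast (by omega))

/-- Since A_0 = 1, extra sites contribute nothing. Two words can thus be compared over a common set
of sites. -/
lemma wick_eq_prod (h : NoiseAssumption μ ε k) {j : ℕ} (w : Fin j → ℤ × ℤ)
    {T : Finset (ℤ × ℤ)} (hT : ∀ i, w i ∈ T) (ω : Ω) :
    wick μ ε w ω = ∏ p ∈ T,
      appell (μ.map (ε 0)) (Finset.univ.filter fun i => w i = p).card (ε p ω) := by
  have := h.isProbabilityMeasure 0
  rw [wick, ← prod_image_word (fun p j => appell (μ.map (ε 0)) j (ε p ω))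
    (fun p => appell_zero _ _) hT]
  exact Finset.prod_congr rfl fun p _ => by rw [h.map_eq p]

lemma card_filter_le_length {j : ℕ} (w : Fin j → ℤ × ℤ) (p : ℤ × ℤ) :
    (Finset.univ.filter fun i => w i = p).card ≤ j :=
  (Finset.card_le_univ _).trans (by simp)

/-- The covariance of two Wick products. -/
lemma integral_wick_mul_wick (h : NoiseAssumption μ ε k) {i j : ℕ} (hi : i ≤ k) (hj : j ≤ k)
    (w : Fin i → ℤ × ℤ) (w' : Fin j → ℤ × ℤ) {T : Finset (ℤ × ℤ)} (hT : ∀ l, w l ∈ T)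
    (hT' : ∀ l, w' l ∈ T) :
    Integrable (fun ω => wick μ ε w ω * wick μ ε w' ω) μ ∧
    ∫ ω, wick μ ε w ω * wick μ ε w' ω ∂μ = ∏ p ∈ T,
      ∫ x, appell (μ.map (ε 0)) (Finset.univ.filter fun l => w l = p).card x *
        appell (μ.map (ε 0)) (Finset.univ.filter fun l => w' l = p).card x ∂(μ.map (ε 0)) := by
  have := h.isProbabilityMeasure 0
  simp_rw [wick_eq_prod h w hT, wick_eq_prod h w' hT', ← Finset.prod_mul_distrib]
  have := integral_prod_indep h.indep h.aemeasurable T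
    (fun p x => appell (μ.map (ε 0)) (Finset.univ.filter fun l => w l = p).card x *
        appell (μ.map (ε 0)) (Finset.univ.filter fun l => w' l = p).card x) (fun p _ => by
      rw [h.map_eq p]
      exact (memLp_appell h.memLp _ ((card_filter_le_length _ _).trans hi)).integrable_mul
        (memLp_appell h.memLp _ ((card_filter_le_length _ _).trans hj)))
  refine ⟨this.1, this.2.trans (Finset.prod_congr rfl fun p _ => by rw [h.map_eq p])⟩

lemma aestronglyMeasurable_wick (h : NoiseAssumption μ ε k) {j : ℕ} (hj : j ≤ k)
    (w : Fin j → ℤ × ℤ) : AEStronglyMeasurable (wick μ ε w) μ := by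
  have := h.isProbabilityMeasure 0
  have : wick μ ε w = fun ω => ∏ p ∈ Finset.univ.image w,
      appell (μ.map (ε 0)) (Finset.univ.filter fun i => w i = p).card (ε p ω) :=
    funext fun ω => wick_eq_prod h w (fun i => Finset.mem_image_of_mem _ (Finset.mem_univ i)) ω
  rw [this]
  refine Finset.aestronglyMeasurable_fun_prod _ fun p _ => ?_
  exact (continuous_appell h.memLp' _
    ((card_filter_le_length _ _).trans hj)).comp_aestronglyMeasurable
      (h.aemeasurable p).aestronglyMeasurable

lemma memLp_wick (h : NoiseAssumption μ ε k) {j : ℕ} (hj : j ≤ k) (w : Fin j → ℤ × ℤ) :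
    MemLp (wick μ ε w) 2 μ := by
  rw [memLp_two_iff_integrable_sq (aestronglyMeasurable_wick h hj w)]
  simp_rw [sq]
  exact (integral_wick_mul_wick h hj hj w w (T := Finset.univ.image w)
    (fun i => Finset.mem_image_of_mem _ (Finset.mem_univ i))
    (fun i => Finset.mem_image_of_mem _ (Finset.mem_univ i))).1

/-- The class of a Wick product in `L²`. -/
def wickL2 (μ : Measure Ω) (ε : ℤ × ℤ → Ω → ℝ) {j : ℕ} (w : Fin j → ℤ × ℤ) : Lp ℝ 2 μ :=
  toL2 μ (wick μ ε w)

lemma coeFn_wickL2 (h : NoiseAssumption μ ε k) {j : ℕ} (hj : j ≤ k) (w : Fin j → ℤ × ℤ) :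
    wickL2 μ ε w =ᵐ[μ] wick μ ε w := by
  rw [wickL2, toL2, dif_pos (memLp_wick h hj w)]
  exact MemLp.coeFn_toLp _

lemma inner_wickL2 (h : NoiseAssumption μ ε k) {i j : ℕ} (hi : i ≤ k) (hj : j ≤ k)
    (w : Fin i → ℤ × ℤ) (w' : Fin j → ℤ × ℤ) :
    inner ℝ (wickL2 μ ε w) (wickL2 μ ε w') = ∫ ω, wick μ ε w ω * wick μ ε w' ω ∂μ := by
  rw [L2.inner_def]
  refine integral_congr_ae ?_
  filter_upwards [coeFn_wickL2 h hi w, coeFn_wickL2 h hj w'] with ω h1 h2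
  rw [h1, h2]
  simp [mul_comm]

lemma inner_wickL2_eq_prod (h : NoiseAssumption μ ε k) {i j : ℕ} (hi : i ≤ k) (hj : j ≤ k)
    (w : Fin i → ℤ × ℤ) (w' : Fin j → ℤ × ℤ) :
    inner ℝ (wickL2 μ ε w) (wickL2 μ ε w') =
      ∏ p ∈ Finset.univ.image w ∪ Finset.univ.image w',
      ∫ x, appell (μ.map (ε 0)) (Finset.univ.filter fun l => w l = p).card x *
        appell (μ.map (ε 0)) (Finset.univ.filter fun l => w' l = p).card x ∂(μ.map (ε 0)) := by
  rw [inner_wickL2 h hi hj]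
  exact (integral_wick_mul_wick h hi hj w w'
    (fun l => Finset.mem_union_left _ (Finset.mem_image_of_mem _ (Finset.mem_univ l)))
    (fun l => Finset.mem_union_right _ (Finset.mem_image_of_mem _ (Finset.mem_univ l)))).2

/-- A site occurring in only one of the two words contributes the factor E A_m(ε) with m ≥ 1, which
is 0. -/
lemma inner_wickL2_eq_zero (h : NoiseAssumption μ ε k) {i j : ℕ} (hi : i ≤ k) (hj : j ≤ k)
    (w : Fin i → ℤ × ℤ) (w' : Fin j → ℤ × ℤ)
    (hne : Finset.univ.image w ≠ Finset.univ.image w') :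
    inner ℝ (wickL2 μ ε w) (wickL2 μ ε w') = 0 := by
  have := h.isProbabilityMeasure 0
  have key : ∀ {i j : ℕ}, i ≤ k → j ≤ k → ∀ (w : Fin i → ℤ × ℤ) (w' : Fin j → ℤ × ℤ),
      ¬ Finset.univ.image w ⊆ Finset.univ.image w' →
      inner ℝ (wickL2 μ ε w) (wickL2 μ ε w') = 0 := by
    intro i j hi hj w w' hsub
    obtain ⟨p, hp, hp'⟩ := Finset.not_subset.1 hsub
    rw [inner_wickL2_eq_prod h hi hj]
    refine Finset.prod_eq_zero (Finset.mem_union_left _ hp) ?_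
    have h1 : (Finset.univ.filter fun l => w' l = p).card = 0 := by
      rw [Finset.card_eq_zero]
      exact Finset.filter_eq_empty_iff.2 fun l _ hl =>
        hp' (Finset.mem_image.2 ⟨l, Finset.mem_univ l, hl⟩)
    have h2 : 1 ≤ (Finset.univ.filter fun l => w l = p).card := by
      obtain ⟨l, -, hl⟩ := Finset.mem_image.1 hp
      exact Finset.card_pos.2 ⟨l, by simp [hl]⟩
    simp_rw [h1, appell_zero, mul_one]
    exact integral_appell h.memLp _ ((card_filter_le_length _ _).trans hi) h2
  by_cases hs : Finset.univ.image w ⊆ Finset.univ.image w'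
  · have hs' : ¬ Finset.univ.image w' ⊆ Finset.univ.image w := fun hs' => hne (hs.antisymm hs')
    rw [real_inner_comm]
    exact key hj hi w' w hs'
  · exact key hi hj w w' hs

/-- By orthogonality only words spelled with the letters of w count. There are at most j^j of them,
and each inner product is a product of at most 2j factors bounded by K. -/
lemma gramBound_wickL2 (h : NoiseAssumption μ ε k) {j : ℕ} (hj : j ≤ k) :
    ∃ C, GramBound (fun w : Fin j → ℤ × ℤ => wickL2 μ ε w) C := by
  classical
  set e : ℕ × ℕ → ℝ := fun m => |∫ x, appell (μ.map (ε 0)) m.1 x * appell (μ.map (ε 0)) m.2 x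
    ∂(μ.map (ε 0))| with he
  -- The summand 1 ensures K ≥ 1, so that K to the number of sites is at most K^(2j).
  set K : ℝ := 1 + ∑ m ∈ Finset.range (j + 1) ×ˢ Finset.range (j + 1), e m with hK
  have he0 : ∀ m, 0 ≤ e m := fun m => abs_nonneg _
  have hK1 : 1 ≤ K := by
    have := Finset.sum_nonneg fun m (_ : m ∈ Finset.range (j + 1) ×ˢ Finset.range (j + 1)) => he0 m
    linarith
  have heK : ∀ m m', m ≤ j → m' ≤ j → e (m, m') ≤ K := by
    intro m m' hm hm'
    have := Finset.single_le_sum (fun m (_ : m ∈ Finset.range (j + 1) ×ˢ Finset.range (j + 1)) =>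
      he0 m) (a := (m, m')) (by simp; omega)
    linarith
  have hcard : ∀ w : Fin j → ℤ × ℤ, (Finset.univ.image w).card ≤ j := fun w =>
    Finset.card_image_le.trans (by simp)
  have hb : ∀ w w' : Fin j → ℤ × ℤ, |inner ℝ (wickL2 μ ε w) (wickL2 μ ε w')| ≤ K ^ (2 * j) := by
    intro w w'
    rw [inner_wickL2_eq_prod h hj hj, Finset.abs_prod]
    calc _ ≤ ∏ p ∈ Finset.univ.image w ∪ Finset.univ.image w', K :=
          Finset.prod_le_prod (fun p _ => abs_nonneg _) fun p _ =>
            heK _ _ (card_filter_le_length _ _) (card_filter_le_length _ _)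
      _ = K ^ (Finset.univ.image w ∪ Finset.univ.image w').card := by rw [Finset.prod_const]
      _ ≤ K ^ (2 * j) := pow_le_pow_right₀ hK1 <| by
          have h1 := Finset.card_union_le (Finset.univ.image w) (Finset.univ.image w')
          have h2 := hcard w
          have h3 := hcard w'
          omega
  refine ⟨(j : ℝ) ^ j * K ^ (2 * j), fun w T => ?_⟩
  set U : Finset (Fin j → ℤ × ℤ) := Fintype.piFinset fun _ => Finset.univ.image w with hU
  have hzero : ∀ w' ∈ T, w' ∉ U → |inner ℝ (wickL2 μ ε w) (wickL2 μ ε w')| = 0 := by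
    intro w' _ hw'
    rw [inner_wickL2_eq_zero h hj hj, abs_zero]
    intro heq
    refine hw' (Fintype.mem_piFinset.2 fun i => ?_)
    rw [heq]
    exact Finset.mem_image_of_mem _ (Finset.mem_univ i)
  rw [← Finset.sum_filter_of_ne (p := fun w' => w' ∈ U) fun w' hw' hne =>
    by_contra fun hn => hne (hzero w' hw' hn)]
  calc _ ≤ ∑ w' ∈ U, |inner ℝ (wickL2 μ ε w) (wickL2 μ ε w')| :=
        Finset.sum_le_sum_of_subset_of_nonneg
          (fun w' hw' => (Finset.mem_filter.1 hw').2) fun _ _ _ => abs_nonneg _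
    _ ≤ ∑ w' ∈ U, K ^ (2 * j) := Finset.sum_le_sum fun w' _ => hb w w'
    _ = (U.card : ℝ) * K ^ (2 * j) := by rw [Finset.sum_const, nsmul_eq_mul]
    _ ≤ (j : ℝ) ^ j * K ^ (2 * j) := by
        have h1 : U.card ≤ j ^ j := by
          rw [hU, Fintype.card_piFinset]
          simpa using Nat.pow_le_pow_left (hcard w) j
        have h2 : (U.card : ℝ) ≤ (j : ℝ) ^ j := by exact_mod_cast h1
        exact mul_le_mul_of_nonneg_right h2 (by positivity)

end Noise

/-! ### Sums over words -/

lemma hasSum_words {S : Type*} {n : ℕ} (f : Fin n → S → ℝ) (hf : ∀ i, Summable fun p => ‖f i p‖) :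
    HasSum (fun w : Fin n → S => ∏ i, f i (w i)) (∏ i, ∑' p, f i p) ∧
      Summable fun w : Fin n → S => ‖∏ i, f i (w i)‖ := by
  induction n with
  | zero =>
    have : HasSum (fun w : Fin 0 → S => ∏ i, f i (w i)) (∏ i, ∑' p, f i p) := by
      simp
    exact ⟨this, (hasSum_unique _).summable⟩
  | succ n ih =>
    obtain ⟨ih1, ih2⟩ := ih (fun i => f i.succ) fun i => hf i.succ
    have h1 : HasSum (fun x : S × (Fin n → S) => f 0 x.1 * ∏ i, f (Fin.succ i) (x.2 i))
        ((∑' p, f 0 p) * ∏ i : Fin n, ∑' p, f i.succ p) :=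
      HasSum.mul (g := fun w : Fin n → S => ∏ i, f (Fin.succ i) (w i)) (hf 0).of_norm.hasSum ih1
        (summable_mul_of_summable_norm (g := fun w : Fin n → S => ∏ i, f (Fin.succ i) (w i))
          (hf 0) ih2)
    have h2 : Summable fun x : S × (Fin n → S) => ‖f 0 x.1 * ∏ i, f (Fin.succ i) (x.2 i)‖ :=
      Summable.mul_norm (g := fun w : Fin n → S => ∏ i, f (Fin.succ i) (w i)) (hf 0) ih2
    rw [← (Fin.consEquiv fun _ => S).hasSum_iff, ← (Fin.consEquiv fun _ => S).summable_iff]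
    simp only [Function.comp_def, Fin.consEquiv_apply, Fin.prod_univ_succ, Fin.cons_zero,
      Fin.cons_succ]
    exact ⟨h1, h2⟩

lemma summable_sq_words {S : Type*} {n : ℕ} {c : S → ℝ} (hc : Summable fun p => c p ^ 2) :
    Summable fun w : Fin n → S => (∏ i, c (w i)) ^ 2 := by
  have := (hasSum_words (fun (_ : Fin n) p => c p ^ 2) fun _ => by simpa using hc).1.summable
  refine this.congr fun w => ?_
  rw [Finset.prod_pow]

/-- Unconditional sums over words can therefore be evaluated along the words in a growing finite set
of sites, where the finite Appell identity holds. -/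
lemma tendsto_piFinset_atTop {S : Type*} [DecidableEq S] (n : ℕ) :
    Tendsto (fun F : Finset S => Fintype.piFinset fun _ : Fin n => F) atTop atTop := by
  rw [tendsto_atTop]
  intro T
  refine eventually_atTop.2 ⟨T.biUnion fun w => Finset.univ.image w, fun F hF w hw => ?_⟩
  refine Fintype.mem_piFinset.2 fun i => hF ?_
  exact Finset.mem_biUnion.2 ⟨w, hw, Finset.mem_image_of_mem _ (Finset.mem_univ i)⟩

variable {Ω : Type*} [MeasurableSpace Ω]

/-- Polynomial identities do not pass to L² limits directly; along one common subsequence they pass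
to the limit pointwise. -/
lemma exists_common_subseq {μ : Measure Ω} {ι : Type*} (s : Finset ι) (f : ι → ℕ → Lp ℝ 2 μ)
    (g : ι → Lp ℝ 2 μ) (h : ∀ i ∈ s, Tendsto (f i) atTop (𝓝 (g i))) :
    ∃ ns : ℕ → ℕ, StrictMono ns ∧ ∀ i ∈ s, ∀ᵐ ω ∂μ,
      Tendsto (fun n => f i (ns n) ω) atTop (𝓝 (g i ω)) := by
  classical
  induction s using Finset.induction_on with
  | empty => exact ⟨id, strictMono_id, by simp⟩
  | insert i s _ ih =>
    obtain ⟨ns, hns, hs⟩ := ih fun i hi => h i (Finset.mem_insert_of_mem hi)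
    have h1 := (h i (Finset.mem_insert_self _ _)).comp hns.tendsto_atTop
    obtain ⟨ms, hms, hs'⟩ := (tendstoInMeasure_of_tendsto_Lp h1).exists_seq_tendsto_ae
    refine ⟨ns ∘ ms, hns.comp hms, fun j hj => ?_⟩
    rcases Finset.mem_insert.1 hj with rfl | hj
    · exact hs'
    · filter_upwards [hs j hj] with ω hω
      exact hω.comp hms.tendsto_atTop

lemma toL2_const_mul {μ : Measure Ω} {f : Ω → ℝ} (hf : MemLp f 2 μ) (c : ℝ) :
    toL2 μ (fun ω => c * f ω) = c • toL2 μ f := by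
  have h : MemLp (fun ω => c * f ω) 2 μ := hf.const_mul c
  rw [toL2, toL2, dif_pos h, dif_pos hf, ← MemLp.toLp_const_smul]
  rfl

lemma coeFn_toL2 {μ : Measure Ω} {f : Ω → ℝ} (hf : MemLp f 2 μ) : toL2 μ f =ᵐ[μ] f := by
  rw [toL2, dif_pos hf]
  exact MemLp.coeFn_toLp _

/-! ### Wick series and the Appell polynomial of a moving average -/

section Noise

variable {μ : Measure Ω} [IsProbabilityMeasure μ] {ε : ℤ × ℤ → Ω → ℝ} {k : ℕ}

/-- The sum of the Wick products of length `j` with coefficients `∏ c (w i)`. -/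
def wickSeries (μ : Measure Ω) (ε : ℤ × ℤ → Ω → ℝ) (c : ℤ × ℤ → ℝ) (j : ℕ) : Lp ℝ 2 μ :=
  ∑' w : Fin j → ℤ × ℤ, (∏ i, c (w i)) • wickL2 μ ε w

/-- The partial sums of the Wick series over words in `F`. -/
def wickPartial (μ : Measure Ω) (ε : ℤ × ℤ → Ω → ℝ) (c : ℤ × ℤ → ℝ) (F : Finset (ℤ × ℤ)) (j : ℕ) :
    Lp ℝ 2 μ :=
  ∑ w ∈ Fintype.piFinset fun _ : Fin j => F, (∏ i, c (w i)) • wickL2 μ ε w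

lemma tendsto_wickPartial (h : NoiseAssumption μ ε k) {c : ℤ × ℤ → ℝ}
    (hc : Summable fun p => c p ^ 2) {j : ℕ} (hj : j ≤ k) :
    Tendsto (fun F => wickPartial μ ε c F j) atTop (𝓝 (wickSeries μ ε c j)) := by
  obtain ⟨C, hC⟩ := gramBound_wickL2 h hj
  exact (hC.summable (summable_sq_words hc)).hasSum.comp (tendsto_piFinset_atTop j)

lemma coeFn_wickPartial (h : NoiseAssumption μ ε k) (c : ℤ × ℤ → ℝ) (F : Finset (ℤ × ℤ)) {j : ℕ}
    (hj : j ≤ k) : wickPartial μ ε c F j =ᵐ[μ] fun ω =>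
      ∑ w ∈ Fintype.piFinset fun _ : Fin j => F, (∏ i, c (w i)) * wick μ ε w ω := by
  refine (Lp.coeFn_finsetSum _ _).trans ?_
  have : ∀ᵐ ω ∂μ, ∀ w ∈ Fintype.piFinset fun _ : Fin j => F,
      ((∏ i, c (w i)) • wickL2 μ ε w : Lp ℝ 2 μ) ω = (∏ i, c (w i)) * wick μ ε w ω := by
    rw [Finset.eventually_all]
    intro w _
    filter_upwards [Lp.coeFn_smul (∏ i, c (w i)) (wickL2 μ ε w), coeFn_wickL2 h hj w] with ω h1 h2
    rw [h1, Pi.smul_apply, h2, smul_eq_mul]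
  filter_upwards [this] with ω hω
  rw [Finset.sum_apply]
  exact Finset.sum_congr rfl hω

lemma memLp_noise (h : NoiseAssumption μ ε k) (hk : 1 ≤ k) (p : ℤ × ℤ) : MemLp (ε p) 2 μ := by
  have h1 : MemLp (ε 0) 2 μ := h.moment.mono_exponent (by exact_mod_cast (by omega))
  exact (h.ident p).symm.memLp_snd h1

lemma wick_empty (ω : Ω) (w : Fin 0 → ℤ × ℤ) : wick μ ε w ω = 1 := by
  simp [wick]

/-- The Wick product of the empty word is the constant 1, so this says that nonempty Wick products
are centred. -/
lemma integral_wickL2 (h : NoiseAssumption μ ε k) {j : ℕ} (hj : j ≤ k) (hj1 : 1 ≤ j)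
    (w : Fin j → ℤ × ℤ) : inner ℝ (wickL2 μ ε (Fin.elim0 : Fin 0 → ℤ × ℤ)) (wickL2 μ ε w) = 0 := by
  refine inner_wickL2_eq_zero h (Nat.zero_le _) hj _ _ fun heq => ?_
  have : w ⟨0, hj1⟩ ∈ Finset.univ.image w := Finset.mem_image_of_mem _ (Finset.mem_univ _)
  rw [← heq] at this
  simp at this

lemma inner_one (h : NoiseAssumption μ ε k) (f : Lp ℝ 2 μ) :
    inner ℝ (wickL2 μ ε (Fin.elim0 : Fin 0 → ℤ × ℤ)) f = ∫ ω, f ω ∂μ := by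
  rw [L2.inner_def]
  refine integral_congr_ae ?_
  filter_upwards [coeFn_wickL2 h (Nat.zero_le k) (Fin.elim0 : Fin 0 → ℤ × ℤ)] with ω h1
  rw [h1, wick_empty]
  simp

lemma isAppell_wickPartial (h : NoiseAssumption μ ε k) (c : ℤ × ℤ → ℝ) (F : Finset (ℤ × ℤ)) (ω : Ω) :
    IsAppell (sumMoment (fun j => ∫ y, y ^ j ∂(μ.map (ε 0))) c F) (∑ p ∈ F, c p * ε p ω)
      (fun j => ∑ w ∈ Fintype.piFinset fun _ : Fin j => F, (∏ i, c (w i)) * wick μ ε w ω) k := by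
  have := h.isProbabilityMeasure 0
  have h1 := isAppell_sum_words (m := fun j => ∫ y, y ^ j ∂(μ.map (ε 0))) (by simp) c
    (fun p => ε p ω) F (fun p j => appell (μ.map (ε p)) j (ε p ω)) (n := k) (fun p => by
      rw [h.map_eq p]
      exact isAppell_appell h.memLp' (ε p ω))
  exact h1

/-- The partial sums of the moving average. -/
def averagePartial (μ : Measure Ω) (ε : ℤ × ℤ → Ω → ℝ) (c : ℤ × ℤ → ℝ) (F : Finset (ℤ × ℤ)) :
    Lp ℝ 2 μ := ∑ p ∈ F, c p • toL2 μ (ε p)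

lemma coeFn_averagePartial (h : NoiseAssumption μ ε k) (hk : 1 ≤ k) (c : ℤ × ℤ → ℝ)
    (F : Finset (ℤ × ℤ)) :
    averagePartial μ ε c F =ᵐ[μ] fun ω => ∑ p ∈ F, c p * ε p ω := by
  refine (Lp.coeFn_finsetSum _ _).trans ?_
  have : ∀ᵐ ω ∂μ, ∀ p ∈ F, (c p • toL2 μ (ε p) : Lp ℝ 2 μ) ω = c p * ε p ω := by
    rw [Finset.eventually_all]
    intro p _
    filter_upwards [Lp.coeFn_smul (c p) (toL2 μ (ε p)), coeFn_toL2 (memLp_noise h hk p)] with ω h1 h2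
    rw [h1, Pi.smul_apply, h2, smul_eq_mul]
  filter_upwards [this] with ω hω
  rw [Finset.sum_apply]
  exact Finset.sum_congr rfl hω

/-- Since A_1(x) = x for a centred law, the noise consists of one-letter Wick products and inherits
their Gram bound. -/
lemma toL2_noise_eq (h : NoiseAssumption μ ε k) (hk : 1 ≤ k) (p : ℤ × ℤ) :
    toL2 μ (ε p) = wickL2 μ ε (fun _ : Fin 1 => p) := by
  have := h.isProbabilityMeasure 0
  rw [wickL2]
  congr 1
  funext ω
  have h0 : ∫ x, x ∂(μ.map (ε 0)) = 0 := by
    exact (integral_map (h.aemeasurable 0) aestronglyMeasurable_id).trans h.mean_zero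
  rw [wick_eq_prod h (fun _ : Fin 1 => p) (T := {p}) (by simp)]
  simp [appell_one hk h.memLp' h0]

lemma summable_average (h : NoiseAssumption μ ε k) (hk : 1 ≤ k) {c : ℤ × ℤ → ℝ}
    (hc : Summable fun p => c p ^ 2) : Summable fun p => c p • toL2 μ (ε p) := by
  obtain ⟨C, hC⟩ := gramBound_wickL2 h hk
  simp_rw [toL2_noise_eq h hk]
  exact (hC.comp_injective (f := fun p (_ : Fin 1) => p) fun p q hpq => congrFun hpq 0).summable hc

lemma integral_wickPartial (h : NoiseAssumption μ ε k) (c : ℤ × ℤ → ℝ) (F : Finset (ℤ × ℤ)) {j : ℕ}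
    (hj : j ≤ k) (hj1 : 1 ≤ j) : ∫ ω, wickPartial μ ε c F j ω ∂μ = 0 := by
  rw [← inner_one h, wickPartial, inner_sum]
  refine Finset.sum_eq_zero fun w _ => ?_
  rw [real_inner_smul_right, integral_wickL2 h hj hj1, mul_zero]

lemma integral_wickSeries (h : NoiseAssumption μ ε k) {c : ℤ × ℤ → ℝ}
    (hc : Summable fun p => c p ^ 2) {j : ℕ} (hj : j ≤ k) (hj1 : 1 ≤ j) :
    ∫ ω, wickSeries μ ε c j ω ∂μ = 0 := by
  rw [← inner_one h]
  refine tendsto_nhds_unique (Tendsto.inner tendsto_const_nhds (tendsto_wickPartial h hc hj)) ?_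
  refine tendsto_const_nhds.congr fun F => ?_
  rw [inner_one h, integral_wickPartial h c F hj hj1]

lemma wickSeries_zero (h : NoiseAssumption μ ε k) (c : ℤ × ℤ → ℝ) :
    wickSeries μ ε c 0 =ᵐ[μ] fun _ => 1 := by
  have : wickSeries μ ε c 0 = wickL2 μ ε (Fin.elim0 : Fin 0 → ℤ × ℤ) := by
    rw [wickSeries, (hasSum_unique _).tsum_eq]
    simp only [Finset.univ_eq_empty, Finset.prod_empty, one_smul]
    congr 1
  rw [this]
  filter_upwards [coeFn_wickL2 h (Nat.zero_le k) (Fin.elim0 : Fin 0 → ℤ × ℤ)] with ω hω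
  rw [hω, wick_empty]

/-- The formal moments of the partial sums are moments. -/
lemma sumMoment_succ (h : NoiseAssumption μ ε k) (hk : 1 ≤ k) (c : ℤ × ℤ → ℝ)
    (F : Finset (ℤ × ℤ)) {j : ℕ} (hj : j + 1 ≤ k) :
    sumMoment (fun j => ∫ y, y ^ j ∂(μ.map (ε 0))) c F (j + 1) =
      ∑ i ∈ Finset.range (j + 1), (j.choose i : ℝ) *
        sumMoment (fun j => ∫ y, y ^ j ∂(μ.map (ε 0))) c F (j - i) *
        inner ℝ (wickPartial μ ε c F i) (averagePartial μ ε c F) := by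
  set M := sumMoment (fun j => ∫ y, y ^ j ∂(μ.map (ε 0))) c F with hM
  have := h.isProbabilityMeasure 0
  have hM0 : M 0 = 1 := sumMoment_zero (by simp) c F
  have hW : ∀ᵐ ω ∂μ, ∀ i ∈ Finset.range (k + 1), wickPartial μ ε c F i ω =
      ∑ w ∈ Fintype.piFinset fun _ : Fin i => F, (∏ i, c (w i)) * wick μ ε w ω := by
    rw [Finset.eventually_all]
    exact fun i hi => coeFn_wickPartial h c F (Nat.lt_succ_iff.1 (Finset.mem_range.1 hi))
  have hWint : ∀ i, Integrable (fun ω => wickPartial μ ε c F i ω) μ := fun i =>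
    (Lp.memLp _).integrable (by norm_num)
  have hA : ∀ᵐ ω ∂μ, IsAppell M (averagePartial μ ε c F ω)
      (fun i => wickPartial μ ε c F i ω) k := by
    filter_upwards [hW, coeFn_averagePartial h hk c F] with ω h1 h2
    intro i hi
    rw [h2, isAppell_wickPartial h c F ω i hi]
    refine Finset.sum_congr rfl fun l hl => ?_
    dsimp only
    rw [h1 l]
    have := Finset.mem_range.1 hl
    exact Finset.mem_range.2 (by omega)
  -- Integrating the recursion in degree j + 1 leaves only the constant Wick term: the formal moment
  -- is the true one.
  have h1 : ∫ ω, averagePartial μ ε c F ω ^ (j + 1) ∂μ = M (j + 1) := by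
    have : ∀ᵐ ω ∂μ, averagePartial μ ε c F ω ^ (j + 1) = ∑ i ∈ Finset.range (j + 1 + 1),
        ((j + 1).choose i : ℝ) * M (j + 1 - i) * wickPartial μ ε c F i ω := by
      filter_upwards [hA] with ω hω using hω (j + 1) hj
    rw [integral_congr_ae this, integral_finsetSum _ fun i _ => (hWint i).const_mul _,
      Finset.sum_range_succ', Finset.sum_eq_zero]
    · rw [integral_const_mul]
      have : ∫ ω, wickPartial μ ε c F 0 ω ∂μ = 1 := by
        rw [integral_congr_ae (coeFn_wickPartial h c F (Nat.zero_le k))]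
        simp [wick_empty]
      simp [this]
    · intro i hi
      have := Finset.mem_range.1 hi
      rw [integral_const_mul, integral_wickPartial h c F (by omega) (by omega), mul_zero]
  -- Only the jth power is expanded, leaving one factor of the average. The moment then involves
  -- lower moments and L² inner products only.
  have h2 : ∀ᵐ ω ∂μ, averagePartial μ ε c F ω ^ (j + 1) = ∑ i ∈ Finset.range (j + 1),
      (j.choose i : ℝ) * M (j - i) * (wickPartial μ ε c F i ω * averagePartial μ ε c F ω) := by
    filter_upwards [hA] with ω hω
    rw [pow_succ, hω j (by omega), Finset.sum_mul]
    exact Finset.sum_congr rfl fun i _ => by ring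
  have h3 : ∀ i, Integrable (fun ω => wickPartial μ ε c F i ω * averagePartial μ ε c F ω) μ :=
    fun i => (Lp.memLp (wickPartial μ ε c F i)).integrable_mul
      (Lp.memLp (averagePartial μ ε c F))
  rw [← h1, integral_congr_ae h2, integral_finsetSum _ fun i _ => (h3 i).const_mul _]
  refine Finset.sum_congr rfl fun i _ => ?_
  rw [integral_const_mul, L2.inner_def]
  congr 1
  refine integral_congr_ae (ae_of_all _ fun ω => ?_)
  simp [mul_comm]

/-- By `sumMoment_succ` a moment is built from lower ones and from inner products, which are
continuous in L². No uniform bound on high moments of the partial sums is needed. -/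
lemma exists_tendsto_sumMoment (h : NoiseAssumption μ ε k) (hk : 1 ≤ k) {c : ℤ × ℤ → ℝ}
    (hc : Summable fun p => c p ^ 2) : ∀ j ≤ k, ∃ l, Tendsto (fun F : Finset (ℤ × ℤ) =>
      sumMoment (fun j => ∫ y, y ^ j ∂(μ.map (ε 0))) c F j) atTop (𝓝 l) := by
  have := h.isProbabilityMeasure 0
  intro j
  induction j using Nat.strong_induction_on with
  | _ j ih =>
    intro hj
    rcases j with _ | j
    · refine ⟨1, tendsto_const_nhds.congr fun F => ?_⟩
      rw [sumMoment_zero (by simp)]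
    · choose! l hl using ih
      refine ⟨∑ i ∈ Finset.range (j + 1), (j.choose i : ℝ) * l (j - i) *
        inner ℝ (wickSeries μ ε c i) (∑' p, c p • toL2 μ (ε p)), ?_⟩
      simp_rw [sumMoment_succ h hk c _ hj]
      refine tendsto_finsetSum _ fun i hi => ?_
      have hi := Finset.mem_range.1 hi
      refine ((hl (j - i) (by omega) (by omega)).const_mul _).mul ?_
      exact (tendsto_wickPartial h hc (by omega)).inner (summable_average h hk hc).hasSum

/-- The Appell polynomial of a moving average is a series of Wick products. -/
lemma appell_average (h : NoiseAssumption μ ε k) (hk : 1 ≤ k) {c : ℤ × ℤ → ℝ}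
    (hc : Summable fun p => c p ^ 2) (Y : Lp ℝ 2 μ) (hY : Y = ∑' p, c p • toL2 μ (ε p)) :
    ∀ᵐ ω ∂μ, appell (μ.map Y) k (Y ω) = wickSeries μ ε c k ω := by
  have := h.isProbabilityMeasure 0
  choose! m hm using exists_tendsto_sumMoment h hk hc
  have hYs : Tendsto (fun F => averagePartial μ ε c F) atTop (𝓝 Y) := by
    rw [hY]; exact (summable_average h hk hc).hasSum
  obtain ⟨F, hF⟩ := exists_seq_tendsto (atTop : Filter (Finset (ℤ × ℤ)))
  have hm0 : m 0 = 1 := tendsto_nhds_unique (hm 0 (Nat.zero_le k)) <|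
    tendsto_const_nhds.congr fun F => by rw [sumMoment_zero (by simp)]
  -- The extra index k + 1 stands for the average itself, so that one subsequence serves for it and
  -- for all the Wick sums.
  obtain ⟨ns, hns, hae⟩ := exists_common_subseq (Finset.range (k + 2))
    (fun i n => if i = k + 1 then averagePartial μ ε c (F n) else wickPartial μ ε c (F n) i)
    (fun i => if i = k + 1 then Y else wickSeries μ ε c i) (by
      intro i hi
      have hi := Finset.mem_range.1 hi
      split_ifs with hik
      · exact hYs.comp hF
      · exact (tendsto_wickPartial h hc (by omega)).comp hF)
  have hW : ∀ᵐ ω ∂μ, ∀ n, ∀ i ∈ Finset.range (k + 1), wickPartial μ ε c (F n) i ω =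
      ∑ w ∈ Fintype.piFinset fun _ : Fin i => F n, (∏ i, c (w i)) * wick μ ε w ω := by
    rw [ae_all_iff]
    intro n
    rw [Finset.eventually_all]
    exact fun i hi => coeFn_wickPartial h c (F n) (Nat.lt_succ_iff.1 (Finset.mem_range.1 hi))
  have hA' : ∀ᵐ ω ∂μ, ∀ n, averagePartial μ ε c (F n) ω = ∑ p ∈ F n, c p * ε p ω := by
    rw [ae_all_iff]
    exact fun n => coeFn_averagePartial h hk c (F n)
  have hae' : ∀ᵐ ω ∂μ, ∀ i ∈ Finset.range (k + 2), Tendsto (fun n => (if i = k + 1 then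
      averagePartial μ ε c (F (ns n)) else wickPartial μ ε c (F (ns n)) i : Lp ℝ 2 μ) ω) atTop
      (𝓝 ((if i = k + 1 then Y else wickSeries μ ε c i : Lp ℝ 2 μ) ω)) := by
    rw [Finset.eventually_all]
    exact hae
  have hA : ∀ᵐ ω ∂μ, IsAppell m (Y ω) (fun i => wickSeries μ ε c i ω) k := by
    filter_upwards [hW, hA', hae'] with ω h1 h2 h3
    intro j hj
    have hYω : Tendsto (fun n => ∑ p ∈ F (ns n), c p * ε p ω) atTop (𝓝 (Y ω)) := by
      have := h3 (k + 1) (by simp)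
      simp only [if_true] at this
      exact this.congr fun n => h2 (ns n)
    refine tendsto_nhds_unique (hYω.pow j) ?_
    have h4 : ∀ n, (∑ p ∈ F (ns n), c p * ε p ω) ^ j = ∑ i ∈ Finset.range (j + 1),
        (j.choose i : ℝ) * sumMoment (fun j => ∫ y, y ^ j ∂(μ.map (ε 0))) c (F (ns n)) (j - i) *
          wickPartial μ ε c (F (ns n)) i ω := by
      intro n
      rw [isAppell_wickPartial h c (F (ns n)) ω j hj]
      refine Finset.sum_congr rfl fun i hi => ?_
      dsimp only
      have := Finset.mem_range.1 hi
      rw [h1 (ns n) i (Finset.mem_range.2 (by omega))]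
    simp_rw [h4]
    refine tendsto_finsetSum _ fun i hi => ?_
    have hi := Finset.mem_range.1 hi
    refine (((hm (j - i) (by omega)).comp (hF.comp hns.tendsto_atTop)).const_mul _).mul ?_
    have := h3 i (Finset.mem_range.2 (by omega))
    simpa only [show ¬ (i = k + 1) by omega, if_false] using this
  have hWL2 : ∀ i, MemLp (fun ω => wickSeries μ ε c i ω) 2 μ := fun i => Lp.memLp _
  have hWint : ∀ i, Integrable (fun ω => wickSeries μ ε c i ω) μ := fun i =>
    (hWL2 i).integrable (by norm_num)
  -- Nothing is assumed about moments of Y. The limit recursion writes Y^j as a combination of L²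
  -- functions, which gives both its integrability and its mean.
  have hpow : ∀ j ≤ k, Integrable (fun ω => Y ω ^ j) μ ∧ ∫ ω, Y ω ^ j ∂μ = m j := by
    intro j hj
    have h1 : (fun ω => Y ω ^ j) =ᵐ[μ] fun ω => ∑ i ∈ Finset.range (j + 1),
        (j.choose i : ℝ) * m (j - i) * wickSeries μ ε c i ω := by
      filter_upwards [hA] with ω hω using hω j hj
    refine ⟨(integrable_finsetSum _ fun i _ => (hWint i).const_mul _).congr h1.symm, ?_⟩
    rw [integral_congr_ae h1, integral_finsetSum _ fun i _ => (hWint i).const_mul _,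
      Finset.sum_range_succ', Finset.sum_eq_zero]
    · rw [integral_const_mul, integral_congr_ae (wickSeries_zero h c)]
      simp
    · intro i hi
      have := Finset.mem_range.1 hi
      rw [integral_const_mul, integral_wickSeries h hc (by omega) (by omega), mul_zero]
  have hYm : AEMeasurable Y μ := (Lp.aestronglyMeasurable Y).aemeasurable
  have hprob : IsProbabilityMeasure (μ.map Y) := Measure.isProbabilityMeasure_map hYm
  have hmem : MemLp id (k : ℝ≥0∞) (μ.map Y) := by
    rw [memLp_map_measure_iff aestronglyMeasurable_id hYm, Function.id_comp,
      ← integrable_norm_rpow_iff (Lp.aestronglyMeasurable Y) (by simp; omega) (by simp)]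
    refine (hpow k le_rfl).1.norm.congr (ae_of_all _ fun ω => ?_)
    simp
  have hmom : ∀ j ≤ k, ∫ y, y ^ j ∂(μ.map Y) = m j := by
    intro j hj
    rw [integral_map hYm (by fun_prop)]
    exact (hpow j hj).2
  filter_upwards [hA] with ω hω
  exact ((isAppell_appell hmem (Y ω)).congr_moments hmom).unique hm0 hω k le_rfl

end Noise

/-! ### Sums over words with a repetition -/

lemma ennreal_tsum_words {S : Type*} {n : ℕ} (f : Fin n → S → ℝ≥0∞) :
    ∑' w : Fin n → S, ∏ i, f i (w i) = ∏ i, ∑' p, f i p := by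
  induction n with
  | zero => rw [(hasSum_unique _).tsum_eq]; simp
  | succ n ih =>
    rw [← (Fin.consEquiv fun _ => S).tsum_eq, ENNReal.tsum_prod', Fin.prod_univ_succ,
      ← ih fun i => f i.succ]
    simp only [Fin.consEquiv_apply, Fin.prod_univ_succ, Fin.cons_zero, Fin.cons_succ,
      ENNReal.tsum_mul_left, ENNReal.tsum_mul_right]

/-- Deleting letter j leaves a free word of length n; the deleted letter equals letter i of it, so
the factor there becomes φ² and the n - 1 others stay φ. -/
lemma ennreal_tsum_words_coincide {S : Type*} [DecidableEq S] {n : ℕ} (φ : S → ℝ≥0∞)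
    (j : Fin (n + 1)) (i : Fin n) :
    ∑' w : Fin (n + 1) → S, (if w j = w (j.succAbove i) then ∏ l, φ (w l) else 0) =
      (∑' p, φ p ^ 2) * (∑' p, φ p) ^ (n - 1) := by
  have h1 : ∀ w' : Fin n → S, ∏ l, (if l = i then fun p => φ p ^ 2 else φ) (w' l) =
      φ (w' i) * ∏ l, φ (w' l) := by
    intro w'
    rw [← Finset.mul_prod_erase Finset.univ _ (Finset.mem_univ i),
      ← Finset.mul_prod_erase Finset.univ (fun l => φ (w' l)) (Finset.mem_univ i), if_pos rfl,
      sq, mul_assoc]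
    congr 2
    refine Finset.prod_congr rfl fun l hl => ?_
    rw [if_neg (Finset.ne_of_mem_erase hl)]
  rw [← (Fin.insertNthEquiv (fun _ => S) j).tsum_eq, ENNReal.tsum_prod', ENNReal.tsum_comm]
  simp only [Fin.insertNthEquiv_apply, Fin.insertNth_apply_same, Fin.insertNth_apply_succAbove,
    Fin.prod_univ_succAbove _ j]
  have h2 : ∀ w' : Fin n → S,
      ∑' p : S, (if p = w' i then φ p * ∏ l, φ (w' l) else 0) = φ (w' i) * ∏ l, φ (w' l) := by
    intro w'
    rw [tsum_eq_single (w' i) fun p hp => if_neg hp, if_pos rfl]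
  simp_rw [h2, ← h1]
  rw [ennreal_tsum_words (fun l => if l = i then fun p => φ p ^ 2 else φ),
    ← Finset.mul_prod_erase Finset.univ _ (Finset.mem_univ i)]
  simp only [if_true]
  congr 1
  rw [Finset.prod_congr rfl fun l hl => by rw [if_neg (Finset.ne_of_mem_erase hl)],
    Finset.prod_const, Finset.card_erase_of_mem (Finset.mem_univ i)]
  simp

/-- Union bound over the (n + 1) n ordered pairs of distinct positions that may carry the same
letter. -/
lemma ennreal_tsum_not_injective_le {S : Type*} [DecidableEq S] {n : ℕ} (φ : S → ℝ≥0∞) :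
    ∑' w : {w : Fin (n + 1) → S // ¬ Function.Injective w}, ∏ l, φ (w.1 l) ≤
      ((n + 1) * n : ℕ) * ((∑' p, φ p ^ 2) * (∑' p, φ p) ^ (n - 1)) := by
  set G : Fin (n + 1) → Fin n → (Fin (n + 1) → S) → ℝ≥0∞ := fun j i w =>
    if w j = w (j.succAbove i) then ∏ l, φ (w l) else 0 with hG
  have h1 : ∀ w : Fin (n + 1) → S, ¬ Function.Injective w → ∏ l, φ (w l) ≤ ∑ j, ∑ i, G j i w := by
    intro w hw
    simp only [Function.Injective, not_forall] at hw
    obtain ⟨j, j', hjj, hne⟩ := hw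
    obtain ⟨i, rfl⟩ := Fin.exists_succAbove_eq (Ne.symm hne)
    have h2 : ∏ l, φ (w l) = G j i w := (if_pos hjj).symm
    rw [h2]
    exact (Finset.single_le_sum (f := fun i => G j i w) (fun _ _ => zero_le)
      (Finset.mem_univ i)).trans (Finset.single_le_sum (f := fun j => ∑ i, G j i w)
      (fun _ _ => zero_le) (Finset.mem_univ j))
  have h3 : ∀ j i, ∑' w, G j i w = (∑' p, φ p ^ 2) * (∑' p, φ p) ^ (n - 1) := fun j i =>
    ennreal_tsum_words_coincide φ j i
  clear_value G
  calc _ ≤ ∑' w : {w : Fin (n + 1) → S // ¬ Function.Injective w}, ∑ j, ∑ i, G j i w.1 :=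
        ENNReal.tsum_le_tsum fun w => h1 w.1 w.2
    _ ≤ ∑' w : Fin (n + 1) → S, ∑ j, ∑ i, G j i w :=
        ENNReal.tsum_comp_le_tsum_of_injective Subtype.val_injective
          (fun w => ∑ j, ∑ i, G j i w)
    _ = _ := by
        rw [Summable.tsum_finsetSum fun _ _ => ENNReal.summable]
        simp_rw [Summable.tsum_finsetSum fun _ _ => ENNReal.summable, h3]
        simp only [Finset.sum_const, Finset.card_univ, Fintype.card_fin, nsmul_eq_mul]
        rw [Nat.cast_mul, mul_assoc]

/-! ### Second moments of sums of a linear field over a finite set -/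

/-- The correlation `r(z) = ∑_p a(p) a(z + p)` of a kernel on the lattice. -/
def corr (a : ℤ × ℤ → ℝ) (z : ℤ × ℤ) : ℝ := ∑' p, a p * a (z + p)

/-- The coefficient of the word `w` in the sum over `z ∈ B` of the Wick series. -/
def boxCoeff (a : ℤ × ℤ → ℝ) (B : Finset (ℤ × ℤ)) {k : ℕ} (w : Fin k → ℤ × ℤ) : ℝ :=
  ∑ z ∈ B, ∏ i, a (z - w i)

section Coefficients

variable {a : ℤ × ℤ → ℝ} (ha : Summable fun p => a p ^ 2)
include ha

lemma summable_sq_shift (z : ℤ × ℤ) : Summable fun p => a (z - p) ^ 2 :=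
  (Equiv.subLeft z).summable_iff.2 ha

lemma summable_mul_shift (z z' : ℤ × ℤ) : Summable fun p => ‖a (z - p) * a (z' - p)‖ := by
  refine Summable.of_nonneg_of_le (fun _ => norm_nonneg _) (fun p => ?_)
    ((summable_sq_shift ha z).add (summable_sq_shift ha z'))
  rw [norm_mul, Real.norm_eq_abs, Real.norm_eq_abs, ← sq_abs (a (z - p)), ← sq_abs (a (z' - p))]
  nlinarith [sq_nonneg (|a (z - p)| - |a (z' - p)|), sq_nonneg (|a (z - p)|),
    sq_nonneg (|a (z' - p)|)]

omit ha in
lemma tsum_mul_shift (z z' : ℤ × ℤ) : ∑' p, a (z - p) * a (z' - p) = corr a (z' - z) := by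
  rw [corr, ← (Equiv.subLeft z).tsum_eq fun q => a q * a (z' - z + q)]
  refine tsum_congr fun p => ?_
  simp only [Equiv.subLeft_apply]
  congr 2
  abel

omit ha in
lemma boxCoeff_sq (B : Finset (ℤ × ℤ)) {k : ℕ} (w : Fin k → ℤ × ℤ) :
    boxCoeff a B w ^ 2 = ∑ z ∈ B, ∑ z' ∈ B, ∏ i, (a (z - w i) * a (z' - w i)) := by
  rw [boxCoeff, sq, Finset.sum_mul_sum]
  simp_rw [Finset.prod_mul_distrib]

/-- After the square is expanded, the sum over words factors into k equal sums over one letter, each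
a correlation. -/
lemma hasSum_boxCoeff_sq (B : Finset (ℤ × ℤ)) (k : ℕ) :
    HasSum (fun w : Fin k → ℤ × ℤ => boxCoeff a B w ^ 2)
      (∑ z ∈ B, ∑ z' ∈ B, corr a (z' - z) ^ k) := by
  simp_rw [boxCoeff_sq]
  refine hasSum_sum fun z _ => hasSum_sum fun z' _ => ?_
  have := (hasSum_words (fun (_ : Fin k) p => a (z - p) * a (z' - p))
    fun _ => summable_mul_shift ha z z').1
  simpa [tsum_mul_shift] using this

/-- A coincidence of letters produces ∑_p a(z - p)² a(z' - p)². Summed over all z' this equals (∑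
a²)², uniformly in z, so only the sum over z in B remains. The other letters cost at most 2 ∑ a²
each. The computation is done in extended nonnegative reals, where sums may be exchanged freely. -/
lemma boxCoeff_not_injective_le (k : ℕ) : ∃ C : ℝ, ∀ B : Finset (ℤ × ℤ),
    ∑' w : {w : Fin k → ℤ × ℤ // ¬ Function.Injective w}, boxCoeff a B w.1 ^ 2 ≤ C * B.card := by
  rcases k with _ | n
  · refine ⟨0, fun B => ?_⟩
    have : IsEmpty {w : Fin 0 → ℤ × ℤ // ¬ Function.Injective w} :=
      ⟨fun w => w.2 (Function.injective_of_subsingleton _)⟩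
    simp
  set α : ℤ × ℤ → ℝ≥0∞ := fun p => ENNReal.ofReal (a p ^ 2) with hα
  set A : ℝ≥0∞ := ∑' p, α p with hA
  have hAtop : A ≠ ⊤ := ha.tsum_ofReal_ne_top
  have hshift : ∀ z, ∑' p, α (z - p) = A := fun z => (Equiv.subLeft z).tsum_eq α
  have hshift' : ∀ p, ∑' z, α (z - p) = A := fun p => (Equiv.subRight p).tsum_eq α
  set φ : ℤ × ℤ → ℤ × ℤ → ℤ × ℤ → ℝ≥0∞ := fun z z' p => ENNReal.ofReal |a (z - p) * a (z' - p)|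
    with hφ
  have hφ2 : ∀ z z' p, φ z z' p ^ 2 = α (z - p) * α (z' - p) := by
    intro z z' p
    simp only [hφ, hα]
    rw [← ENNReal.ofReal_pow (abs_nonneg _), sq_abs, mul_pow, ENNReal.ofReal_mul (sq_nonneg _)]
  have hφ1 : ∀ z z', ∑' p, φ z z' p ≤ 2 * A := by
    intro z z'
    calc ∑' p, φ z z' p ≤ ∑' p, (α (z - p) + α (z' - p)) := by
          refine ENNReal.tsum_le_tsum fun p => ?_
          simp only [hφ, hα]
          rw [← ENNReal.ofReal_add (sq_nonneg _) (sq_nonneg _)]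
          refine ENNReal.ofReal_le_ofReal ?_
          rw [abs_mul, ← sq_abs (a (z - p)), ← sq_abs (a (z' - p))]
          nlinarith [sq_nonneg (|a (z - p)| - |a (z' - p)|), sq_nonneg (|a (z - p)|),
            sq_nonneg (|a (z' - p)|)]
      _ = 2 * A := by rw [ENNReal.tsum_add, hshift, hshift, two_mul]
  have hcoef : ∀ (B : Finset (ℤ × ℤ)) (w : Fin (n + 1) → ℤ × ℤ),
      ENNReal.ofReal (boxCoeff a B w ^ 2) ≤ ∑ z ∈ B, ∑ z' ∈ B, ∏ i, φ z z' (w i) := by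
    intro B w
    rw [boxCoeff_sq]
    calc _ ≤ ENNReal.ofReal (∑ z ∈ B, ∑ z' ∈ B, ∏ i, |a (z - w i) * a (z' - w i)|) := by
          refine ENNReal.ofReal_le_ofReal ?_
          refine Finset.sum_le_sum fun z _ => Finset.sum_le_sum fun z' _ => ?_
          rw [← Finset.abs_prod]
          exact le_abs_self _
      _ = _ := by
          rw [ENNReal.ofReal_sum_of_nonneg fun z _ => Finset.sum_nonneg fun z' _ =>
            Finset.prod_nonneg fun _ _ => abs_nonneg _]
          refine Finset.sum_congr rfl fun z _ => ?_
          rw [ENNReal.ofReal_sum_of_nonneg fun z' _ => Finset.prod_nonneg fun _ _ => abs_nonneg _]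
          refine Finset.sum_congr rfl fun z' _ => ?_
          rw [ENNReal.ofReal_prod_of_nonneg fun _ _ => abs_nonneg _]
  set K : ℝ≥0∞ := ((n + 1) * n : ℕ) * ((A * A) * (2 * A) ^ (n - 1)) with hK
  have hKtop : K ≠ ⊤ := by
    refine ENNReal.mul_ne_top (ENNReal.natCast_ne_top _) ?_
    refine ENNReal.mul_ne_top (ENNReal.mul_ne_top hAtop hAtop) (ENNReal.pow_ne_top ?_)
    exact ENNReal.mul_ne_top (by simp) hAtop
  have hmain : ∀ B : Finset (ℤ × ℤ),
      ∑' w : {w : Fin (n + 1) → ℤ × ℤ // ¬ Function.Injective w},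
        ENNReal.ofReal (boxCoeff a B w.1 ^ 2) ≤ K * B.card := by
    intro B
    calc _ ≤ ∑' w : {w : Fin (n + 1) → ℤ × ℤ // ¬ Function.Injective w},
          ∑ z ∈ B, ∑ z' ∈ B, ∏ i, φ z z' (w.1 i) := ENNReal.tsum_le_tsum fun w => hcoef B w.1
      _ = ∑ z ∈ B, ∑ z' ∈ B, ∑' w : {w : Fin (n + 1) → ℤ × ℤ // ¬ Function.Injective w},
          ∏ i, φ z z' (w.1 i) := by
          rw [Summable.tsum_finsetSum fun _ _ => ENNReal.summable]
          simp_rw [Summable.tsum_finsetSum fun _ _ => ENNReal.summable]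
      _ ≤ ∑ z ∈ B, ∑ z' ∈ B, ((n + 1) * n : ℕ) *
          ((∑' p, φ z z' p ^ 2) * (2 * A) ^ (n - 1)) := by
          refine Finset.sum_le_sum fun z _ => Finset.sum_le_sum fun z' _ => ?_
          refine (ennreal_tsum_not_injective_le (φ z z')).trans ?_
          gcongr
          exact hφ1 z z'
      _ = ∑ z ∈ B, ((n + 1) * n : ℕ) *
          ((∑ z' ∈ B, ∑' p, φ z z' p ^ 2) * (2 * A) ^ (n - 1)) := by
          simp_rw [Finset.sum_mul, Finset.mul_sum]
      _ ≤ ∑ z ∈ B, K := by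
          refine Finset.sum_le_sum fun z _ => ?_
          rw [hK]
          gcongr
          calc ∑ z' ∈ B, ∑' p, φ z z' p ^ 2 ≤ ∑' z', ∑' p, φ z z' p ^ 2 := ENNReal.sum_le_tsum _
            _ = ∑' p, ∑' z', α (z - p) * α (z' - p) := by
                rw [ENNReal.tsum_comm]; simp_rw [hφ2]
            _ = A * A := by
                simp_rw [ENNReal.tsum_mul_left, hshift', ENNReal.tsum_mul_right, hshift]
      _ = K * B.card := by rw [Finset.sum_const, nsmul_eq_mul, mul_comm]
  refine ⟨K.toReal, fun B => ?_⟩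
  have hs : Summable fun w : {w : Fin (n + 1) → ℤ × ℤ // ¬ Function.Injective w} =>
      boxCoeff a B w.1 ^ 2 := (hasSum_boxCoeff_sq ha B (n + 1)).summable.subtype _
  rw [← ENNReal.ofReal_le_ofReal_iff (by positivity),
    ENNReal.ofReal_tsum_of_nonneg (fun _ => sq_nonneg _) hs, ENNReal.ofReal_mul (by positivity),
    ENNReal.ofReal_toReal hKtop, ENNReal.ofReal_natCast]
  exact hmain B

end Coefficients

/-! ### The decomposition of the Appell field and second moments of its partial sums -/

variable {Ω : Type*} [MeasurableSpace Ω]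
variable {μ : Measure Ω} [IsProbabilityMeasure μ] {ε : ℤ × ℤ → Ω → ℝ} {k : ℕ}

/-- The `L²` sum of Wick products over words in a set `s`. -/
def wickSum (μ : Measure Ω) (ε : ℤ × ℤ → Ω → ℝ) {k : ℕ} (s : Set (Fin k → ℤ × ℤ))
    (b : (Fin k → ℤ × ℤ) → ℝ) : Lp ℝ 2 μ :=
  ∑' w : s, b w • wickL2 μ ε w.1

lemma wick_of_injective (h : NoiseAssumption μ ε k) (hk : 1 ≤ k) {w : Fin k → ℤ × ℤ}
    (hw : Function.Injective w) (ω : Ω) : wick μ ε w ω = ∏ i, ε (w i) ω := by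
  have := h.isProbabilityMeasure 0
  have h0 : ∫ x, x ∂(μ.map (ε 0)) = 0 :=
    (integral_map (h.aemeasurable 0) aestronglyMeasurable_id).trans h.mean_zero
  rw [wick, Finset.prod_image fun i _ j _ hij => hw hij]
  refine Finset.prod_congr rfl fun i _ => ?_
  have h1 : (Finset.univ.filter fun l => w l = w i) = {i} := by
    ext l
    simp [hw.eq_iff]
  rw [h1, Finset.card_singleton, h.map_eq, appell_one hk h.memLp' h0]

lemma offDiagonal_eq (h : NoiseAssumption μ ε k) (hk : 1 ≤ k) (a : ℤ × ℤ → ℝ) (z : ℤ × ℤ) :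
    offDiagonal μ a ε k z =
      wickSum μ ε {w : Fin k → ℤ × ℤ | Function.Injective w} fun w => ∏ i, a (z - w i) := by
  rw [offDiagonal, l2Sum, wickSum]
  congr 2
  refine tsum_congr fun w => ?_
  rw [wickL2, ← toL2_const_mul (memLp_wick h le_rfl w.1)]
  congr 1
  funext ω
  rw [wick_of_injective h hk w.2]

lemma diagonal_eq (h : NoiseAssumption μ ε k) (a : ℤ × ℤ → ℝ) (z : ℤ × ℤ) :
    diagonal μ a ε k z =
      wickSum μ ε {w : Fin k → ℤ × ℤ | ¬ Function.Injective w} fun w => ∏ i, a (z - w i) := by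
  rw [diagonal, l2Sum, wickSum]
  congr 2
  refine tsum_congr fun w => ?_
  rw [wickL2, ← toL2_const_mul (memLp_wick h le_rfl w.1)]

lemma movingAverage_eq (h : NoiseAssumption μ ε k) (hk : 1 ≤ k) (a : ℤ × ℤ → ℝ) (z : ℤ × ℤ) :
    movingAverage μ a ε z = ⇑(∑' p, a (z - p) • toL2 μ (ε p)) := by
  rw [movingAverage, l2Sum]
  congr 2
  exact tsum_congr fun p => toL2_const_mul (memLp_noise h hk p) _

lemma summable_wickSum (h : NoiseAssumption μ ε k) (s : Set (Fin k → ℤ × ℤ))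
    {b : (Fin k → ℤ × ℤ) → ℝ} (hb : Summable fun w => b w ^ 2) :
    Summable fun w : s => b w • wickL2 μ ε w.1 := by
  obtain ⟨C, hC⟩ := gramBound_wickL2 h (le_refl k)
  exact (hC.summable hb).subtype s

lemma wickSum_add_compl (h : NoiseAssumption μ ε k) (s : Set (Fin k → ℤ × ℤ))
    {b : (Fin k → ℤ × ℤ) → ℝ} (hb : Summable fun w => b w ^ 2) :
    wickSum μ ε s b + wickSum μ ε sᶜ b = ∑' w, b w • wickL2 μ ε w :=
  Summable.tsum_add_tsum_compl (f := fun w => b w • wickL2 μ ε w)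
    (summable_wickSum h s hb) (summable_wickSum h sᶜ hb)

/-- The Appell field is the sum of its off-diagonal and diagonal parts. -/
theorem appellField_eq_add (h : NoiseAssumption μ ε k) (hk : 1 ≤ k) {a : ℤ × ℤ → ℝ}
    (ha : Summable fun p => a p ^ 2) (z : ℤ × ℤ) :
    ∀ᵐ ω ∂μ, appellField μ a ε k z ω = offDiagonal μ a ε k z ω + diagonal μ a ε k z ω := by
  have hz := summable_sq_shift ha z
  have h1 : ∀ᵐ ω ∂μ, appellField μ a ε k z ω = wickSeries μ ε (fun p => a (z - p)) k ω := by
    unfold appellField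
    rw [movingAverage_eq h hk]
    exact appell_average h hk hz _ rfl
  have h2 := wickSum_add_compl h {w : Fin k → ℤ × ℤ | Function.Injective w}
    (summable_sq_words (n := k) hz)
  rw [offDiagonal_eq h hk, diagonal_eq h]
  filter_upwards [h1, Lp.coeFn_add
    (wickSum μ ε {w : Fin k → ℤ × ℤ | Function.Injective w} fun w => ∏ i, a (z - w i))
    (wickSum μ ε {w : Fin k → ℤ × ℤ | Function.Injective w}ᶜ fun w => ∏ i, a (z - w i))]
    with ω h3 h4
  rw [h3, wickSeries, ← h2, h4, Pi.add_apply]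
  rfl

lemma sum_wickSum (h : NoiseAssumption μ ε k) {a : ℤ × ℤ → ℝ}
    (ha : Summable fun p => a p ^ 2) (B : Finset (ℤ × ℤ)) (s : Set (Fin k → ℤ × ℤ)) :
    ∑ z ∈ B, wickSum μ ε s (fun w => ∏ i, a (z - w i)) = wickSum μ ε s (boxCoeff a B) := by
  have h1 := hasSum_sum (s := B) fun z _ =>
    (summable_wickSum h s (summable_sq_words (n := k) (summable_sq_shift ha z))).hasSum
  rw [wickSum]
  simp only [boxCoeff, Finset.sum_smul]
  exact h1.tsum_eq.symm

lemma sum_coeFn_wickSum (h : NoiseAssumption μ ε k) {a : ℤ × ℤ → ℝ}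
    (ha : Summable fun p => a p ^ 2) (B : Finset (ℤ × ℤ)) (s : Set (Fin k → ℤ × ℤ)) :
    (fun ω => ∑ z ∈ B, wickSum μ ε s (fun w => ∏ i, a (z - w i)) ω) =ᵐ[μ]
      wickSum μ ε s (boxCoeff a B) := by
  rw [← sum_wickSum h ha]
  filter_upwards [Lp.coeFn_finsetSum B fun z => wickSum μ ε s (fun w => ∏ i, a (z - w i))]
    with ω hω
  rw [hω, Finset.sum_apply]

lemma variance_lp (f : Lp ℝ 2 μ) (hf : ∫ ω, f ω ∂μ = 0) :
    variance f μ = ‖f‖ ^ 2 := by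
  rw [variance_of_integral_eq_zero (Lp.aestronglyMeasurable f).aemeasurable hf,
    ← real_inner_self_eq_norm_sq, L2.inner_def]
  refine integral_congr_ae (ae_of_all _ fun ω => ?_)
  simp [sq]

lemma summable_boxCoeff {a : ℤ × ℤ → ℝ} (ha : Summable fun p => a p ^ 2) (B : Finset (ℤ × ℤ))
    (k : ℕ) : Summable fun w : Fin k → ℤ × ℤ => boxCoeff a B w ^ 2 :=
  (hasSum_boxCoeff_sq ha B k).summable

lemma integral_wickSum (h : NoiseAssumption μ ε k) (hk : 1 ≤ k) (s : Set (Fin k → ℤ × ℤ))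
    {b : (Fin k → ℤ × ℤ) → ℝ} (hb : Summable fun w => b w ^ 2) :
    ∫ ω, wickSum μ ε s b ω ∂μ = 0 := by
  rw [← inner_one h, wickSum]
  have h1 := ((summable_wickSum h s hb).hasSum.mapL
    (innerSL ℝ (wickL2 μ ε (Fin.elim0 : Fin 0 → ℤ × ℤ))))
  simp only [innerSL_apply_apply] at h1
  rw [← h1.tsum_eq]
  refine (tsum_congr fun w => ?_).trans tsum_zero
  rw [real_inner_smul_right, integral_wickL2 h le_rfl hk, mul_zero]

lemma inner_wickSum (h : NoiseAssumption μ ε k) (s : Set (Fin k → ℤ × ℤ))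
    {b : (Fin k → ℤ × ℤ) → ℝ} (hb : Summable fun w => b w ^ 2) (f : Lp ℝ 2 μ) :
    HasSum (fun w : s => b w * inner ℝ f (wickL2 μ ε w.1)) (inner ℝ f (wickSum μ ε s b)) := by
  have h1 := ((summable_wickSum h s hb).hasSum.mapL (innerSL ℝ f))
  simp only [innerSL_apply_apply, real_inner_smul_right] at h1
  exact h1

/-- A non-injective word has fewer than k distinct letters, so its letter set is never that of an
injective word. -/
lemma inner_off_diag (h : NoiseAssumption μ ε k)
    {b : (Fin k → ℤ × ℤ) → ℝ} (hb : Summable fun w => b w ^ 2) :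
    inner ℝ (wickSum μ ε {w : Fin k → ℤ × ℤ | Function.Injective w} b)
      (wickSum μ ε {w : Fin k → ℤ × ℤ | ¬ Function.Injective w} b) = 0 := by
  refine (inner_wickSum h _ hb _).unique (hasSum_zero.congr_fun fun w => ?_) |>.trans rfl
  rw [real_inner_comm]
  have h1 : inner ℝ (wickL2 μ ε w.1)
      (wickSum μ ε {w : Fin k → ℤ × ℤ | Function.Injective w} b) = 0 := by
    refine (inner_wickSum h _ hb _).unique (hasSum_zero.congr_fun fun w' => ?_)
    rw [inner_wickL2_eq_zero h le_rfl le_rfl, mul_zero]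
    intro heq
    have h2 := congrArg Finset.card heq
    rw [Finset.card_image_of_injective _ w'.2] at h2
    exact w.2 (by simpa using Finset.card_image_iff.1 h2)
  rw [h1, mul_zero]

lemma inner_wickL2_of_injective (h : NoiseAssumption μ ε k) (hk : 1 ≤ k) {w w' : Fin k → ℤ × ℤ}
    (hw : Function.Injective w) (hw' : Function.Injective w')
    (himg : Finset.univ.image w = Finset.univ.image w') :
    inner ℝ (wickL2 μ ε w) (wickL2 μ ε w') = 1 := by
  have := h.isProbabilityMeasure 0
  have h0 : ∫ x, x ∂(μ.map (ε 0)) = 0 :=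
    (integral_map (h.aemeasurable 0) aestronglyMeasurable_id).trans h.mean_zero
  have hone : ∀ {w : Fin k → ℤ × ℤ}, Function.Injective w → ∀ p ∈ Finset.univ.image w,
      (Finset.univ.filter fun l => w l = p).card = 1 := by
    intro w hw p hp
    obtain ⟨i, -, rfl⟩ := Finset.mem_image.1 hp
    rw [Finset.card_eq_one]
    exact ⟨i, by ext l; simp [hw.eq_iff]⟩
  rw [inner_wickL2_eq_prod h le_rfl le_rfl, ← himg, Finset.union_self]
  refine Finset.prod_eq_one fun p hp => ?_
  rw [hone hw p hp, hone hw' p (himg ▸ hp)]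
  simp_rw [appell_one hk h.memLp' h0]
  rw [integral_map (f := fun x : ℝ => x * x) (h.aemeasurable 0) (by fun_prop)]
  simpa [sq] using h.var_one

/-- An injective word pairs nontrivially only with its k! rearrangements. Each pairing is 1 and the
coefficient is unchanged, which produces the factor k!. -/
lemma norm_sq_wickSum_injective (h : NoiseAssumption μ ε k) (hk : 1 ≤ k)
    {b : (Fin k → ℤ × ℤ) → ℝ} (hb : Summable fun w => b w ^ 2)
    (hsymm : ∀ (w : Fin k → ℤ × ℤ) (σ : Equiv.Perm (Fin k)), b (w ∘ σ) = b w) :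
    ‖wickSum μ ε {w : Fin k → ℤ × ℤ | Function.Injective w} b‖ ^ 2 =
      k.factorial * ∑' w : {w : Fin k → ℤ × ℤ | Function.Injective w}, b w ^ 2 := by
  set s := {w : Fin k → ℤ × ℤ | Function.Injective w} with hs
  have hrow : ∀ w : s, inner ℝ (wickSum μ ε s b) (wickL2 μ ε w.1) = k.factorial * b w := by
    intro w
    rw [real_inner_comm, ← (inner_wickSum h s hb _).tsum_eq]
    set e : Equiv.Perm (Fin k) → s := fun σ => ⟨w.1 ∘ σ, w.2.comp σ.injective⟩ with he
    have hinj : Function.Injective e := by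
      intro σ τ hστ
      ext1 i
      exact w.2 (congrFun (congrArg Subtype.val hστ) i)
    rw [← hinj.tsum_eq, tsum_fintype]
    · have hterm : ∀ σ, b (e σ) * inner ℝ (wickL2 μ ε w.1) (wickL2 μ ε (e σ).1) = b w := by
        intro σ
        rw [inner_wickL2_of_injective h hk w.2 (e σ).2, mul_one]
        · exact hsymm w.1 σ
        · ext p
          simp only [Finset.mem_image, Finset.mem_univ, true_and, he, Function.comp]
          exact (σ.surjective.exists (p := fun i => w.1 i = p))
      rw [Finset.sum_congr rfl fun σ _ => hterm σ, Finset.sum_const, Finset.card_univ,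
        Fintype.card_perm, Fintype.card_fin, nsmul_eq_mul]
    · intro w' hw'
      have himg : Finset.univ.image w.1 = Finset.univ.image w'.1 := by
        by_contra hne
        rw [Function.mem_support, inner_wickL2_eq_zero h le_rfl le_rfl _ _ hne, mul_zero] at hw'
        exact hw' rfl
      have hex : ∀ i, ∃ l, w.1 l = w'.1 i := by
        intro i
        have : w'.1 i ∈ Finset.univ.image w.1 := by
          rw [himg]; exact Finset.mem_image_of_mem _ (Finset.mem_univ _)
        simpa using this
      choose σ hσ using hex
      have hσi : Function.Injective σ := by
        intro i l hil
        apply w'.2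
        rw [← hσ, ← hσ, hil]
      refine ⟨Equiv.ofBijective σ (Finite.injective_iff_bijective.1 hσi), ?_⟩
      ext1
      funext i
      exact hσ i
  rw [← real_inner_self_eq_norm_sq, ← (inner_wickSum h s hb _).tsum_eq, ← tsum_mul_left]
  refine tsum_congr fun w => ?_
  rw [hrow]
  ring

lemma boxCoeff_comp_perm (a : ℤ × ℤ → ℝ) (B : Finset (ℤ × ℤ)) (w : Fin k → ℤ × ℤ)
    (σ : Equiv.Perm (Fin k)) : boxCoeff a B (w ∘ σ) = boxCoeff a B w :=
  Finset.sum_congr rfl fun z _ => Equiv.prod_comp σ fun i => a (z - w i)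

/-! ### Variances of sums over a finite set of sites -/

section Variance

variable (h : NoiseAssumption μ ε k) (hk : 1 ≤ k) {a : ℤ × ℤ → ℝ}
  (ha : Summable fun p => a p ^ 2)
include h hk ha

lemma variance_sum_offDiagonal (B : Finset (ℤ × ℤ)) :
    variance (fun ω => ∑ z ∈ B, offDiagonal μ a ε k z ω) μ = k.factorial *
      ∑' w : {w : Fin k → ℤ × ℤ | Function.Injective w}, boxCoeff a B w.1 ^ 2 := by
  simp_rw [offDiagonal_eq h hk]
  rw [variance_congr (sum_coeFn_wickSum h ha B _),
    variance_lp _ (integral_wickSum h hk _ (summable_boxCoeff ha B k)),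
    norm_sq_wickSum_injective h hk (summable_boxCoeff ha B k) (boxCoeff_comp_perm a B)]

lemma variance_sum_diagonal_le : ∃ C : ℝ, ∀ B : Finset (ℤ × ℤ),
    variance (fun ω => ∑ z ∈ B, diagonal μ a ε k z ω) μ ≤ C * B.card := by
  obtain ⟨C, hC⟩ := gramBound_wickL2 h (le_refl k)
  obtain ⟨C', hC'⟩ := boxCoeff_not_injective_le ha k
  have hC0 := hC.nonneg fun _ => 0
  refine ⟨C * C', fun B => ?_⟩
  simp_rw [diagonal_eq h]
  rw [variance_congr (sum_coeFn_wickSum h ha B _),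
    variance_lp _ (integral_wickSum h hk _ (summable_boxCoeff ha B k)), mul_assoc]
  refine le_trans ?_ (mul_le_mul_of_nonneg_left (hC' B) hC0)
  exact (hC.comp_injective (f := fun w : {w : Fin k → ℤ × ℤ | ¬ Function.Injective w} => w.1)
    Subtype.val_injective).norm_tsum_sq_le ((summable_boxCoeff ha B k).subtype _)

lemma variance_sum_appellField (B : Finset (ℤ × ℤ)) :
    variance (fun ω => ∑ z ∈ B, appellField μ a ε k z ω) μ =
      variance (fun ω => ∑ z ∈ B, offDiagonal μ a ε k z ω) μ +
      variance (fun ω => ∑ z ∈ B, diagonal μ a ε k z ω) μ := by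
  have hae : (fun ω => ∑ z ∈ B, appellField μ a ε k z ω) =ᵐ[μ]
      (wickSum μ ε {w : Fin k → ℤ × ℤ | Function.Injective w} (boxCoeff a B) +
        wickSum μ ε {w : Fin k → ℤ × ℤ | ¬ Function.Injective w} (boxCoeff a B) : Lp ℝ 2 μ) := by
    have h1 : ∀ᵐ ω ∂μ, ∀ z ∈ B, appellField μ a ε k z ω =
        offDiagonal μ a ε k z ω + diagonal μ a ε k z ω := by
      rw [Finset.eventually_all]
      exact fun z _ => appellField_eq_add h hk ha z
    filter_upwards [h1, Lp.coeFn_add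
      (wickSum μ ε {w : Fin k → ℤ × ℤ | Function.Injective w} (boxCoeff a B))
      (wickSum μ ε {w : Fin k → ℤ × ℤ | ¬ Function.Injective w} (boxCoeff a B)),
      sum_coeFn_wickSum h ha B {w : Fin k → ℤ × ℤ | Function.Injective w},
      sum_coeFn_wickSum h ha B {w : Fin k → ℤ × ℤ | ¬ Function.Injective w}] with ω h2 h3 h4 h5
    rw [h3, Pi.add_apply, ← h4, ← h5, Finset.sum_congr rfl h2, Finset.sum_add_distrib]
    simp_rw [offDiagonal_eq h hk, diagonal_eq h]
  have hs := summable_boxCoeff ha B k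
  have hint := integral_wickSum h hk {w : Fin k → ℤ × ℤ | Function.Injective w} hs
  have hint' := integral_wickSum h hk {w : Fin k → ℤ × ℤ | ¬ Function.Injective w} hs
  simp_rw [offDiagonal_eq h hk, diagonal_eq h]
  rw [variance_congr hae, variance_congr (sum_coeFn_wickSum h ha B _),
    variance_congr (sum_coeFn_wickSum h ha B _), variance_lp _ hint, variance_lp _ hint',
    variance_lp, norm_add_sq_real, inner_off_diag h hs]
  · ring
  · rw [← inner_one h, inner_add_right, inner_one h, inner_one h, hint, hint', add_zero]

/-- Injective words are all words minus the non-injective ones: the first sum is accessible to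
scaling, the second is O(|B|). -/
lemma variance_sum_offDiagonal_eq_sub (B : Finset (ℤ × ℤ)) :
    variance (fun ω => ∑ z ∈ B, offDiagonal μ a ε k z ω) μ = k.factorial *
      (∑ z ∈ B, ∑ z' ∈ B, corr a (z' - z) ^ k -
      ∑' w : {w : Fin k → ℤ × ℤ | ¬ Function.Injective w}, boxCoeff a B w.1 ^ 2) := by
  have hs := summable_boxCoeff ha B k
  rw [variance_sum_offDiagonal h hk ha, ← (hasSum_boxCoeff_sq ha B k).tsum_eq,
    ← hs.tsum_subtype_add_tsum_subtype_compl {w : Fin k → ℤ × ℤ | Function.Injective w}]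
  have : ∀ x y z : ℝ, y = z → x = x + y - z := by intro x y z h; rw [h]; ring
  congr 1
  exact this _ _ _ rfl

end Variance

/-! ### The anisotropic gauge `|t|^α + |s|^β` -/

/-- The gauge `|t|^α + |s|^β` on the plane. -/
def eta (α β : ℝ) (x : ℝ × ℝ) : ℝ := |x.1| ^ α + |x.2| ^ β

section Eta

variable {α β : ℝ}

lemma eta_nonneg (x : ℝ × ℝ) : 0 ≤ eta α β x := by unfold eta; positivity

lemma eta_pos {x : ℝ × ℝ} (hx : x ≠ 0) : 0 < eta α β x := by
  unfold eta
  by_cases h1 : x.1 = 0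
  · have h2 : x.2 ≠ 0 := fun h2 => hx (Prod.ext h1 h2)
    have := Real.rpow_pos_of_pos (abs_pos.2 h2) β
    positivity
  · have := Real.rpow_pos_of_pos (abs_pos.2 h1) α
    positivity

lemma eta_neg (x : ℝ × ℝ) : eta α β (-x) = eta α β x := by simp [eta]

lemma continuous_eta (hα : 0 < α) (hβ : 0 < β) : Continuous (eta α β) := by
  unfold eta
  exact (continuous_fst.abs.rpow_const fun _ => Or.inr hα.le).add
    (continuous_snd.abs.rpow_const fun _ => Or.inr hβ.le)

lemma add_rpow_le_two {x y : ℝ} (hx : 0 ≤ x) (hy : 0 ≤ y) (hα : 0 < α) :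
    (x + y) ^ α ≤ 2 ^ α * (x ^ α + y ^ α) := by
  have hx' := Real.rpow_nonneg hx α
  have hy' := Real.rpow_nonneg hy α
  have h2 : (0 : ℝ) < 2 ^ α := Real.rpow_pos_of_pos two_pos α
  rcases le_total x y with h | h
  · calc (x + y) ^ α ≤ (2 * y) ^ α := Real.rpow_le_rpow (by linarith) (by linarith) hα.le
      _ = 2 ^ α * y ^ α := Real.mul_rpow two_pos.le hy
      _ ≤ _ := by gcongr; linarith
  · calc (x + y) ^ α ≤ (2 * x) ^ α := Real.rpow_le_rpow (by linarith) (by linarith) hα.le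
      _ = 2 ^ α * x ^ α := Real.mul_rpow two_pos.le hx
      _ ≤ _ := by gcongr; linarith

lemma eta_add_le (hα : 0 < α) (hβ : 0 < β) (x y : ℝ × ℝ) :
    eta α β (x + y) ≤ (2 ^ α + 2 ^ β) * (eta α β x + eta α β y) := by
  unfold eta
  have h1 : |(x + y).1| ^ α ≤ 2 ^ α * (|x.1| ^ α + |y.1| ^ α) :=
    (Real.rpow_le_rpow (abs_nonneg _) (abs_add_le _ _) hα.le).trans
      (add_rpow_le_two (abs_nonneg _) (abs_nonneg _) hα)
  have h2 : |(x + y).2| ^ β ≤ 2 ^ β * (|x.2| ^ β + |y.2| ^ β) :=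
    (Real.rpow_le_rpow (abs_nonneg _) (abs_add_le _ _) hβ.le).trans
      (add_rpow_le_two (abs_nonneg _) (abs_nonneg _) hβ)
  have h3 : (0 : ℝ) < 2 ^ α := Real.rpow_pos_of_pos two_pos α
  have h4 : (0 : ℝ) < 2 ^ β := Real.rpow_pos_of_pos two_pos β
  have h5 : 0 ≤ |x.1| ^ α + |y.1| ^ α := by positivity
  have h6 : 0 ≤ |x.2| ^ β + |y.2| ^ β := by positivity
  nlinarith

/-- This bounds the gauge below by products of one-variable powers, which reduces integrability on
the plane to the line. -/
lemma rpow_mul_rpow_le_add {A B θ : ℝ} (hA : 0 ≤ A) (hB : 0 ≤ B) (h0 : 0 ≤ θ) (h1 : θ ≤ 1) :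
    A ^ θ * B ^ (1 - θ) ≤ A + B := by
  have hs : 0 ≤ A + B := add_nonneg hA hB
  calc A ^ θ * B ^ (1 - θ) ≤ (A + B) ^ θ * (A + B) ^ (1 - θ) := by
        have h2 := Real.rpow_le_rpow hA (by linarith : A ≤ A + B) h0
        have h3 := Real.rpow_le_rpow hB (by linarith : B ≤ A + B) (by linarith : 0 ≤ 1 - θ)
        exact mul_le_mul h2 h3 (Real.rpow_nonneg hB _) (Real.rpow_nonneg hs _)
    _ = A + B := by
        rw [← Real.rpow_add_of_nonneg hs h0 (by linarith)]
        simp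

lemma ae_coord_ne_zero : ∀ᵐ x : ℝ × ℝ, x.1 ≠ 0 ∧ x.2 ≠ 0 := by
  have h0 : ∀ᵐ x : ℝ, x ≠ 0 := by
    rw [ae_iff]; simp
  have h1 := (Measure.quasiMeasurePreserving_fst (μ := (volume : Measure ℝ))
    (ν := (volume : Measure ℝ))).ae h0
  have h2 := (Measure.quasiMeasurePreserving_snd (μ := (volume : Measure ℝ))
    (ν := (volume : Measure ℝ))).ae h0
  rw [← Measure.volume_eq_prod] at h1 h2
  filter_upwards [h1, h2] with x h3 h4 using ⟨h3, h4⟩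

lemma ae_ne_zero : ∀ᵐ x : ℝ × ℝ, x ≠ 0 := by
  filter_upwards [ae_coord_ne_zero] with x hx h
  exact hx.1 (by rw [h]; rfl)

lemma integrableOn_abs_rpow {r : ℝ} (hr : -1 < r) (K : ℝ) :
    IntegrableOn (fun x : ℝ => |x| ^ r) (Icc (-K) K) := by
  rcases lt_or_ge K 0 with hK | hK
  · rw [Icc_eq_empty (by linarith)]; exact integrableOn_empty
  have h1 : IntervalIntegrable (fun x : ℝ => |x| ^ r) volume 0 K := by
    refine (intervalIntegral.intervalIntegrable_rpow' hr).congr fun x hx => ?_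
    rw [uIoc_of_le hK] at hx
    rw [abs_of_pos hx.1]
  have h2 : IntervalIntegrable (fun x : ℝ => |x| ^ r) volume (-K) 0 := by
    have := (IntervalIntegrable.iff_comp_neg (by simp)).1 h1.symm
    simpa using this
  have h3 := h2.trans h1
  rwa [intervalIntegrable_iff_integrableOn_Icc_of_le (by linarith)] at h3

/-- `1 / η` is integrable near the origin when `1/α + 1/β > 1`. -/
lemma integrableOn_inv_eta (hα : 0 < α) (hβ : 0 < β) (h : 1 < 1 / α + 1 / β) (K : ℝ) :
    IntegrableOn (fun x => (eta α β x)⁻¹) (Icc (-K) K ×ˢ Icc (-K) K) := by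
  -- The choice makes αθ < 1 and β(1 - θ) < 1, so both one-variable powers are integrable at 0; it
  -- is possible because 1/α + 1/β > 1.
  obtain ⟨θ, h1, h2⟩ : ∃ θ, max 0 (1 - 1 / β) < θ ∧ θ < min 1 (1 / α) := by
    refine exists_between (max_lt (lt_min one_pos (by positivity)) (lt_min ?_ (by linarith)))
    have : 0 < 1 / β := by positivity
    linarith
  have hθ0 : 0 < θ := (le_max_left _ _).trans_lt h1
  have hθ1 : θ < 1 := h2.trans_le (min_le_left _ _)
  have hθα : α * θ < 1 := by
    have := h2.trans_le (min_le_right _ _)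
    rw [lt_div_iff₀ hα] at this
    linarith
  have hθβ : β * (1 - θ) < 1 := by
    have := (le_max_right _ _).trans_lt h1
    have h3 : 1 - θ < 1 / β := by linarith
    rw [lt_div_iff₀ hβ] at h3
    linarith
  have hprod : IntegrableOn (fun x : ℝ × ℝ => |x.1| ^ (-(α * θ)) * |x.2| ^ (-(β * (1 - θ))))
      (Icc (-K) K ×ˢ Icc (-K) K) := by
    rw [IntegrableOn, Measure.volume_eq_prod, ← Measure.prod_restrict]
    exact Integrable.mul_prod (f := fun x : ℝ => |x| ^ (-(α * θ)))
      (g := fun x : ℝ => |x| ^ (-(β * (1 - θ)))) (integrableOn_abs_rpow (by linarith) K)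
      (integrableOn_abs_rpow (by linarith) K)
  refine Integrable.mono' hprod
    ((continuous_eta hα hβ).measurable.inv).aestronglyMeasurable ?_
  filter_upwards [ae_restrict_of_ae ae_coord_ne_zero] with x hx
  have hx1 := abs_pos.2 hx.1
  have hx2 := abs_pos.2 hx.2
  rw [Real.norm_of_nonneg (inv_nonneg.2 (eta_nonneg x)), Real.rpow_neg hx1.le,
    Real.rpow_neg hx2.le, ← mul_inv, Real.rpow_mul hx1.le, Real.rpow_mul hx2.le]
  refine inv_anti₀ (by positivity) ?_
  exact rpow_mul_rpow_le_add (by positivity) (by positivity) hθ0.le hθ1.le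

/-- Here θ is taken with 2αθ > 1 and 2β(1 - θ) > 1, possible because 1/α + 1/β < 2. The product
bound serves both the integral and the lattice sum. -/
lemma exists_one_add_eta_sq_ge (hα : 0 < α) (hβ : 0 < β) (h : 1 / α + 1 / β < 2) :
    ∃ C r s : ℝ, 0 < C ∧ 1 < r ∧ 1 < s ∧ ∀ x : ℝ × ℝ,
      ((1 + eta α β x) ^ 2)⁻¹ ≤ C * ((1 + ‖x.1‖) ^ (-r) * (1 + ‖x.2‖) ^ (-s)) := by
  have hα' : 0 < 1 / α := by positivity
  have hβ' : 0 < 1 / β := by positivity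
  obtain ⟨θ, h1, h2⟩ : ∃ θ, 1 / α / 2 < θ ∧ θ < 1 - 1 / β / 2 := exists_between (by linarith)
  have hθ0 : 0 < θ := by linarith
  have hθ1 : θ < 1 := by linarith
  have hr : 1 < α * (θ * 2) := by
    have : 1 / α < θ * 2 := by linarith
    rw [div_lt_iff₀ hα] at this
    linarith
  have hs : 1 < β * ((1 - θ) * 2) := by
    have : 1 / β < (1 - θ) * 2 := by linarith
    rw [div_lt_iff₀ hβ] at this
    linarith
  have hc : 0 < ((2 : ℝ) ^ α + 2 ^ β + 2) := by
    have := Real.rpow_pos_of_pos two_pos α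
    have := Real.rpow_pos_of_pos two_pos β
    positivity
  refine ⟨((2 : ℝ) ^ α + 2 ^ β + 2) ^ 2, α * (θ * 2), β * ((1 - θ) * 2), by positivity, hr, hs,
    fun x => ?_⟩
  have hx1 : 0 < 1 + ‖x.1‖ := by positivity
  have hx2 : 0 < 1 + ‖x.2‖ := by positivity
  have key : ((1 + ‖x.1‖) ^ α) ^ θ * ((1 + ‖x.2‖) ^ β) ^ (1 - θ) ≤
      (2 ^ α + 2 ^ β + 2) * (1 + eta α β x) := by
    refine (rpow_mul_rpow_le_add (by positivity) (by positivity) hθ0.le hθ1.le).trans ?_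
    have h3 := add_rpow_le_two zero_le_one (norm_nonneg x.1) hα
    have h4 := add_rpow_le_two zero_le_one (norm_nonneg x.2) hβ
    rw [Real.one_rpow] at h3 h4
    unfold eta
    simp only [Real.norm_eq_abs] at *
    have h5 : (0 : ℝ) < 2 ^ α := Real.rpow_pos_of_pos two_pos α
    have h6 : (0 : ℝ) < 2 ^ β := Real.rpow_pos_of_pos two_pos β
    have h7 : 0 ≤ |x.1| ^ α := by positivity
    have h8 : 0 ≤ |x.2| ^ β := by positivity
    nlinarith [mul_nonneg h5.le h8, mul_nonneg h6.le h7]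
  have hη : 0 < 1 + eta α β x := by linarith [eta_nonneg (α := α) (β := β) x]
  rw [Real.rpow_neg hx1.le, Real.rpow_neg hx2.le, ← mul_inv, ← div_eq_mul_inv,
    inv_le_iff_one_le_mul₀ (by positivity), div_mul_eq_mul_div, one_le_div (by positivity),
    ← mul_pow]
  refine le_trans (le_of_eq ?_) (pow_le_pow_left₀ (by positivity) key 2)
  rw [mul_pow, Real.rpow_mul hx1.le, Real.rpow_mul hx2.le, Real.rpow_mul (by positivity),
    Real.rpow_mul (by positivity), Real.rpow_two, Real.rpow_two]

lemma integrable_inv_one_add_eta_sq (hα : 0 < α) (hβ : 0 < β) (h : 1 / α + 1 / β < 2) :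
    Integrable fun x => ((1 + eta α β x) ^ 2)⁻¹ := by
  obtain ⟨C, r, s, hC, hr, hs, hle⟩ := exists_one_add_eta_sq_ge hα hβ h
  have h1 : Integrable fun x : ℝ × ℝ => C * ((1 + ‖x.1‖) ^ (-r) * (1 + ‖x.2‖) ^ (-s)) := by
    refine Integrable.const_mul ?_ C
    rw [Measure.volume_eq_prod]
    exact Integrable.mul_prod (f := fun x : ℝ => (1 + ‖x‖) ^ (-r))
      (g := fun x : ℝ => (1 + ‖x‖) ^ (-s)) (integrable_one_add_norm (by simpa using hr))
      (integrable_one_add_norm (by simpa using hs))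
  refine h1.mono' ?_ (ae_of_all _ fun x => ?_)
  · exact (((continuous_eta hα hβ).measurable.const_add 1).pow_const 2).inv.aestronglyMeasurable
  · rw [Real.norm_of_nonneg (by positivity)]
    exact hle x

lemma summable_one_add_abs_int {r : ℝ} (hr : 1 < r) :
    Summable fun n : ℤ => (1 + ‖(n : ℝ)‖) ^ (-r) := by
  have h1 : Summable fun n : ℕ => (1 + (n : ℝ)) ^ (-r) := by
    have := (summable_nat_add_iff 1).2 (Real.summable_nat_rpow.2 (by linarith : -r < -1))
    refine this.congr fun n => ?_
    push_cast
    rw [add_comm]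
  refine Summable.of_nat_of_neg ?_ ?_
  · simpa using h1
  · simpa using h1

lemma summable_inv_one_add_eta_sq (hα : 0 < α) (hβ : 0 < β) (h : 1 / α + 1 / β < 2) :
    Summable fun z : ℤ × ℤ => ((1 + eta α β ((z.1 : ℝ), (z.2 : ℝ))) ^ 2)⁻¹ := by
  obtain ⟨C, r, s, hC, hr, hs, hle⟩ := exists_one_add_eta_sq_ge hα hβ h
  have h1 : Summable fun z : ℤ × ℤ => C * ((1 + ‖(z.1 : ℝ)‖) ^ (-r) * (1 + ‖(z.2 : ℝ)‖) ^ (-s)) :=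
    (Summable.mul_of_nonneg (f := fun n : ℤ => (1 + ‖(n : ℝ)‖) ^ (-r))
      (g := fun n : ℤ => (1 + ‖(n : ℝ)‖) ^ (-s)) (summable_one_add_abs_int hr)
      (summable_one_add_abs_int hs) (fun n => by positivity) fun n => by positivity).mul_left C
  exact Summable.of_nonneg_of_le (fun z => by positivity) (fun z => hle _) h1

lemma one_le_eta_of_notMem {x : ℝ × ℝ} (hα : 0 < α) (hβ : 0 < β)
    (hx : x ∉ Icc (-1 : ℝ) 1 ×ˢ Icc (-1 : ℝ) 1) : 1 ≤ eta α β x := by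
  unfold eta
  have h1 : 0 ≤ |x.1| ^ α := by positivity
  have h2 : 0 ≤ |x.2| ^ β := by positivity
  by_cases h : |x.1| ≤ 1
  · have h3 : 1 < |x.2| := by
      by_contra hle
      exact hx ⟨abs_le.1 h, abs_le.1 (not_lt.1 hle)⟩
    have := Real.one_le_rpow h3.le hβ.le
    linarith
  · have := Real.one_le_rpow (not_le.1 h).le hα.le
    linarith

/-- `1 / (η (η + c))` is integrable on the plane when `1 < 1/α + 1/β < 2`. -/
lemma integrable_inv_eta_mul (hα : 0 < α) (hβ : 0 < β) (h : 1 < 1 / α + 1 / β)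
    (h' : 1 / α + 1 / β < 2) {c : ℝ} (hc : 0 < c) :
    Integrable fun x => (eta α β x * (eta α β x + c))⁻¹ := by
  set S : Set (ℝ × ℝ) := Icc (-1 : ℝ) 1 ×ˢ Icc (-1 : ℝ) 1 with hS
  have hSm : MeasurableSet S := measurableSet_Icc.prod measurableSet_Icc
  have h1 : Integrable fun x => c⁻¹ * S.indicator (fun x => (eta α β x)⁻¹) x +
      4 * ((1 + eta α β x) ^ 2)⁻¹ :=
    (((integrable_indicator_iff hSm).2 (integrableOn_inv_eta hα hβ h 1)).const_mul _).add
      ((integrable_inv_one_add_eta_sq hα hβ h').const_mul _)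
  have hm := (continuous_eta hα hβ).measurable
  refine h1.mono' (hm.mul (hm.add_const c)).inv.aestronglyMeasurable ?_
  filter_upwards [ae_ne_zero] with x hx
  have hη : 0 < eta α β x := eta_pos hx
  rw [Real.norm_of_nonneg (by positivity)]
  by_cases hxS : x ∈ S
  · rw [indicator_of_mem hxS]
    have : (eta α β x * (eta α β x + c))⁻¹ ≤ c⁻¹ * (eta α β x)⁻¹ := by
      rw [← mul_inv]
      refine inv_anti₀ (by positivity) ?_
      nlinarith
    have h2 : 0 ≤ 4 * ((1 + eta α β x) ^ 2)⁻¹ := by positivity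
    linarith
  · rw [indicator_of_notMem hxS, mul_zero, zero_add]
    have := one_le_eta_of_notMem hα hβ hxS
    rw [← div_eq_mul_inv, inv_eq_one_div, div_le_div_iff₀ (by positivity) (by positivity)]
    nlinarith

/-- `1 / η` is integrable on horizontally bounded strips when `1/α + 1/β > 1` and `β > 1`. -/
lemma integrableOn_inv_eta_strip (hα : 0 < α) (hβ : 1 < β) (h : 1 < 1 / α + 1 / β) (K : ℝ) :
    IntegrableOn (fun x => (eta α β x)⁻¹) (Icc (-K) K ×ˢ univ) := by
  have hβ0 : 0 < β := by linarith
  -- A point of the strip outside the square of half-side L has |s| > 1. There 1/η is at most a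
  -- multiple of (1 + |s|)^(-β), integrable since β > 1.
  set L := max K 1 with hL
  set S : Set (ℝ × ℝ) := Icc (-L) L ×ˢ Icc (-L) L with hS
  have hSm : MeasurableSet S := measurableSet_Icc.prod measurableSet_Icc
  have h1 : IntegrableOn (fun x : ℝ × ℝ => S.indicator (fun x => (eta α β x)⁻¹) x +
      2 ^ β * (1 * (1 + ‖x.2‖) ^ (-β))) (Icc (-K) K ×ˢ univ) := by
    refine Integrable.add ?_ ?_
    · exact ((integrable_indicator_iff hSm).2 (integrableOn_inv_eta hα hβ0 h L)).integrableOn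
    · refine Integrable.const_mul ?_ _
      rw [Measure.volume_eq_prod, ← Measure.prod_restrict]
      refine Integrable.mul_prod (f := fun _ : ℝ => (1 : ℝ)) (g := fun x : ℝ => (1 + ‖x‖) ^ (-β))
        (integrable_const _) ?_
      rw [Measure.restrict_univ]
      exact integrable_one_add_norm (by simpa using hβ)
  have hm := (continuous_eta hα hβ0).measurable
  refine h1.mono' hm.inv.aestronglyMeasurable ?_
  filter_upwards [ae_restrict_of_ae ae_ne_zero,
    ae_restrict_mem (measurableSet_Icc.prod MeasurableSet.univ)] with x hx hxK
  have hη : 0 < eta α β x := eta_pos hx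
  rw [Real.norm_of_nonneg (by positivity)]
  by_cases hxS : x ∈ S
  · rw [indicator_of_mem hxS]
    have : 0 ≤ (2 : ℝ) ^ β * (1 * (1 + ‖x.2‖) ^ (-β)) := by positivity
    linarith
  · rw [indicator_of_notMem hxS, zero_add, one_mul]
    have h2 : 1 < |x.2| := by
      by_contra hle
      refine hxS ⟨⟨?_, ?_⟩, abs_le.1 ((not_lt.1 hle).trans (le_max_right _ _))⟩
      · exact (neg_le_neg (le_max_left _ _)).trans hxK.1.1
      · exact hxK.1.2.trans (le_max_left _ _)
    rw [Real.rpow_neg (by positivity), ← div_eq_mul_inv, inv_eq_one_div,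
      div_le_div_iff₀ hη (by positivity), one_mul]
    have h3 : (1 + ‖x.2‖) ^ β ≤ (2 * |x.2|) ^ β := by
      refine Real.rpow_le_rpow (by positivity) ?_ hβ0.le
      rw [Real.norm_eq_abs]; linarith
    rw [Real.mul_rpow two_pos.le (abs_nonneg _)] at h3
    refine h3.trans ?_
    gcongr
    unfold eta
    have : 0 ≤ |x.1| ^ α := by positivity
    linarith

/-! ### Lattice sums as integrals of step functions -/

lemma abs_rpow_le_floor (hα : 0 < α) (y : ℝ) : |y| ^ α ≤ 2 ^ α * (1 + |(⌊y⌋ : ℝ)| ^ α) := by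
  have h1 : |y| ≤ 1 + |(⌊y⌋ : ℝ)| := by
    have h2 : |y - ⌊y⌋| ≤ 1 := by
      rw [abs_le]
      exact ⟨by linarith [Int.floor_le y], by linarith [Int.lt_floor_add_one y]⟩
    have := abs_add_le (y - ⌊y⌋) ⌊y⌋
    rw [sub_add_cancel] at this
    linarith
  calc |y| ^ α ≤ (1 + |(⌊y⌋ : ℝ)|) ^ α := Real.rpow_le_rpow (abs_nonneg _) h1 hα.le
    _ ≤ 2 ^ α * (1 ^ α + |(⌊y⌋ : ℝ)| ^ α) := add_rpow_le_two zero_le_one (abs_nonneg _) hα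
    _ = _ := by rw [Real.one_rpow]

lemma volume_floor_mul_preimage {A : ℝ} (hA : 0 < A) (n : ℤ) :
    volume ((fun x : ℝ => ⌊A * x⌋) ⁻¹' {n}) = ENNReal.ofReal A⁻¹ := by
  have : (fun x : ℝ => ⌊A * x⌋) ⁻¹' {n} = Ico (n / A) ((n + 1) / A) := by
    ext x
    rw [mem_preimage, mem_singleton_iff, Int.floor_eq_iff, mem_Ico, div_le_iff₀ hA,
      lt_div_iff₀ hA, mul_comm x A]
  rw [this, Real.volume_Ico]
  congr 1
  field_simp
  ring

/-- The rescaled floor map of the plane to the lattice. -/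
def floorMap (A B : ℝ) (x : ℝ × ℝ) : ℤ × ℤ := (⌊A * x.1⌋, ⌊B * x.2⌋)

lemma measurable_floorMap (A B : ℝ) : Measurable (floorMap A B) :=
  ((measurable_const.mul measurable_fst).floor).prodMk
    ((measurable_const.mul measurable_snd).floor)

lemma map_floorMap {A B : ℝ} (hA : 0 < A) (hB : 0 < B) :
    (volume : Measure (ℝ × ℝ)).map (floorMap A B) = ENNReal.ofReal (A * B)⁻¹ • Measure.count := by
  refine Measure.ext_of_singleton fun z => ?_
  rw [Measure.map_apply (measurable_floorMap A B) (measurableSet_singleton z)]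
  have : floorMap A B ⁻¹' {z} =
      ((fun x : ℝ => ⌊A * x⌋) ⁻¹' {z.1}) ×ˢ ((fun x : ℝ => ⌊B * x⌋) ⁻¹' {z.2}) := by
    ext x
    simp [floorMap, Prod.ext_iff]
  rw [this, Measure.volume_eq_prod, Measure.prod_prod, volume_floor_mul_preimage hA,
    volume_floor_mul_preimage hB, ← ENNReal.ofReal_mul (by positivity), mul_inv]
  simp

/-- Each lattice point is the value of the floor map on a rectangle of area 1/(AB). The mesh is free
in each direction, so dominated convergence can be run at any anisotropic scale. -/
lemma tsum_eq_integral_floor {A B : ℝ} (hA : 0 < A) (hB : 0 < B) {g : ℤ × ℤ → ℝ}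
    (hg : Summable g) : ∑' z, g z = A * B * ∫ x, g (floorMap A B x) := by
  have h1 : Integrable g Measure.count := integrable_count_iff.2 hg.norm
  have h2 : ∫ x, g (floorMap A B x) = (A * B)⁻¹ * ∑' z, g z := by
    rw [← integral_map (f := g) (measurable_floorMap A B).aemeasurable
      (measurable_of_countable g).aestronglyMeasurable, map_floorMap hA hB,
      integral_smul_measure, integral_countable h1, ENNReal.toReal_ofReal (by positivity)]
    simp [Measure.real]
  rw [h2]
  field_simp

end Eta

/-! ### Convergence of correlations of singular kernels -/

section Correlation

variable {α β : ℝ}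

/-- The part of the integrand of `planeConv f f ζ` away from the singularity at `-ζ`. -/
def halfConv (α β : ℝ) (f : ℝ × ℝ → ℝ) (ζ w : ℝ × ℝ) : ℝ :=
  f w * f (ζ + w) * (eta α β (ζ + w) / (eta α β w + eta α β (ζ + w)))

lemma ae_add_ne_zero (ζ : ℝ × ℝ) : ∀ᵐ w : ℝ × ℝ, ζ + w ≠ 0 :=
  (quasiMeasurePreserving_add_left volume ζ).ae ae_ne_zero

/-- Quasi-triangle inequality for ζ = (ζ + w) - w: the points w and ζ + w cannot both be close to
the origin. -/
lemma le_eta_add_eta (hα : 0 < α) (hβ : 0 < β) (ζ w : ℝ × ℝ) :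
    eta α β ζ / (2 ^ α + 2 ^ β) ≤ eta α β w + eta α β (ζ + w) := by
  have h := eta_add_le hα hβ (ζ + w) (-w)
  rw [add_neg_cancel_right, eta_neg] at h
  have : (0 : ℝ) < 2 ^ α + 2 ^ β :=
    add_pos (Real.rpow_pos_of_pos two_pos α) (Real.rpow_pos_of_pos two_pos β)
  rw [div_le_iff₀ this]
  linarith

/-- The weight cancels the singularity at -ζ. The remaining bound depends on ζ only through the
lower bound c, hence is a common dominating function for moving ζ. -/
lemma norm_halfConv_le {f : ℝ × ℝ → ℝ} {C c : ℝ}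
    (hf : ∀ x, x ≠ 0 → |f x| ≤ C * (eta α β x)⁻¹) {ζ w : ℝ × ℝ} (hc : 0 < c)
    (hcw : c ≤ eta α β w + eta α β (ζ + w)) (hw : w ≠ 0) (hζw : ζ + w ≠ 0) :
    ‖halfConv α β f ζ w‖ ≤ 2 * C ^ 2 * (eta α β w * (eta α β w + c))⁻¹ := by
  have h1 : 0 < eta α β w := eta_pos hw
  have h2 : 0 < eta α β (ζ + w) := eta_pos hζw
  have h3 := hf w hw
  have h4 := hf _ hζw
  have h5 : 0 ≤ C * (eta α β w)⁻¹ := (abs_nonneg _).trans h3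
  set x := eta α β w
  set y := eta α β (ζ + w)
  calc ‖halfConv α β f ζ w‖ = |f w| * |f (ζ + w)| * (y / (x + y)) := by
        rw [halfConv, norm_mul, norm_mul, Real.norm_eq_abs, Real.norm_eq_abs,
          Real.norm_of_nonneg (by positivity)]
    _ ≤ (C * x⁻¹) * (C * y⁻¹) * (y / (x + y)) := by gcongr
    _ = C ^ 2 * (x * (x + y))⁻¹ := by field_simp
    -- Both x + y ≥ x and x + y ≥ c hold, so 2(x + y) ≥ x + c.
    _ ≤ C ^ 2 * (2 * (x * (x + c))⁻¹) := by
        gcongr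
        rw [← div_eq_mul_inv, inv_eq_one_div, div_le_div_iff₀ (by positivity) (by positivity)]
        nlinarith
    _ = _ := by ring

lemma measurable_halfConv (hα : 0 < α) (hβ : 0 < β) {f : ℝ × ℝ → ℝ} (hf : Measurable f)
    (ζ : ℝ × ℝ) : Measurable (halfConv α β f ζ) := by
  have hη := (continuous_eta hα hβ).measurable
  have h1 : Measurable fun w : ℝ × ℝ => ζ + w := measurable_const_add ζ
  exact (hf.mul (hf.comp h1)).mul ((hη.comp h1).div (hη.add (hη.comp h1)))

lemma integrable_halfConv (hα : 0 < α) (hβ : 0 < β) (h : 1 < 1 / α + 1 / β)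
    (h' : 1 / α + 1 / β < 2) {f : ℝ × ℝ → ℝ} {C : ℝ} (hfm : Measurable f)
    (hf : ∀ x, x ≠ 0 → |f x| ≤ C * (eta α β x)⁻¹) {ζ : ℝ × ℝ} (hζ : ζ ≠ 0) :
    Integrable (halfConv α β f ζ) := by
  have hc : 0 < eta α β ζ / (2 ^ α + 2 ^ β) := div_pos (eta_pos hζ)
    (add_pos (Real.rpow_pos_of_pos two_pos α) (Real.rpow_pos_of_pos two_pos β))
  refine ((integrable_inv_eta_mul hα hβ h h' hc).const_mul (2 * C ^ 2)).mono'
    (measurable_halfConv hα hβ hfm ζ).aestronglyMeasurable ?_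
  filter_upwards [ae_ne_zero, ae_add_ne_zero ζ] with w hw hζw
  exact norm_halfConv_le hf hc (le_eta_add_eta hα hβ ζ w) hw hζw

/-- The splitting of the integrand of a correlation between its two singularities. -/
lemma mul_shift_eq_halfConv_add (ζ : ℝ × ℝ) (f : ℝ × ℝ → ℝ) {w : ℝ × ℝ} (hw : w ≠ 0) :
    f w * f (ζ + w) = halfConv α β f ζ w + halfConv α β f (-ζ) (ζ + w) := by
  have h1 : 0 < eta α β w := eta_pos hw
  have h2 : 0 ≤ eta α β (ζ + w) := eta_nonneg _
  unfold halfConv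
  rw [neg_add_cancel_left]
  field_simp
  ring

lemma integrable_conv (hα : 0 < α) (hβ : 0 < β) (h : 1 < 1 / α + 1 / β)
    (h' : 1 / α + 1 / β < 2) {f : ℝ × ℝ → ℝ} {C : ℝ} (hfm : Measurable f)
    (hf : ∀ x, x ≠ 0 → |f x| ≤ C * (eta α β x)⁻¹) {ζ : ℝ × ℝ} (hζ : ζ ≠ 0) :
    Integrable fun w => f w * f (ζ + w) := by
  have h1 := integrable_halfConv hα hβ h h' hfm hf hζ
  have h2 := integrable_halfConv hα hβ h h' hfm hf (neg_ne_zero.2 hζ)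
  refine (h1.add (h2.comp_add_left ζ)).congr ?_
  filter_upwards [ae_ne_zero] with w hw
  exact (mul_shift_eq_halfConv_add ζ f hw).symm

/-- Translating by ζ moves the second singularity to the origin, so that both halves are dominated
by functions centred there. -/
lemma planeConv_eq_halfConv (hα : 0 < α) (hβ : 0 < β) (h : 1 < 1 / α + 1 / β)
    (h' : 1 / α + 1 / β < 2) {f : ℝ × ℝ → ℝ} {C : ℝ} (hfm : Measurable f)
    (hf : ∀ x, x ≠ 0 → |f x| ≤ C * (eta α β x)⁻¹) {ζ : ℝ × ℝ} (hζ : ζ ≠ 0) :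
    planeConv f f ζ = (∫ w, halfConv α β f ζ w) + ∫ w, halfConv α β f (-ζ) w := by
  have h1 := integrable_halfConv hα hβ h h' hfm hf hζ
  have h2 := integrable_halfConv hα hβ h h' hfm hf (neg_ne_zero.2 hζ)
  rw [planeConv, ← integral_add_left_eq_self (halfConv α β f (-ζ)) ζ,
    ← integral_add h1 (h2.comp_add_left ζ)]
  refine integral_congr_ae ?_
  filter_upwards [ae_ne_zero] with w hw
  exact mul_shift_eq_halfConv_add ζ f hw

variable {ι : Type*} {l : Filter ι}

/-- Convergence along moving points is required of the kernels because the argument ζ i + w varies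
with i. -/
lemma tendsto_integral_halfConv [l.IsCountablyGenerated] (hα : 0 < α) (hβ : 0 < β)
    (h : 1 < 1 / α + 1 / β) (h' : 1 / α + 1 / β < 2) {f : ι → ℝ × ℝ → ℝ} {g : ℝ × ℝ → ℝ} {C : ℝ}
    (hfm : ∀ i, Measurable (f i))
    (hf : ∀ᶠ i in l, ∀ x, x ≠ 0 → |f i x| ≤ C * (eta α β x)⁻¹)
    (hconv : ∀ᵐ x, ∀ u : ι → ℝ × ℝ, Tendsto u l (𝓝 x) →
      Tendsto (fun i => f i (u i)) l (𝓝 (g x)))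
    {ζ : ι → ℝ × ℝ} {ζ₀ : ℝ × ℝ} (hζ : Tendsto ζ l (𝓝 ζ₀)) (hζ₀ : ζ₀ ≠ 0) :
    Tendsto (fun i => ∫ w, halfConv α β (f i) (ζ i) w) l (𝓝 (∫ w, halfConv α β g ζ₀ w)) := by
  have hη := continuous_eta hα hβ
  set K : ℝ := 2 ^ α + 2 ^ β with hK
  have hK0 : 0 < K :=
    add_pos (Real.rpow_pos_of_pos two_pos α) (Real.rpow_pos_of_pos two_pos β)
  -- Half of the bound in `le_eta_add_eta` at ζ₀, so that it remains valid for every ζ i close to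
  -- ζ₀.
  set c : ℝ := eta α β ζ₀ / 2 / K with hc
  have hc0 : 0 < c := by have := eta_pos (α := α) (β := β) hζ₀; positivity
  have hev : ∀ᶠ i in l, eta α β ζ₀ / 2 < eta α β (ζ i) :=
    ((hη.tendsto ζ₀).comp hζ).eventually_const_lt (half_lt_self (eta_pos hζ₀))
  refine tendsto_integral_filter_of_dominated_convergence
    (fun w => 2 * C ^ 2 * (eta α β w * (eta α β w + c))⁻¹)
    (Eventually.of_forall fun i => (measurable_halfConv hα hβ (hfm i) (ζ i)).aestronglyMeasurable)
    ?_ ((integrable_inv_eta_mul hα hβ h h' hc0).const_mul _) ?_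
  · filter_upwards [hf, hev] with i hi hi'
    filter_upwards [ae_ne_zero, ae_add_ne_zero (ζ i)] with w hw hζw
    refine norm_halfConv_le hi hc0 (le_trans ?_ (le_eta_add_eta hα hβ (ζ i) w)) hw hζw
    rw [hc]
    gcongr
  · filter_upwards [hconv, (quasiMeasurePreserving_add_left volume ζ₀).ae hconv, ae_ne_zero]
      with w hw hw' hw0
    have h1 : Tendsto (fun i => ζ i + w) l (𝓝 (ζ₀ + w)) := hζ.add_const w
    have h2 := (hη.tendsto _).comp h1
    refine ((hw (fun _ => w) tendsto_const_nhds).mul (hw' _ h1)).mul (h2.div (h2.const_add _) ?_)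
    have := eta_pos (α := α) (β := β) hw0
    have := eta_nonneg (α := α) (β := β) (ζ₀ + w)
    positivity

/-- Correlations of kernels bounded by `C / η` converge, locally uniformly off the origin, if the
kernels converge continuously almost everywhere. -/
lemma tendsto_planeConv [l.IsCountablyGenerated] (hα : 0 < α) (hβ : 0 < β)
    (h : 1 < 1 / α + 1 / β) (h' : 1 / α + 1 / β < 2) {f : ι → ℝ × ℝ → ℝ} {g : ℝ × ℝ → ℝ} {C : ℝ}
    (hfm : ∀ i, Measurable (f i)) (hgm : Measurable g)
    (hf : ∀ᶠ i in l, ∀ x, x ≠ 0 → |f i x| ≤ C * (eta α β x)⁻¹)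
    (hg : ∀ x, x ≠ 0 → |g x| ≤ C * (eta α β x)⁻¹)
    (hconv : ∀ᵐ x, ∀ u : ι → ℝ × ℝ, Tendsto u l (𝓝 x) →
      Tendsto (fun i => f i (u i)) l (𝓝 (g x)))
    {ζ : ι → ℝ × ℝ} {ζ₀ : ℝ × ℝ} (hζ : Tendsto ζ l (𝓝 ζ₀)) (hζ₀ : ζ₀ ≠ 0) :
    Tendsto (fun i => planeConv (f i) (f i) (ζ i)) l (𝓝 (planeConv g g ζ₀)) := by
  rw [planeConv_eq_halfConv hα hβ h h' hgm hg hζ₀]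
  refine ((tendsto_integral_halfConv hα hβ h h' hfm hf hconv hζ hζ₀).add
    (tendsto_integral_halfConv hα hβ h h' hfm hf hconv hζ.neg (neg_ne_zero.2 hζ₀))).congr' ?_
  filter_upwards [hf, hζ.eventually_ne hζ₀] with i hi hi'
  rw [planeConv_eq_halfConv hα hβ h h' (hfm i) hi hi']

end Correlation

/-! ### The limit kernel -/

/-- The pair `(t / Λ^(1/α), s / Λ^(1/β))`. -/
def scaleDown (α β Λ : ℝ) (z : ℤ × ℤ) : ℝ × ℝ :=
  ((z.1 : ℝ) / Λ ^ (1 / α), (z.2 : ℝ) / Λ ^ (1 / β))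

section Rho

variable {q₁ q₂ : ℝ}

lemma rho_nonneg (x : ℝ × ℝ) : 0 ≤ rho q₁ q₂ x := Real.sqrt_nonneg _

lemma rho_sq (x : ℝ × ℝ) : rho q₁ q₂ x ^ 2 = |x.1| ^ 2 + |x.2| ^ (2 * q₂ / q₁) :=
  Real.sq_sqrt (by positivity)

lemma abs_fst_le_rho (x : ℝ × ℝ) : |x.1| ≤ rho q₁ q₂ x := by
  refine Real.le_sqrt_of_sq_le ?_
  have : 0 ≤ |x.2| ^ (2 * q₂ / q₁) := by positivity
  linarith

lemma rho_pos {x : ℝ × ℝ} (hx : x ≠ 0) : 0 < rho q₁ q₂ x := by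
  unfold rho
  refine Real.sqrt_pos.2 ?_
  by_cases h1 : x.1 = 0
  · have h2 : x.2 ≠ 0 := fun h2 => hx (Prod.ext h1 h2)
    have := Real.rpow_pos_of_pos (abs_pos.2 h2) (2 * q₂ / q₁)
    positivity
  · have := abs_pos.2 h1
    positivity

lemma continuous_rho (h₁ : 0 < q₁) (h₂ : 0 < q₂) : Continuous (rho q₁ q₂) := by
  unfold rho
  exact ((continuous_fst.abs.pow 2).add
    (continuous_snd.abs.rpow_const fun _ => Or.inr (by positivity))).sqrt

lemma ratio_mem (x : ℝ × ℝ) : x.1 / rho q₁ q₂ x ∈ Icc (-1 : ℝ) 1 := by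
  refine abs_le.1 ?_
  rw [abs_div, abs_of_nonneg (rho_nonneg x)]
  exact div_le_one_of_le₀ (abs_fst_le_rho x) (rho_nonneg x)

lemma eta_le_rho_rpow (h₁ : 0 < q₁) (x : ℝ × ℝ) :
    eta q₁ q₂ x ≤ 2 * rho q₁ q₂ x ^ q₁ := by
  have h3 : |x.1| ^ q₁ ≤ rho q₁ q₂ x ^ q₁ :=
    Real.rpow_le_rpow (abs_nonneg _) (abs_fst_le_rho x) h₁.le
  have h4 : |x.2| ^ (q₂ / q₁) ≤ rho q₁ q₂ x := by
    refine Real.le_sqrt_of_sq_le ?_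
    rw [← Real.rpow_natCast, ← Real.rpow_mul (abs_nonneg _)]
    have : q₂ / q₁ * ((2 : ℕ) : ℝ) = 2 * q₂ / q₁ := by push_cast; ring
    rw [this]
    have : 0 ≤ |x.1| ^ 2 := by positivity
    linarith
  have h5 := Real.rpow_le_rpow (by positivity) h4 h₁.le
  rw [← Real.rpow_mul (abs_nonneg _), div_mul_cancel₀ _ h₁.ne'] at h5
  unfold eta
  linarith

lemma rho_rpow_neg_le (h₁ : 0 < q₁) {x : ℝ × ℝ} (hx : x ≠ 0) :
    rho q₁ q₂ x ^ (-q₁) ≤ 2 * (eta q₁ q₂ x)⁻¹ := by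
  have h3 := rho_pos (q₁ := q₁) (q₂ := q₂) hx
  have h4 := eta_pos (α := q₁) (β := q₂) hx
  rw [Real.rpow_neg h3.le, ← div_eq_mul_inv, inv_eq_one_div,
    div_le_div_iff₀ (by positivity) h4, one_mul]
  exact eta_le_rho_rpow h₁ x

/-- Under the anisotropic dilation the angular argument t/ρ is unchanged, hence a_∞ is multiplied by
1/Λ. -/
lemma rho_scale (h₁ : 0 < q₁) (h₂ : 0 < q₂) {Λ : ℝ} (hΛ : 0 < Λ) (x : ℝ × ℝ) :
    rho q₁ q₂ (Λ ^ (1 / q₁) * x.1, Λ ^ (1 / q₂) * x.2) = Λ ^ (1 / q₁) * rho q₁ q₂ x := by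
  have h3 : 0 < Λ ^ (1 / q₁) := Real.rpow_pos_of_pos hΛ _
  have h4 : 0 < Λ ^ (1 / q₂) := Real.rpow_pos_of_pos hΛ _
  unfold rho
  dsimp only
  rw [← Real.sqrt_sq h3.le, ← Real.sqrt_mul (sq_nonneg _), Real.sqrt_sq h3.le]
  congr 1
  rw [abs_mul, abs_mul, abs_of_pos h3, abs_of_pos h4, Real.mul_rpow h4.le (abs_nonneg _),
    ← Real.rpow_mul hΛ.le, mul_add, mul_pow]
  congr 2
  rw [← Real.rpow_natCast, ← Real.rpow_mul hΛ.le]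
  congr 1
  push_cast
  field_simp

end Rho

section Kernel

variable {q₁ q₂ : ℝ} {L₀ : ℝ → ℝ} {a : ℤ × ℤ → ℝ} (ha : CoefAssumption q₁ q₂ L₀ a)
include ha

lemma CoefAssumption.aInf_nonneg (x : ℝ × ℝ) : 0 ≤ aInf q₁ q₂ L₀ x :=
  mul_nonneg (Real.rpow_nonneg (rho_nonneg x) _) (ha.nonneg _ (ratio_mem x))

/-- Nothing is known of `L₀` outside [-1,1]. Since t/ρ always lies in that interval, `L₀` can be
replaced by 0 outside it. -/
lemma CoefAssumption.measurable_aInf : Measurable (aInf q₁ q₂ L₀) := by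
  obtain ⟨F, hF, hc⟩ := ha.piecewise
  classical
  have h1 : Measurable ((Icc (-1 : ℝ) 1 \ F).piecewise L₀ 0) :=
    hc.measurable_piecewise continuousOn_const (measurableSet_Icc.diff hF.measurableSet)
  have h2 : Measurable ((Icc (-1 : ℝ) 1).piecewise L₀ 0) := by
    refine h1.measurable_of_countable_ne (hF.countable.mono fun x hx => ?_)
    by_contra hxF
    refine hx ?_
    by_cases hxI : x ∈ Icc (-1 : ℝ) 1
    · rw [piecewise_eq_of_mem _ _ _ hxI,
        piecewise_eq_of_mem _ _ _ (show x ∈ Icc (-1 : ℝ) 1 \ F from ⟨hxI, hxF⟩)]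
    · rw [piecewise_eq_of_notMem _ _ _ hxI, piecewise_eq_of_notMem _ _ _ fun h : x ∈ Icc (-1 : ℝ) 1 \ F => hxI h.1]
  have h3 : aInf q₁ q₂ L₀ = fun x => rho q₁ q₂ x ^ (-q₁) *
      (Icc (-1 : ℝ) 1).piecewise L₀ 0 (x.1 / rho q₁ q₂ x) := by
    funext x
    rw [aInf, piecewise_eq_of_mem _ _ _ (ratio_mem x)]
  rw [h3]
  have hρ := (continuous_rho ha.q₁_pos ha.q₂_pos).measurable
  exact (hρ.pow_const _).mul (h2.comp (measurable_fst.div hρ))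

lemma CoefAssumption.exists_aInf_le : ∃ C : ℝ, 0 ≤ C ∧
    ∀ x, x ≠ 0 → |aInf q₁ q₂ L₀ x| ≤ C * (eta q₁ q₂ x)⁻¹ := by
  obtain ⟨C, hC⟩ := ha.bounded
  have hC0 : 0 ≤ C := (ha.nonneg 0 (by simp)).trans (hC 0 (by simp))
  refine ⟨2 * C, by positivity, fun x hx => ?_⟩
  rw [abs_of_nonneg (ha.aInf_nonneg x), aInf]
  have h1 := rho_rpow_neg_le (q₂ := q₂) ha.q₁_pos hx
  have h2 := hC _ (ratio_mem (q₁ := q₁) (q₂ := q₂) x)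
  have h3 := ha.nonneg _ (ratio_mem (q₁ := q₁) (q₂ := q₂) x)
  have h4 : 0 ≤ rho q₁ q₂ x ^ (-q₁) := Real.rpow_nonneg (rho_nonneg x) _
  calc _ ≤ (2 * (eta q₁ q₂ x)⁻¹) * C := mul_le_mul h1 h2 h3 (h4.trans h1)
    _ = _ := by ring

omit ha in
lemma intCast_ne_zero {z : ℤ × ℤ} (hz : z ≠ 0) : ((z.1 : ℝ), (z.2 : ℝ)) ≠ 0 := by
  intro h
  refine hz (Prod.ext ?_ ?_)
  · have h1 : (z.1 : ℝ) = 0 := congrArg Prod.fst h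
    exact_mod_cast h1
  · have h1 : (z.2 : ℝ) = 0 := congrArg Prod.snd h
    exact_mod_cast h1

omit ha in
lemma one_le_eta_int (h₁ : 0 < q₁) (h₂ : 0 < q₂) {z : ℤ × ℤ} (hz : z ≠ 0) :
    1 ≤ eta q₁ q₂ ((z.1 : ℝ), (z.2 : ℝ)) := by
  unfold eta
  have h3 : 0 ≤ |(z.1 : ℝ)| ^ q₁ := by positivity
  have h4 : 0 ≤ |(z.2 : ℝ)| ^ q₂ := by positivity
  dsimp only
  by_cases h1 : z.1 = 0
  · have h2 : z.2 ≠ 0 := fun h2 => hz (Prod.ext h1 h2)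
    have : (1 : ℝ) ≤ |(z.2 : ℝ)| := by exact_mod_cast Int.one_le_abs h2
    have := Real.one_le_rpow this h₂.le
    linarith
  · have : (1 : ℝ) ≤ |(z.1 : ℝ)| := by exact_mod_cast Int.one_le_abs h1
    have := Real.one_le_rpow this h₁.le
    linarith

/-- The gauge is shifted by 1 so that the bound covers the origin, where the asymptotic formula says
nothing. -/
lemma CoefAssumption.exists_coef_le : ∃ C : ℝ, 0 ≤ C ∧
    ∀ z, |a z| ≤ C * (1 + eta q₁ q₂ ((z.1 : ℝ), (z.2 : ℝ)))⁻¹ := by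
  obtain ⟨C, hC⟩ := ha.bounded
  have hC0 : 0 ≤ C := (ha.nonneg 0 (by simp)).trans (hC 0 (by simp))
  obtain ⟨δ, hδ, hδa⟩ := ha.asymp
  obtain ⟨D, hD⟩ := hδ.norm.bddAbove_range_of_cofinite
  have hD' : ∀ z, |δ z| ≤ D := fun z => hD ⟨z, rfl⟩
  have hD0 : 0 ≤ D := (abs_nonneg _).trans (hD' 0)
  refine ⟨|a 0| + 4 * (C + D), by positivity, fun z => ?_⟩
  by_cases hz : z = 0
  · subst hz
    have : eta q₁ q₂ (((0 : ℤ × ℤ).1 : ℝ), ((0 : ℤ × ℤ).2 : ℝ)) = 0 := by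
      simp [eta, Real.zero_rpow ha.q₁_pos.ne', Real.zero_rpow ha.q₂_pos.ne']
    rw [this]
    simp
    positivity
  have h1 := one_le_eta_int ha.q₁_pos ha.q₂_pos hz
  have h2 := rho_rpow_neg_le (q₂ := q₂) ha.q₁_pos (intCast_ne_zero hz)
  have h3 := hC _ (ratio_mem (q₁ := q₁) (q₂ := q₂) ((z.1 : ℝ), (z.2 : ℝ)))
  have h4 := ha.nonneg _ (ratio_mem (q₁ := q₁) (q₂ := q₂) ((z.1 : ℝ), (z.2 : ℝ)))
  have h5 : 0 ≤ rho q₁ q₂ ((z.1 : ℝ), (z.2 : ℝ)) ^ (-q₁) := Real.rpow_nonneg (rho_nonneg _) _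
  set η := eta q₁ q₂ ((z.1 : ℝ), (z.2 : ℝ))
  have h6 : η⁻¹ ≤ 2 * (1 + η)⁻¹ := by
    rw [← div_eq_mul_inv, inv_eq_one_div, div_le_div_iff₀ (by positivity) (by positivity)]
    linarith
  have h7 : |L₀ ((z.1 : ℝ) / rho q₁ q₂ ((z.1 : ℝ), (z.2 : ℝ))) + δ z| ≤ C + D :=
    (abs_add_le _ _).trans (add_le_add ((abs_of_nonneg h4).trans_le h3) (hD' z))
  rw [hδa z hz, abs_mul, abs_of_nonneg h5]
  calc _ ≤ (2 * η⁻¹) * (C + D) := mul_le_mul h2 h7 (abs_nonneg _) (h5.trans h2)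
    _ ≤ (2 * (2 * (1 + η)⁻¹)) * (C + D) := by gcongr
    _ = 4 * (C + D) * (1 + η)⁻¹ := by ring
    _ ≤ _ := by gcongr; linarith [abs_nonneg (a 0)]

lemma CoefAssumption.summable_sq : Summable fun z => a z ^ 2 := by
  obtain ⟨C, -, hC⟩ := ha.exists_coef_le
  refine Summable.of_nonneg_of_le (fun z => sq_nonneg _) (fun z => ?_)
    ((summable_inv_one_add_eta_sq ha.q₁_pos ha.q₂_pos ha.lt_two).mul_left (C ^ 2))
  rw [← sq_abs, ← inv_pow, ← mul_pow]
  exact pow_le_pow_left₀ (abs_nonneg _) (hC z) 2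

omit ha in
-- For fixed t ≠ 0 the ratio determines ρ, hence |s|, so at most two values of s occur. The
-- discontinuities of `L₀` thus cost only a null set.
lemma ae_ratio_ne (h₁ : 0 < q₁) (h₂ : 0 < q₂) (f : ℝ) :
    ∀ᵐ x : ℝ × ℝ, x.1 / rho q₁ q₂ x ≠ f := by
  have hρ := (continuous_rho h₁ h₂).measurable
  have hm : MeasurableSet {x : ℝ × ℝ | x.1 / rho q₁ q₂ x = f} :=
    (measurable_fst.div hρ) (measurableSet_singleton f)
  rw [ae_iff]
  simp only [not_not]
  rw [Measure.volume_eq_prod, Measure.measure_prod_null hm]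
  have h0 : ∀ᵐ t : ℝ, t ≠ 0 := by rw [ae_iff]; simp
  filter_upwards [h0] with t ht
  have hb : 0 < 2 * q₂ / q₁ := by positivity
  refine Set.Finite.measure_zero ?_ _
  rcases (Prod.mk t ⁻¹' {x : ℝ × ℝ | x.1 / rho q₁ q₂ x = f}).eq_empty_or_nonempty with he | ⟨s₀, hs₀⟩
  · rw [he]; exact finite_empty
  refine (Set.toFinite {s₀, -s₀}).subset fun s hs => ?_
  have hx : ∀ s : ℝ, (t, s) ≠ 0 := fun s h => ht (congrArg Prod.fst h)
  have h1 : t / rho q₁ q₂ (t, s) = t / rho q₁ q₂ (t, s₀) := by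
    have h3 : t / rho q₁ q₂ (t, s) = f := hs
    have h4 : t / rho q₁ q₂ (t, s₀) = f := hs₀
    rw [h3, h4]
  have h2 : rho q₁ q₂ (t, s) = rho q₁ q₂ (t, s₀) := by
    have h3 := rho_pos (q₁ := q₁) (q₂ := q₂) (hx s)
    have h4 := rho_pos (q₁ := q₁) (q₂ := q₂) (hx s₀)
    field_simp at h1
    exact h1.symm
  have h3 := congrArg (· ^ 2) h2
  simp only [rho_sq] at h3
  have h4 : |s| ^ (2 * q₂ / q₁) = |s₀| ^ (2 * q₂ / q₁) := by linarith
  have h5 : |s| = |s₀| := (Real.rpow_left_inj (abs_nonneg _) (abs_nonneg _) hb.ne').1 h4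
  exact abs_eq_abs.1 h5

variable {ι : Type*} {l : Filter ι}

omit ha in
-- A fixed lattice point rescales to 0, so a nonzero limit forces the points to leave every finite
-- set, and the error term δ vanishes along them.
lemma tendsto_cofinite_of_scaleDown {α β : ℝ} (hα : 0 < α) (hβ : 0 < β) {Λ : ι → ℝ}
    (hΛ : Tendsto Λ l atTop) {z : ι → ℤ × ℤ} {x : ℝ × ℝ} (hx : x ≠ 0)
    (hz : Tendsto (fun i => scaleDown α β (Λ i) (z i)) l (𝓝 x)) : Tendsto z l cofinite := by
  rw [Tendsto, le_cofinite_iff_eventually_ne]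
  intro p
  rw [eventually_map]
  have h1 : ∀ {γ : ℝ}, 0 < γ → ∀ c : ℝ, Tendsto (fun i => c / Λ i ^ (1 / γ)) l (𝓝 0) := fun hγ c =>
    ((tendsto_rpow_atTop (by positivity)).comp hΛ).const_div_atTop c
  have h2 : Tendsto (fun i => scaleDown α β (Λ i) (z i) - scaleDown α β (Λ i) p) l (𝓝 (x - 0)) :=
    hz.sub ((h1 hα _).prodMk_nhds (h1 hβ _))
  rw [sub_zero] at h2
  filter_upwards [h2.eventually_ne hx] with i hi h
  exact hi (by rw [h, sub_self])

/-- The rescaled kernel converges continuously, almost everywhere. -/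
lemma CoefAssumption.ae_tendsto : ∀ᵐ x : ℝ × ℝ, ∀ (Λ : ι → ℝ) (z : ι → ℤ × ℤ),
    Tendsto Λ l atTop → Tendsto (fun i => scaleDown q₁ q₂ (Λ i) (z i)) l (𝓝 x) →
    Tendsto (fun i => Λ i * a (z i)) l (𝓝 (aInf q₁ q₂ L₀ x)) := by
  obtain ⟨F, hF, hc⟩ := ha.piecewise
  obtain ⟨δ, hδ, hδa⟩ := ha.asymp
  have hρ := continuous_rho ha.q₁_pos ha.q₂_pos
  have hae : ∀ᵐ x : ℝ × ℝ, ∀ f ∈ F, x.1 / rho q₁ q₂ x ≠ f :=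
    (ae_ball_iff hF.countable).2 fun f _ => ae_ratio_ne ha.q₁_pos ha.q₂_pos f
  filter_upwards [ae_ne_zero, hae] with x hx hxF
  intro Λ z hΛ hz
  set y : ι → ℝ × ℝ := fun i => scaleDown q₁ q₂ (Λ i) (z i) with hy
  have hρx := rho_pos (q₁ := q₁) (q₂ := q₂) hx
  have hρy : Tendsto (fun i => rho q₁ q₂ (y i)) l (𝓝 (rho q₁ q₂ x)) := (hρ.tendsto x).comp hz
  have hratio : Tendsto (fun i => (y i).1 / rho q₁ q₂ (y i)) l (𝓝 (x.1 / rho q₁ q₂ x)) :=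
    ((continuous_fst.tendsto x).comp hz).div hρy hρx.ne'
  have hmem : x.1 / rho q₁ q₂ x ∈ Icc (-1 : ℝ) 1 \ F :=
    ⟨ratio_mem x, fun h => hxF _ h rfl⟩
  have hev : ∀ᶠ i in l, (y i).1 / rho q₁ q₂ (y i) ∈ Icc (-1 : ℝ) 1 \ F := by
    filter_upwards [hratio.eventually (hF.isClosed.isOpen_compl.mem_nhds hmem.2)] with i hi
    exact ⟨ratio_mem _, hi⟩
  have hL : Tendsto (fun i => L₀ ((y i).1 / rho q₁ q₂ (y i))) l (𝓝 (L₀ (x.1 / rho q₁ q₂ x))) :=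
    (hc _ hmem).tendsto.comp (tendsto_nhdsWithin_iff.2 ⟨hratio, hev⟩)
  have hδz : Tendsto (fun i => δ (z i)) l (𝓝 0) :=
    hδ.comp (tendsto_cofinite_of_scaleDown ha.q₁_pos ha.q₂_pos hΛ hx hz)
  have hlim : Tendsto (fun i => rho q₁ q₂ (y i) ^ (-q₁) *
      (L₀ ((y i).1 / rho q₁ q₂ (y i)) + δ (z i))) l (𝓝 (aInf q₁ q₂ L₀ x)) := by
    have := (hρy.rpow_const (p := -q₁) (Or.inl hρx.ne')).mul (hL.add hδz)
    rwa [add_zero] at this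
  refine hlim.congr' ?_
  filter_upwards [hz.eventually_ne hx, hΛ.eventually_gt_atTop 0] with i hi hΛi
  have hzi : z i ≠ 0 := by
    intro h
    apply hi
    simp only [hy, scaleDown, h]
    simp
  have h3 : 0 < Λ i ^ (1 / q₁) := Real.rpow_pos_of_pos hΛi _
  have h4 : 0 < Λ i ^ (1 / q₂) := Real.rpow_pos_of_pos hΛi _
  have hzy : (((z i).1 : ℝ), ((z i).2 : ℝ)) =
      (Λ i ^ (1 / q₁) * (y i).1, Λ i ^ (1 / q₂) * (y i).2) := by
    simp only [hy, scaleDown]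
    rw [mul_div_cancel₀ _ h3.ne', mul_div_cancel₀ _ h4.ne']
  have hz1 : ((z i).1 : ℝ) = Λ i ^ (1 / q₁) * (y i).1 := congrArg Prod.fst hzy
  have hyρ := rho_pos (q₁ := q₁) (q₂ := q₂) hi
  rw [hδa _ hzi, hzy, rho_scale ha.q₁_pos ha.q₂_pos hΛi, hz1, mul_div_mul_left _ _ h3.ne',
    Real.mul_rpow h3.le hyρ.le, ← Real.rpow_mul hΛi.le]
  have : 1 / q₁ * -q₁ = -1 := by
    have := ha.q₁_pos.ne'
    field_simp
  rw [this, Real.rpow_neg_one]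
  field_simp

omit ha in
lemma tendsto_floor_div {A : ι → ℝ} (hA : Tendsto A l atTop) {u : ι → ℝ} {x : ℝ}
    (hu : Tendsto u l (𝓝 x)) : Tendsto (fun i => (⌊A i * u i⌋ : ℝ) / A i) l (𝓝 x) := by
  have h1 : Tendsto (fun i => (⌊A i * u i⌋ : ℝ) / A i - u i) l (𝓝 0) := by
    refine squeeze_zero_norm' ?_ (hA.const_div_atTop 1)
    filter_upwards [hA.eventually_gt_atTop 0] with i hi
    have h2 : (⌊A i * u i⌋ : ℝ) / A i - u i = (⌊A i * u i⌋ - A i * u i) / A i := by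
      field_simp
    rw [h2, norm_div, Real.norm_eq_abs, Real.norm_eq_abs, abs_of_pos hi]
    gcongr
    rw [abs_le]
    exact ⟨by linarith [Int.lt_floor_add_one (A i * u i)], by linarith [Int.floor_le (A i * u i)]⟩
  simpa using h1.add hu

/-- The rescaled step function of the kernel. -/
def stepKernel (q₁ q₂ : ℝ) (a : ℤ × ℤ → ℝ) (Λ : ℝ) (x : ℝ × ℝ) : ℝ :=
  Λ * a (floorMap (Λ ^ (1 / q₁)) (Λ ^ (1 / q₂)) x)

omit ha in
lemma measurable_stepKernel (Λ : ℝ) : Measurable (stepKernel q₁ q₂ a Λ) :=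
  ((measurable_of_countable a).comp (measurable_floorMap _ _)).const_mul Λ

omit ha in
-- The lattice bound passes to the rescaled step functions with a constant free of Λ, which supplies
-- the dominating functions below.
lemma mul_eta_le_floorMap {α β : ℝ} (hα : 0 < α) (hβ : 0 < β) {Λ : ℝ} (hΛ : 0 < Λ) (x : ℝ × ℝ) :
    Λ * eta α β x ≤ (2 ^ α + 2 ^ β) *
      (1 + eta α β (((floorMap (Λ ^ (1 / α)) (Λ ^ (1 / β)) x).1 : ℝ),
        ((floorMap (Λ ^ (1 / α)) (Λ ^ (1 / β)) x).2 : ℝ))) := by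
  have h1 := abs_rpow_le_floor hα (Λ ^ (1 / α) * x.1)
  have h2 := abs_rpow_le_floor hβ (Λ ^ (1 / β) * x.2)
  have h3 : ∀ {γ : ℝ}, 0 < γ → ∀ t : ℝ, |Λ ^ (1 / γ) * t| ^ γ = Λ * |t| ^ γ := by
    intro γ hγ t
    rw [abs_mul, abs_of_pos (Real.rpow_pos_of_pos hΛ _), Real.mul_rpow (by positivity)
      (abs_nonneg _), ← Real.rpow_mul hΛ.le, one_div_mul_cancel hγ.ne', Real.rpow_one]
  rw [h3 hα] at h1
  rw [h3 hβ] at h2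
  unfold eta floorMap
  dsimp only
  have h4 : (0 : ℝ) < 2 ^ α := Real.rpow_pos_of_pos two_pos α
  have h5 : (0 : ℝ) < 2 ^ β := Real.rpow_pos_of_pos two_pos β
  have h6 : 0 ≤ |(⌊Λ ^ (1 / α) * x.1⌋ : ℝ)| ^ α := by positivity
  have h7 : 0 ≤ |(⌊Λ ^ (1 / β) * x.2⌋ : ℝ)| ^ β := by positivity
  nlinarith [mul_nonneg h4.le h7, mul_nonneg h5.le h6]

lemma CoefAssumption.exists_stepKernel_le : ∃ C : ℝ, 0 ≤ C ∧ ∀ Λ : ℝ, 0 < Λ → ∀ x, x ≠ 0 →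
    |stepKernel q₁ q₂ a Λ x| ≤ C * (eta q₁ q₂ x)⁻¹ := by
  obtain ⟨C, hC0, hC⟩ := ha.exists_coef_le
  refine ⟨C * (2 ^ q₁ + 2 ^ q₂), by positivity, fun Λ hΛ x hx => ?_⟩
  have h1 := hC (floorMap (Λ ^ (1 / q₁)) (Λ ^ (1 / q₂)) x)
  have h2 := mul_eta_le_floorMap ha.q₁_pos ha.q₂_pos hΛ x
  have h3 := eta_pos (α := q₁) (β := q₂) hx
  rw [stepKernel, abs_mul, abs_of_pos hΛ]
  set E := eta q₁ q₂ (((floorMap (Λ ^ (1 / q₁)) (Λ ^ (1 / q₂)) x).1 : ℝ),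
        ((floorMap (Λ ^ (1 / q₁)) (Λ ^ (1 / q₂)) x).2 : ℝ)) with hE
  have hE0 : 0 ≤ E := eta_nonneg _
  calc _ ≤ Λ * (C * (1 + E)⁻¹) := mul_le_mul_of_nonneg_left h1 hΛ.le
    _ = C * (Λ / (1 + E)) := by ring
    _ ≤ C * ((2 ^ q₁ + 2 ^ q₂) / eta q₁ q₂ x) := by
        refine mul_le_mul_of_nonneg_left ?_ hC0
        rw [div_le_div_iff₀ (by positivity) h3]
        exact h2
    _ = _ := by ring

omit ha in
-- An exact identity, since shifts by lattice points commute with the floor. The exponent collects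
-- Λ² from the two kernels and Λ^(-Q) from the cell area.
lemma corr_eq_planeConv (hs : Summable fun z => a z ^ 2) {Λ : ℝ} (hΛ : 0 < Λ) (z : ℤ × ℤ) :
    Λ ^ (2 - expQ q₁ q₂) * corr a z =
      planeConv (stepKernel q₁ q₂ a Λ) (stepKernel q₁ q₂ a Λ) (scaleDown q₁ q₂ Λ z) := by
  have h3 : 0 < Λ ^ (1 / q₁) := Real.rpow_pos_of_pos hΛ _
  have h4 : 0 < Λ ^ (1 / q₂) := Real.rpow_pos_of_pos hΛ _
  have hsum : Summable fun p => a p * a (z + p) := by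
    have h5 : Summable fun p => a (z + p) ^ 2 := (Equiv.addLeft z).summable_iff.2 hs
    refine Summable.of_norm_bounded (hs.add h5) fun p => ?_
    rw [norm_mul, Real.norm_eq_abs, Real.norm_eq_abs, ← sq_abs (a p), ← sq_abs (a (z + p))]
    nlinarith [sq_nonneg (|a p| - |a (z + p)|), sq_nonneg (|a p|), sq_nonneg (|a (z + p)|)]
  rw [corr, tsum_eq_integral_floor h3 h4 hsum, planeConv]
  have h5 : ∀ w : ℝ × ℝ, stepKernel q₁ q₂ a Λ w * stepKernel q₁ q₂ a Λ (scaleDown q₁ q₂ Λ z + w) =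
      Λ ^ 2 * (a (floorMap (Λ ^ (1 / q₁)) (Λ ^ (1 / q₂)) w) *
        a (z + floorMap (Λ ^ (1 / q₁)) (Λ ^ (1 / q₂)) w)) := by
    intro w
    have h6 : floorMap (Λ ^ (1 / q₁)) (Λ ^ (1 / q₂)) (scaleDown q₁ q₂ Λ z + w) =
        z + floorMap (Λ ^ (1 / q₁)) (Λ ^ (1 / q₂)) w := by
      refine Prod.ext ?_ ?_
      · simp only [floorMap, scaleDown, Prod.fst_add, mul_add, mul_div_cancel₀ _ h3.ne',
          Int.floor_intCast_add]
      · simp only [floorMap, scaleDown, Prod.snd_add, mul_add, mul_div_cancel₀ _ h4.ne',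
          Int.floor_intCast_add]
    rw [stepKernel, stepKernel, h6]
    ring
  simp_rw [h5]
  rw [integral_const_mul, ← mul_assoc]
  congr 1
  rw [← Real.rpow_add hΛ, ← Real.rpow_add hΛ, ← Real.rpow_natCast]
  congr 1
  rw [expQ]
  push_cast
  ring

/-- The limit correlation. -/
def corrInf (q₁ q₂ : ℝ) (L₀ : ℝ → ℝ) : ℝ × ℝ → ℝ :=
  planeConv (aInf q₁ q₂ L₀) (aInf q₁ q₂ L₀)

lemma CoefAssumption.expP₁_pos : 0 < expP₁ q₁ q₂ :=
  mul_pos ha.q₁_pos (by linarith [ha.lt_two])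

lemma CoefAssumption.expP₂_pos : 0 < expP₂ q₁ q₂ :=
  mul_pos ha.q₂_pos (by linarith [ha.lt_two])

/-- The correlation of the kernel converges continuously to the limit correlation. -/
lemma CoefAssumption.tendsto_corr [l.IsCountablyGenerated] {Λ : ι → ℝ} (hΛ : Tendsto Λ l atTop)
    {z : ι → ℤ × ℤ} {ζ : ℝ × ℝ} (hζ : ζ ≠ 0)
    (hz : Tendsto (fun i => scaleDown (expP₁ q₁ q₂) (expP₂ q₁ q₂) (Λ i) (z i)) l (𝓝 ζ)) :
    Tendsto (fun i => Λ i * corr a (z i)) l (𝓝 (corrInf q₁ q₂ L₀ ζ)) := by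
  have hQ : 0 < 2 - expQ q₁ q₂ := by linarith [ha.lt_two]
  -- The scale M satisfies M^(2 - Q) = Λ and M^(1/q_i) = Λ^(1/p_i); this is the origin of p_i = q_i
  -- (2 - Q).
  set M : ι → ℝ := fun i => Λ i ^ (1 / (2 - expQ q₁ q₂)) with hM
  have hMt : Tendsto M l atTop := (tendsto_rpow_atTop (by positivity)).comp hΛ
  obtain ⟨C₁, hC₁, h₁⟩ := ha.exists_stepKernel_le
  obtain ⟨C₂, hC₂, h₂⟩ := ha.exists_aInf_le
  have hpow : ∀ i, 0 < Λ i → ∀ q, 0 < q → M i ^ (1 / q) = Λ i ^ (1 / (q * (2 - expQ q₁ q₂))) := by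
    intro i hi q hq
    rw [hM, ← Real.rpow_mul hi.le]
    congr 1
    field_simp
  have hz' : Tendsto (fun i => scaleDown q₁ q₂ (M i) (z i)) l (𝓝 ζ) := by
    refine hz.congr' ?_
    filter_upwards [hΛ.eventually_gt_atTop 0] with i hi
    rw [scaleDown, scaleDown, hpow i hi q₁ ha.q₁_pos, hpow i hi q₂ ha.q₂_pos]
    rfl
  have hconv : ∀ᵐ x : ℝ × ℝ, ∀ u : ι → ℝ × ℝ, Tendsto u l (𝓝 x) →
      Tendsto (fun i => stepKernel q₁ q₂ a (M i) (u i)) l (𝓝 (aInf q₁ q₂ L₀ x)) := by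
    filter_upwards [ha.ae_tendsto (l := l)] with x hx
    intro u hu
    refine hx M (fun i => floorMap (M i ^ (1 / q₁)) (M i ^ (1 / q₂)) (u i)) hMt ?_
    have h3 : ∀ {q : ℝ}, 0 < q → Tendsto (fun i => M i ^ (1 / q)) l atTop := fun hq =>
      (tendsto_rpow_atTop (by positivity)).comp hMt
    exact (tendsto_floor_div (h3 ha.q₁_pos) ((continuous_fst.tendsto x).comp hu)).prodMk_nhds
      (tendsto_floor_div (h3 ha.q₂_pos) ((continuous_snd.tendsto x).comp hu))
  have hlim := tendsto_planeConv (C := max C₁ C₂) ha.q₁_pos ha.q₂_pos ha.one_lt ha.lt_two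
    (fun i => measurable_stepKernel (q₁ := q₁) (q₂ := q₂) (a := a) (M i)) ha.measurable_aInf
    (by
      filter_upwards [hMt.eventually_gt_atTop 0] with i hi x hx
      exact (h₁ _ hi x hx).trans (mul_le_mul_of_nonneg_right (le_max_left _ _)
        (inv_nonneg.2 (eta_nonneg x))))
    (fun x hx => (h₂ x hx).trans (mul_le_mul_of_nonneg_right (le_max_right _ _)
        (inv_nonneg.2 (eta_nonneg x)))) hconv hz' hζ
  refine hlim.congr' ?_
  filter_upwards [hMt.eventually_gt_atTop 0, hΛ.eventually_gt_atTop 0] with i hi hi'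
  rw [← corr_eq_planeConv ha.summable_sq hi, hM, ← Real.rpow_mul hi'.le,
    one_div_mul_cancel hQ.ne', Real.rpow_one]

lemma CoefAssumption.measurable_corrInf : Measurable (corrInf q₁ q₂ L₀) := by
  have h := ha.measurable_aInf
  have : Measurable fun x : (ℝ × ℝ) × (ℝ × ℝ) => aInf q₁ q₂ L₀ x.2 * aInf q₁ q₂ L₀ (x.1 + x.2) :=
    (h.comp measurable_snd).mul (h.comp (measurable_fst.add measurable_snd))
  exact (this.stronglyMeasurable.integral_prod_right').measurable

end Kernel

/-! ### Positivity of the limit correlation -/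

section Positivity

variable {q₁ q₂ : ℝ} {L₀ : ℝ → ℝ} {a : ℤ × ℤ → ℝ} (ha : CoefAssumption q₁ q₂ L₀ a)
include ha

lemma CoefAssumption.corrInf_nonneg (x : ℝ × ℝ) : 0 ≤ corrInf q₁ q₂ L₀ x :=
  integral_nonneg fun _ => mul_nonneg (ha.aInf_nonneg _) (ha.aInf_nonneg _)

lemma CoefAssumption.integrable_aInf_mul {ζ : ℝ × ℝ} (hζ : ζ ≠ 0) :
    Integrable fun w => aInf q₁ q₂ L₀ w * aInf q₁ q₂ L₀ (ζ + w) := by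
  obtain ⟨C, -, hC⟩ := ha.exists_aInf_le
  exact integrable_conv ha.q₁_pos ha.q₂_pos ha.one_lt ha.lt_two ha.measurable_aInf hC hζ

/-- The exceptional set and the endpoints are null, so `L₀` is positive at some interior continuity
point, and then near it. -/
lemma CoefAssumption.exists_eventually_pos
    (hL₀ : ¬ ∀ᵐ u ∂(volume.restrict (Icc (-1 : ℝ) 1)), L₀ u = 0) :
    ∃ u ∈ Ioo (-1 : ℝ) 1, ∀ᶠ v in 𝓝 u, 0 < L₀ v := by
  obtain ⟨F, hF, hc⟩ := ha.piecewise
  by_contra! hno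
  refine hL₀ ?_
  have h1 : ∀ᵐ u : ℝ, u ∉ F ∪ {-1, 1} :=
    measure_eq_zero_iff_ae_notMem.1
      ((hF.union (by simp : ({-1, 1} : Set ℝ).Finite)).measure_zero volume)
  rw [ae_restrict_iff' measurableSet_Icc]
  filter_upwards [h1] with u hu huI
  have hu1 : u ≠ -1 := fun h => hu (by simp [h])
  have hu2 : u ≠ 1 := fun h => hu (by simp [h])
  have huF : u ∉ F := fun h => hu (Or.inl h)
  have huo : u ∈ Ioo (-1 : ℝ) 1 := ⟨lt_of_le_of_ne huI.1 hu1.symm, lt_of_le_of_ne huI.2 hu2⟩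
  by_contra hne
  have hpos : 0 < L₀ u := lt_of_le_of_ne (ha.nonneg u huI) (Ne.symm hne)
  have hnhds : Icc (-1 : ℝ) 1 \ F ∈ 𝓝 u :=
    inter_mem (Icc_mem_nhds huo.1 huo.2) (hF.isClosed.isOpen_compl.mem_nhds huF)
  have hcont : ContinuousAt L₀ u := (hc u ⟨huI, huF⟩).continuousAt hnhds
  exact hno u huo ((hcont.eventually_const_lt hpos).mono fun v hv => not_le.2 hv)

lemma CoefAssumption.eventually_aInf_pos {x : ℝ × ℝ} (hx : x ≠ 0)
    (h : ∀ᶠ v in 𝓝 (x.1 / rho q₁ q₂ x), 0 < L₀ v) : ∀ᶠ y in 𝓝 x, 0 < aInf q₁ q₂ L₀ y := by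
  have h1 : Tendsto (fun y : ℝ × ℝ => y.1 / rho q₁ q₂ y) (𝓝 x) (𝓝 (x.1 / rho q₁ q₂ x)) :=
    (continuous_fst.tendsto x).div ((continuous_rho ha.q₁_pos ha.q₂_pos).tendsto x)
      (rho_pos hx).ne'
  filter_upwards [h1.eventually h, isOpen_ne.mem_nhds hx] with y hy hy0
  exact mul_pos (Real.rpow_pos_of_pos (rho_pos hy0) _) hy

/-- The kernel is positive near a whole ray of anisotropic dilates of one point. Far out along it
the shift by ζ is negligible at the dilated scale, so the kernel is positive at both w and ζ + w on
an open set of w. -/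
lemma CoefAssumption.corrInf_pos
    (hL₀ : ¬ ∀ᵐ u ∂(volume.restrict (Icc (-1 : ℝ) 1)), L₀ u = 0) {ζ : ℝ × ℝ} (hζ : ζ ≠ 0) :
    0 < corrInf q₁ q₂ L₀ ζ := by
  have h₁ := ha.q₁_pos
  have h₂ := ha.q₂_pos
  obtain ⟨u, huI, hu⟩ := ha.exists_eventually_pos hL₀
  have hu1 : 0 < 1 - u ^ 2 := by nlinarith [huI.1, huI.2]
  -- The point of the curve ρ = 1 with angular argument u.
  set x : ℝ × ℝ := (u, (1 - u ^ 2) ^ (q₁ / (2 * q₂))) with hx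
  have hρx : rho q₁ q₂ x = 1 := by
    rw [rho, hx]
    dsimp only
    rw [abs_of_pos (Real.rpow_pos_of_pos hu1 _), ← Real.rpow_mul hu1.le,
      show q₁ / (2 * q₂) * (2 * q₂ / q₁) = 1 by field_simp, Real.rpow_one, sq_abs]
    simp
  have hx0 : x ≠ 0 := fun h => by
    have := (Real.rpow_pos_of_pos hu1 (q₁ / (2 * q₂))).ne'
    exact this (congrArg Prod.snd h)
  have hA : ∀ {q : ℝ}, 0 < q → Tendsto (fun Λ : ℝ => Λ ^ (1 / q)) atTop atTop := fun hq =>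
    tendsto_rpow_atTop (by positivity)
  have hlim : Tendsto (fun Λ : ℝ => (ζ.1 / Λ ^ (1 / q₁) + x.1, ζ.2 / Λ ^ (1 / q₂) + x.2)) atTop
      (𝓝 x) := by
    have h3 := ((hA h₁).const_div_atTop ζ.1).add_const x.1
    have h4 := ((hA h₂).const_div_atTop ζ.2).add_const x.2
    rw [zero_add] at h3 h4
    exact h3.prodMk_nhds h4
  have hratio : Tendsto (fun y : ℝ × ℝ => y.1 / rho q₁ q₂ y) (𝓝 x) (𝓝 u) := by
    have := (continuous_fst.tendsto x).div ((continuous_rho h₁ h₂).tendsto x) (rho_pos hx0).ne'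
    rwa [hρx, div_one] at this
  obtain ⟨Λ, hΛ1, hΛ2, hΛ⟩ := ((hlim.eventually (hratio.eventually hu.eventually_nhds)).and
    ((hlim.eventually_ne hx0).and (eventually_gt_atTop 0))).exists
  have h3 : 0 < Λ ^ (1 / q₁) := Real.rpow_pos_of_pos hΛ _
  have h4 : 0 < Λ ^ (1 / q₂) := Real.rpow_pos_of_pos hΛ _
  set D : ℝ × ℝ → ℝ × ℝ := fun y => (Λ ^ (1 / q₁) * y.1, Λ ^ (1 / q₂) * y.2) with hD
  have hD0 : ∀ {y}, y ≠ 0 → D y ≠ 0 := by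
    intro y hy h
    refine hy (Prod.ext ?_ ?_)
    · exact (mul_eq_zero.1 (congrArg Prod.fst h)).resolve_left h3.ne'
    · exact (mul_eq_zero.1 (congrArg Prod.snd h)).resolve_left h4.ne'
  have hDr : ∀ y, (D y).1 / rho q₁ q₂ (D y) = y.1 / rho q₁ q₂ y := fun y => by
    rw [hD, rho_scale h₁ h₂ hΛ]
    exact mul_div_mul_left _ _ h3.ne'
  have hshift : ζ + D x = D (ζ.1 / Λ ^ (1 / q₁) + x.1, ζ.2 / Λ ^ (1 / q₂) + x.2) := by
    refine Prod.ext ?_ ?_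
    · simp only [hD, Prod.fst_add]; field_simp
    · simp only [hD, Prod.snd_add]; field_simp
  have hw1 : ∀ᶠ w in 𝓝 (D x), 0 < aInf q₁ q₂ L₀ w :=
    ha.eventually_aInf_pos (hD0 hx0) (by rw [hDr, hρx, div_one]; exact hu)
  have hw2 : ∀ᶠ w in 𝓝 (D x), 0 < aInf q₁ q₂ L₀ (ζ + w) := by
    have : ∀ᶠ w in 𝓝 (ζ + D x), 0 < aInf q₁ q₂ L₀ w := by
      rw [hshift]
      exact ha.eventually_aInf_pos (hD0 hΛ2) (by rw [hDr]; exact hΛ1)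
    exact ((continuous_const.add continuous_id).tendsto (D x)).eventually this
  rw [corrInf, planeConv, integral_pos_iff_support_of_nonneg
    (fun _ => mul_nonneg (ha.aInf_nonneg _) (ha.aInf_nonneg _)) (ha.integrable_aInf_mul hζ)]
  refine Measure.measure_pos_of_mem_nhds volume (x := D x) ?_
  filter_upwards [hw1, hw2] with w h5 h6
  exact (mul_pos h5 h6).ne'

end Positivity

/-! ### Lattice functions with a homogeneous limit -/

/-- `Λ R(z) → G(ζ)` when `Λ → ∞` and the rescaled lattice point converges to `ζ ≠ 0`, with a limit
that is positive off the origin and not integrable at infinity. -/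
structure HomogLimit (α β : ℝ) (R : ℤ × ℤ → ℝ) (G : ℝ × ℝ → ℝ) : Prop where
  α_pos : 0 < α
  β_pos : 0 < β
  one_lt : 1 < 1 / α + 1 / β
  meas : Measurable G
  nonneg : ∀ x, 0 ≤ G x
  pos : ∀ x, x ≠ 0 → 0 < G x
  tendsto : ∀ {ι : Type} {l : Filter ι} [l.IsCountablyGenerated] {Λ : ι → ℝ} {z : ι → ℤ × ℤ}
    {ζ : ℝ × ℝ}, Tendsto Λ l atTop → ζ ≠ 0 →
    Tendsto (fun i => scaleDown α β (Λ i) (z i)) l (𝓝 ζ) →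
    Tendsto (fun i => Λ i * R (z i)) l (𝓝 (G ζ))

/-- The kth power of the limit at scale Λ^(1/k) replaces p_i by k p_i. The hypothesis k < P is
exactly 1/(k p₁) + 1/(k p₂) > 1. -/
lemma CoefAssumption.homogLimit {q₁ q₂ : ℝ} {L₀ : ℝ → ℝ} {a : ℤ × ℤ → ℝ}
    (ha : CoefAssumption q₁ q₂ L₀ a)
    (hL₀ : ¬ ∀ᵐ u ∂(volume.restrict (Icc (-1 : ℝ) 1)), L₀ u = 0) {k : ℕ} (hk : 1 ≤ k)
    (hkP : (k : ℝ) < expP q₁ q₂) :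
    HomogLimit (k * expP₁ q₁ q₂) (k * expP₂ q₁ q₂) (fun z => corr a z ^ k)
      (fun x => corrInf q₁ q₂ L₀ x ^ k) := by
  have hk0 : (0 : ℝ) < k := by exact_mod_cast hk
  have h1 := ha.expP₁_pos
  have h2 := ha.expP₂_pos
  refine ⟨by positivity, by positivity, ?_, ha.measurable_corrInf.pow_const k,
    fun x => pow_nonneg (ha.corrInf_nonneg x) k, fun x hx => pow_pos (ha.corrInf_pos hL₀ hx) k, ?_⟩
  · rw [expP] at hkP
    have : 1 / (k * expP₁ q₁ q₂) + 1 / (k * expP₂ q₁ q₂) =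
        (1 / expP₁ q₁ q₂ + 1 / expP₂ q₁ q₂) / k := by field_simp
    rw [this, lt_div_iff₀ hk0, one_mul]
    exact hkP
  · intro ι l _ Λ z ζ hΛ hζ hz
    have hΛ' : Tendsto (fun i => Λ i ^ (1 / (k : ℝ))) l atTop :=
      (tendsto_rpow_atTop (by positivity)).comp hΛ
    have h3 : ∀ {p : ℝ}, 0 < p → ∀ i, 0 ≤ Λ i →
        (Λ i ^ (1 / (k : ℝ))) ^ (1 / p) = Λ i ^ (1 / (k * p)) := by
      intro p hp i hi
      rw [← Real.rpow_mul hi]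
      congr 1
      field_simp
    have hz' : Tendsto (fun i => scaleDown (expP₁ q₁ q₂) (expP₂ q₁ q₂) (Λ i ^ (1 / (k : ℝ))) (z i))
        l (𝓝 ζ) := by
      refine hz.congr' ?_
      filter_upwards [hΛ.eventually_ge_atTop 0] with i hi
      rw [scaleDown, scaleDown, h3 h1 i hi, h3 h2 i hi]
    refine ((ha.tendsto_corr hΛ' hζ hz').pow k).congr' ?_
    · filter_upwards [hΛ.eventually_ge_atTop 0] with i hi
      rw [mul_pow, ← Real.rpow_natCast, ← Real.rpow_mul hi, one_div_mul_cancel hk0.ne',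
        Real.rpow_one]

namespace HomogLimit

variable {α β : ℝ} {R : ℤ × ℤ → ℝ} {G : ℝ × ℝ → ℝ}

/-- This symmetry reduces γ < γ₀ to γ > γ₀. -/
lemma swap (h : HomogLimit α β R G) :
    HomogLimit β α (fun z => R z.swap) (fun x => G x.swap) := by
  refine ⟨h.β_pos, h.α_pos, by linarith [h.one_lt], h.meas.comp measurable_swap,
    fun x => h.nonneg _, fun x hx => h.pos _ fun h0 => hx (by simpa using congrArg Prod.swap h0), ?_⟩
  intro ι l _ Λ z ζ hΛ hζ hz
  exact h.tendsto (z := fun i => (z i).swap) hΛ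
    (fun h0 => hζ (by simpa using congrArg Prod.swap h0))
    ((continuous_swap.tendsto ζ).comp hz)

lemma tendsto_eta_cofinite (hα : 0 < α) (hβ : 0 < β) :
    Tendsto (fun z : ℤ × ℤ => eta α β ((z.1 : ℝ), (z.2 : ℝ))) cofinite atTop := by
  rw [tendsto_atTop]
  intro K
  refine mem_cofinite.2 ((Finset.finite_toSet
    (Finset.Icc (-⌈(max K 0) ^ (1 / α)⌉) ⌈(max K 0) ^ (1 / α)⌉ ×ˢ
      Finset.Icc (-⌈(max K 0) ^ (1 / β)⌉) ⌈(max K 0) ^ (1 / β)⌉)).subset ?_)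
  · intro z hz
    have hz' : eta α β ((z.1 : ℝ), (z.2 : ℝ)) < K := not_le.1 hz
    have key : ∀ {p : ℝ} {n : ℤ}, 0 < p → |(n : ℝ)| ^ p ≤ max K 0 →
        n ∈ Finset.Icc (-⌈(max K 0) ^ (1 / p)⌉) ⌈(max K 0) ^ (1 / p)⌉ := by
      intro p n hp hn
      have h1 := Real.rpow_le_rpow (by positivity) hn (by positivity : 0 ≤ 1 / p)
      rw [← Real.rpow_mul (abs_nonneg _), mul_one_div_cancel hp.ne', Real.rpow_one] at h1
      have h2 : |n| ≤ ⌈(max K 0) ^ (1 / p)⌉ := by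
        have : ((|n| : ℤ) : ℝ) ≤ ⌈(max K 0) ^ (1 / p)⌉ := by
          rw [Int.cast_abs]; exact h1.trans (Int.le_ceil _)
        exact_mod_cast this
      rw [Finset.mem_Icc]
      exact abs_le.1 h2
    have h3 : 0 ≤ |(z.1 : ℝ)| ^ α := by positivity
    have h4 : 0 ≤ |(z.2 : ℝ)| ^ β := by positivity
    unfold eta at hz'
    simp only [Finset.coe_product, Set.mem_prod, Finset.mem_coe]
    exact ⟨key hα (le_max_of_le_left (by dsimp only at hz'; linarith)),
      key hβ (le_max_of_le_left (by dsimp only at hz'; linarith))⟩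

lemma eta_scaleDown {Λ : ℝ} (hα : 0 < α) (hβ : 0 < β) (hΛ : 0 < Λ) (z : ℤ × ℤ) :
    eta α β (scaleDown α β Λ z) = eta α β ((z.1 : ℝ), (z.2 : ℝ)) / Λ := by
  have h1 : ∀ {p : ℝ}, 0 < p → ∀ t : ℝ, |t / Λ ^ (1 / p)| ^ p = |t| ^ p / Λ := by
    intro p hp t
    rw [abs_div, abs_of_pos (Real.rpow_pos_of_pos hΛ _), Real.div_rpow (abs_nonneg _) (by positivity),
      ← Real.rpow_mul hΛ.le, one_div_mul_cancel hp.ne', Real.rpow_one]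
  simp only [eta, scaleDown, h1 hα, h1 hβ]
  ring

lemma isCompact_eta_eq_one (hα : 0 < α) (hβ : 0 < β) : IsCompact {x | eta α β x = 1} := by
  refine (isCompact_Icc.prod isCompact_Icc : IsCompact (Icc (-1 : ℝ) 1 ×ˢ Icc (-1 : ℝ) 1)).of_isClosed_subset
    (isClosed_eq (continuous_eta hα hβ) continuous_const) fun x hx => ?_
  have h3 : 0 ≤ |x.1| ^ α := by positivity
  have h4 : 0 ≤ |x.2| ^ β := by positivity
  have h5 : |x.1| ^ α + |x.2| ^ β = 1 := hx
  refine ⟨abs_le.1 ?_, abs_le.1 ?_⟩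
  · by_contra! h
    linarith [Real.one_lt_rpow h hα]
  · by_contra! h
    linarith [Real.one_lt_rpow h hβ]

/-- Rescaling z by its own gauge puts it on the compact curve η = 1, where the limit is positive.
Bounds near each point of the curve are patched by compactness, without continuity of G. -/
lemma exists_eventually_bounds (h : HomogLimit α β R G) : ∃ c C : ℝ, 0 < c ∧ ∀ᶠ z in cofinite,
    c ≤ eta α β ((z.1 : ℝ), (z.2 : ℝ)) * R z ∧ eta α β ((z.1 : ℝ), (z.2 : ℝ)) * R z ≤ C := by
  set E : ℤ × ℤ → ℝ := fun z => eta α β ((z.1 : ℝ), (z.2 : ℝ)) with hE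
  have hEt : Tendsto E cofinite atTop := tendsto_eta_cofinite h.α_pos h.β_pos
  set y : ℤ × ℤ → ℝ × ℝ := fun z => scaleDown α β (E z) z with hy
  have key : ∃ c C : ℝ, 0 < c ∧ ∀ᶠ z in cofinite, y z ∈ {x | eta α β x = 1} →
      c ≤ E z * R z ∧ E z * R z ≤ C := by
    refine (isCompact_eta_eq_one h.α_pos h.β_pos).induction_on
      (p := fun S => ∃ c C : ℝ, 0 < c ∧ ∀ᶠ z in cofinite, y z ∈ S →
        c ≤ E z * R z ∧ E z * R z ≤ C) ⟨1, 1, one_pos, by simp⟩ ?_ ?_ ?_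
    · rintro S T hST ⟨c, C, hc, hev⟩
      exact ⟨c, C, hc, hev.mono fun z hz hzS => hz (hST hzS)⟩
    · rintro S T ⟨c, C, hc, hev⟩ ⟨c', C', hc', hev'⟩
      refine ⟨min c c', max C C', lt_min hc hc', ?_⟩
      filter_upwards [hev, hev'] with z hz hz'
      rintro (hS | hT)
      · exact ⟨(min_le_left _ _).trans (hz hS).1, (hz hS).2.trans (le_max_left _ _)⟩
      · exact ⟨(min_le_right _ _).trans (hz' hT).1, (hz' hT).2.trans (le_max_right _ _)⟩
    · intro x hx
      have hx0 : x ≠ 0 := by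
        rintro rfl
        have : eta α β (0 : ℝ × ℝ) = 1 := hx
        simp [eta, Real.zero_rpow h.α_pos.ne', Real.zero_rpow h.β_pos.ne'] at this
      -- The lattice point is its own index and its gauge is the scale; the filter encodes that the
      -- gauge tends to infinity and the rescaled point to x.
      have hlim : Tendsto (fun z => E z * R z) (comap E atTop ⊓ comap y (𝓝 x)) (𝓝 (G x)) :=
        h.tendsto (tendsto_comap.mono_left inf_le_left) hx0 (tendsto_comap.mono_left inf_le_right)
      have hG := h.pos x hx0
      have hev := hlim.eventually (Icc_mem_nhds (half_lt_self hG) (lt_add_one (G x)))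
      obtain ⟨s, hs, t, ht, hst⟩ := eventually_inf.1 hev
      obtain ⟨U, hU, hUt⟩ := mem_comap.1 ht
      have hs' : s ∈ cofinite := tendsto_iff_comap.1 hEt hs
      refine ⟨U, mem_nhdsWithin_of_mem_nhds hU, G x / 2, G x + 1, half_pos hG, ?_⟩
      filter_upwards [hs'] with z hz hzU
      exact hst z ⟨hz, hUt hzU⟩
  obtain ⟨c, C, hc, hev⟩ := key
  refine ⟨c, C, hc, ?_⟩
  filter_upwards [hev, hEt.eventually_gt_atTop 0] with z hz hz0
  refine hz ?_
  change eta α β (scaleDown α β (E z) z) = 1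
  rw [eta_scaleDown h.α_pos h.β_pos hz0, div_self hz0.ne']

lemma exists_le (h : HomogLimit α β R G) : ∃ C : ℝ, 0 ≤ C ∧
    ∀ z, |R z| ≤ C * (1 + eta α β ((z.1 : ℝ), (z.2 : ℝ)))⁻¹ := by
  obtain ⟨c, C, hc, hev⟩ := h.exists_eventually_bounds
  have hb : ∀ᶠ z in cofinite, |(1 + eta α β ((z.1 : ℝ), (z.2 : ℝ))) * R z| ≤ 2 * C := by
    filter_upwards [hev, (tendsto_eta_cofinite h.α_pos h.β_pos).eventually_ge_atTop 1] with z hz h1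
    have hR : 0 ≤ R z := by
      by_contra! hneg
      nlinarith [hz.1]
    rw [abs_of_nonneg (by positivity)]
    nlinarith [hz.2]
  obtain ⟨D, hD⟩ : ∃ D, ∀ z, |(1 + eta α β ((z.1 : ℝ), (z.2 : ℝ))) * R z| ≤ D := by
    obtain ⟨D, hD⟩ := (isBoundedUnder_of_eventually_le hb).bddAbove_range_of_cofinite
    exact ⟨D, fun z => hD ⟨z, rfl⟩⟩
  have hD0 : 0 ≤ D := (abs_nonneg _).trans (hD 0)
  refine ⟨D, hD0, fun z => ?_⟩
  have h1 : 0 ≤ eta α β ((z.1 : ℝ), (z.2 : ℝ)) := eta_nonneg _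
  rw [← div_eq_mul_inv, le_div_iff₀ (by positivity), mul_comm]
  have := hD z
  rwa [abs_mul, abs_of_pos (by positivity)] at this

end HomogLimit

/-! ### Double sums over boxes -/

/-- The triangular function `(1 - |u|)₊`. -/
def tri (u : ℝ) : ℝ := max 0 (1 - |u|)

lemma tri_nonneg (u : ℝ) : 0 ≤ tri u := le_max_left _ _

lemma tri_le_one (u : ℝ) : tri u ≤ 1 := max_le zero_le_one (by linarith [abs_nonneg u])

lemma tri_eq_zero {u : ℝ} (hu : 1 ≤ |u|) : tri u = 0 := max_eq_left (by linarith)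

lemma tri_pos {u : ℝ} (hu : |u| < 1) : 0 < tri u := lt_max_of_lt_right (by linarith)

lemma tri_zero : tri 0 = 1 := by simp [tri]

lemma continuous_tri : Continuous tri := continuous_const.max (continuous_const.sub continuous_abs)

lemma tri_le_indicator (u : ℝ) : tri u ≤ (Icc (-2 : ℝ) 2).indicator 1 u := by
  by_cases hu : u ∈ Icc (-2 : ℝ) 2
  · rw [indicator_of_mem hu]; exact tri_le_one u
  · rw [indicator_of_notMem hu, tri_eq_zero]
    by_contra! h
    have := abs_lt.1 h
    exact hu ⟨by linarith, by linarith⟩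

lemma tri_int_eq_zero {N d : ℤ} (hN : 0 < N) (hd : d ∉ Finset.Icc (-N) N) : tri (d / N) = 0 := by
  have hN' : (0 : ℝ) < N := by exact_mod_cast hN
  refine tri_eq_zero ?_
  rw [abs_div, abs_of_pos hN', one_le_div hN']
  by_contra! h
  have h2 : |d| < N := by exact_mod_cast h
  rw [abs_lt] at h2
  exact hd (Finset.mem_Icc.2 ⟨h2.1.le, h2.2.le⟩)

/-- The difference d occurs N - |d| times, which is N tri(d/N). -/
lemma sum_Icc_sub_eq {N : ℤ} (hN : 0 < N) (g : ℤ → ℝ) :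
    ∑ s ∈ Finset.Icc 1 N, ∑ s' ∈ Finset.Icc 1 N, g (s' - s) =
      N * ∑ d ∈ Finset.Icc (-N) N, tri (d / N) * g d := by
  have hN' : (0 : ℝ) < N := by exact_mod_cast hN
  have h1 : ∀ s ∈ Finset.Icc 1 N, ∑ s' ∈ Finset.Icc 1 N, g (s' - s) =
      ∑ d ∈ Finset.Icc (-N) N, if s + d ∈ Finset.Icc 1 N then g d else 0 := by
    intro s hs
    rw [← Finset.sum_filter]
    refine Finset.sum_bij (fun s' _ => s' - s) ?_ ?_ ?_ ?_
    · intro s' hs'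
      simp only [Finset.mem_filter, Finset.mem_Icc] at hs hs' ⊢
      omega
    · intro s' _ s'' _ h
      exact sub_left_injective h
    · intro d hd
      exact ⟨s + d, (Finset.mem_filter.1 hd).2, by ring⟩
    · intro s' _
      rfl
  rw [Finset.sum_congr rfl h1, Finset.sum_comm, Finset.mul_sum]
  refine Finset.sum_congr rfl fun d hd => ?_
  rw [← Finset.sum_filter, Finset.sum_const, nsmul_eq_mul, ← mul_assoc]
  congr 1
  have h2 : (Finset.Icc 1 N).filter (fun s => s + d ∈ Finset.Icc 1 N) =
      Finset.Icc (max 1 (1 - d)) (min N (N - d)) := by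
    ext s
    simp only [Finset.mem_filter, Finset.mem_Icc]
    omega
  rw [h2, Int.card_Icc]
  rw [Finset.mem_Icc] at hd
  have h3 : ((min N (N - d) + 1 - max 1 (1 - d)).toNat : ℤ) = N - |d| := by
    rcases abs_cases d with h | h <;> omega
  have h4 : |(d : ℝ)| ≤ N := by
    rw [abs_le]
    exact ⟨by exact_mod_cast hd.1, by exact_mod_cast hd.2⟩
  have h5 : tri (d / N) = 1 - |(d : ℝ)| / N := by
    rw [tri, abs_div, abs_of_pos hN']
    refine max_eq_right ?_
    rw [sub_nonneg, div_le_one hN']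
    exact h4
  have h6 : (((min N (N - d) + 1 - max 1 (1 - d)).toNat : ℕ) : ℝ) = N - |(d : ℝ)| := by
    rw [← Int.cast_natCast, h3]
    push_cast
    rfl
  rw [h6, h5]
  field_simp

/-- The double sum of `R` over the differences of the points of a box. -/
def boxSum (R : ℤ × ℤ → ℝ) (N M : ℤ) : ℝ :=
  ∑ z ∈ Finset.Icc 1 N ×ˢ Finset.Icc 1 M, ∑ z' ∈ Finset.Icc 1 N ×ˢ Finset.Icc 1 M, R (z' - z)

lemma boxSum_swap (R : ℤ × ℤ → ℝ) (N M : ℤ) :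
    boxSum R N M = boxSum (fun z => R z.swap) M N := by
  unfold boxSum
  simp only [Finset.sum_product]
  rw [Finset.sum_comm]
  refine Finset.sum_congr rfl fun s _ => Finset.sum_congr rfl fun t _ => ?_
  rw [Finset.sum_comm]
  rfl

/-- The weights of the differences in a box. -/
lemma summable_tri_mul {N M : ℤ} (hN : 0 < N) (hM : 0 < M) (R : ℤ × ℤ → ℝ) :
    Summable fun d : ℤ × ℤ => tri (d.1 / N) * tri (d.2 / M) * R d := by
  refine summable_of_ne_finset_zero (s := Finset.Icc (-N) N ×ˢ Finset.Icc (-M) M) fun d hd => ?_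
  rw [Finset.mem_product, not_and_or] at hd
  rcases hd with h | h
  · rw [tri_int_eq_zero hN h]; ring
  · rw [tri_int_eq_zero hM h]; ring

lemma boxSum_eq_tsum {N M : ℤ} (hN : 0 < N) (hM : 0 < M) (R : ℤ × ℤ → ℝ) :
    boxSum R N M = N * M * ∑' d : ℤ × ℤ, tri (d.1 / N) * tri (d.2 / M) * R d := by
  rw [tsum_eq_sum (s := Finset.Icc (-N) N ×ˢ Finset.Icc (-M) M), boxSum]
  swap
  · intro d hd
    rw [Finset.mem_product, not_and_or] at hd
    rcases hd with h | h
    · rw [tri_int_eq_zero hN h]; ring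
    · rw [tri_int_eq_zero hM h]; ring
  simp only [Finset.sum_product]
  have h1 : ∀ t ∈ Finset.Icc 1 N, ∑ s ∈ Finset.Icc 1 M, ∑ t' ∈ Finset.Icc 1 N,
      ∑ s' ∈ Finset.Icc 1 M, R ((t', s') - (t, s)) =
      ∑ t' ∈ Finset.Icc 1 N, M * ∑ d ∈ Finset.Icc (-M) M, tri (d / M) * R (t' - t, d) := by
    intro t _
    rw [Finset.sum_comm]
    refine Finset.sum_congr rfl fun t' _ => ?_
    exact sum_Icc_sub_eq hM fun d => R (t' - t, d)
  rw [Finset.sum_congr rfl h1,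
    sum_Icc_sub_eq hN fun e => M * ∑ d ∈ Finset.Icc (-M) M, tri (d / M) * R (e, d), mul_assoc,
    Finset.mul_sum (a := (M : ℝ))]
  congr 1
  refine Finset.sum_congr rfl fun d _ => ?_
  rw [mul_left_comm, Finset.mul_sum]
  congr 1
  refine Finset.sum_congr rfl fun e _ => ?_
  ring

lemma boxSum_eq_integral {N M : ℤ} (hN : 0 < N) (hM : 0 < M) {A B : ℝ} (hA : 0 < A) (hB : 0 < B)
    (R : ℤ × ℤ → ℝ) : boxSum R N M = N * M * (A * B * ∫ x : ℝ × ℝ,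
      tri (⌊A * x.1⌋ / N) * tri (⌊B * x.2⌋ / M) * R (floorMap A B x)) := by
  rw [boxSum_eq_tsum hN hM, tsum_eq_integral_floor hA hB (summable_tri_mul hN hM R)]
  rfl

/-- Common engine of the three regimes, which differ only in the mesh A, B and the scale Λ. -/
lemma tendsto_boxSum {ι : Type*} {l : Filter ι} [l.IsCountablyGenerated] {N M : ι → ℤ}
    {A B Λ : ι → ℝ} (hN : ∀ᶠ i in l, 0 < N i) (hM : ∀ᶠ i in l, 0 < M i)
    (hA : ∀ᶠ i in l, 0 < A i) (hB : ∀ᶠ i in l, 0 < B i) {R : ℤ × ℤ → ℝ} {D Ψ : ℝ × ℝ → ℝ}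
    (hD : Integrable D)
    (hbound : ∀ᶠ i in l, ∀ᵐ x : ℝ × ℝ, |tri (⌊A i * x.1⌋ / N i) * tri (⌊B i * x.2⌋ / M i) *
      (Λ i * R (floorMap (A i) (B i) x))| ≤ D x)
    (hlim : ∀ᵐ x : ℝ × ℝ, Tendsto (fun i => tri (⌊A i * x.1⌋ / N i) * tri (⌊B i * x.2⌋ / M i) *
      (Λ i * R (floorMap (A i) (B i) x))) l (𝓝 (Ψ x))) :
    Tendsto (fun i => boxSum R (N i) (M i) * Λ i / (N i * M i * (A i * B i))) l
      (𝓝 (∫ x, Ψ x)) := by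
  set f : ι → ℝ × ℝ → ℝ := fun i x => tri (⌊A i * x.1⌋ / N i) * tri (⌊B i * x.2⌋ / M i) *
      (Λ i * R (floorMap (A i) (B i) x)) with hf
  have hmeas : ∀ i, AEStronglyMeasurable (f i) := by
    intro i
    have h1 : Measurable fun d : ℤ × ℤ => tri (d.1 / N i) * tri (d.2 / M i) * (Λ i * R d) :=
      measurable_of_countable _
    exact (h1.comp (measurable_floorMap (A i) (B i))).aestronglyMeasurable
  have h0 : Tendsto (fun i => ∫ x, f i x) l (𝓝 (∫ x, Ψ x)) :=
    tendsto_integral_filter_of_dominated_convergence D (Eventually.of_forall hmeas)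
      hbound hD hlim
  refine h0.congr' ?_
  filter_upwards [hN, hM, hA, hB] with i h1 h2 h3 h4
  have h1' : (0 : ℝ) < N i := by exact_mod_cast h1
  have h2' : (0 : ℝ) < M i := by exact_mod_cast h2
  have h5 : ∫ x, f i x = Λ i * ∫ x : ℝ × ℝ,
      tri (⌊A i * x.1⌋ / N i) * tri (⌊B i * x.2⌋ / M i) * R (floorMap (A i) (B i) x) := by
    rw [← integral_const_mul]
    congr 1
    funext x
    simp only [hf]
    ring
  rw [h5, boxSum_eq_integral h1 h2 h3 h4]
  generalize ∫ x : ℝ × ℝ, tri (⌊A i * x.1⌋ / N i) * tri (⌊B i * x.2⌋ / M i) *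
    R (floorMap (A i) (B i) x) = J
  field_simp

/-- With c = 1 the mesh matches the side of the box; with c = 0 the side is far longer and the
weight tends to tri 0 = 1. -/
lemma tendsto_tri_floor {ι : Type*} {l : Filter ι} {A : ι → ℝ} {N : ι → ℤ} (hA : Tendsto A l atTop)
    {c : ℝ} (hc : Tendsto (fun i => A i / N i) l (𝓝 c)) (x : ℝ) :
    Tendsto (fun i => tri (⌊A i * x⌋ / N i)) l (𝓝 (tri (x * c))) := by
  refine (continuous_tri.tendsto _).comp ?_
  refine ((tendsto_floor_div hA (tendsto_const_nhds (x := x))).mul hc).congr' ?_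
  filter_upwards [hA.eventually_gt_atTop 0] with i hi
  field_simp

/-- The interval [-2,2] instead of [-1,1] leaves room for the rounding. -/
lemma tri_floor_le {A : ℝ} {N : ℤ} (hA : 1 ≤ A) (hN : 0 < N) (hNA : (N : ℝ) ≤ A) (x : ℝ) :
    tri (⌊A * x⌋ / N) ≤ (Icc (-2 : ℝ) 2).indicator 1 x := by
  have hN' : (0 : ℝ) < N := by exact_mod_cast hN
  by_cases hx : x ∈ Icc (-2 : ℝ) 2
  · rw [indicator_of_mem hx]; exact tri_le_one _
  · rw [indicator_of_notMem hx, tri_eq_zero]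
    rw [abs_div, abs_of_pos hN', one_le_div hN']
    by_contra! h
    have h1 := Int.floor_le (A * x)
    have h2 := Int.lt_floor_add_one (A * x)
    have h3 := abs_lt.1 h
    refine hx ⟨?_, ?_⟩ <;> by_contra! h4 <;> nlinarith

lemma tendsto_floor_div_self {A : ℝ → ℝ} (hA : Tendsto A atTop atTop) :
    Tendsto (fun l => (⌊A l⌋ : ℝ) / A l) atTop (𝓝 1) := by
  simpa using tendsto_floor_div hA (tendsto_const_nhds (x := (1 : ℝ)))

/-! ### Asymptotics of the double sums -/

lemma integral_pos_of_eventually_pos {Ψ : ℝ × ℝ → ℝ} (h0 : ∀ x, 0 ≤ Ψ x) (hi : Integrable Ψ)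
    {x : ℝ × ℝ} (hx : ∀ᶠ y in 𝓝 x, 0 < Ψ y) : 0 < ∫ y, Ψ y := by
  rw [integral_pos_iff_support_of_nonneg h0 hi]
  exact Measure.measure_pos_of_mem_nhds volume (hx.mono fun y hy => hy.ne')

lemma abs_tri_mul_le_box {A B : ℝ} {N M : ℤ} (hA : 1 ≤ A) (hN : 0 < N) (hNA : (N : ℝ) ≤ A)
    (hB : 1 ≤ B) (hM : 0 < M) (hMB : (M : ℝ) ≤ B) {v : ℝ} {b : ℝ × ℝ → ℝ} {x : ℝ × ℝ}
    (hv : |v| ≤ b x) : |tri (⌊A * x.1⌋ / N) * tri (⌊B * x.2⌋ / M) * v| ≤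
      (Icc (-2 : ℝ) 2 ×ˢ Icc (-2 : ℝ) 2).indicator b x := by
  have h1 := tri_floor_le hA hN hNA x.1
  have h2 := tri_floor_le hB hM hMB x.2
  have h3 := tri_nonneg (⌊A * x.1⌋ / N)
  have h4 := tri_nonneg (⌊B * x.2⌋ / M)
  rw [abs_mul, abs_of_nonneg (mul_nonneg h3 h4)]
  by_cases hx : x ∈ Icc (-2 : ℝ) 2 ×ˢ Icc (-2 : ℝ) 2
  · rw [indicator_of_mem hx]
    have := mul_le_one₀ (tri_le_one (⌊A * x.1⌋ / N)) h4 (tri_le_one (⌊B * x.2⌋ / M))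
    exact (mul_le_of_le_one_left (abs_nonneg v) this).trans hv
  · rw [indicator_of_notMem hx]
    rw [Set.mem_prod, not_and_or] at hx
    rcases hx with h | h
    · rw [indicator_of_notMem h] at h1
      rw [le_antisymm h1 h3]; simp
    · rw [indicator_of_notMem h] at h2
      rw [le_antisymm h2 h4]; simp

lemma abs_tri_mul_le_strip {A B : ℝ} {N M : ℤ} (hA : 1 ≤ A) (hN : 0 < N) (hNA : (N : ℝ) ≤ A)
    {v : ℝ} {b : ℝ × ℝ → ℝ} {x : ℝ × ℝ}
    (hv : |v| ≤ b x) : |tri (⌊A * x.1⌋ / N) * tri (⌊B * x.2⌋ / M) * v| ≤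
      (Icc (-2 : ℝ) 2 ×ˢ univ).indicator b x := by
  have h1 := tri_floor_le hA hN hNA x.1
  have h3 := tri_nonneg (⌊A * x.1⌋ / N)
  have h4 := tri_nonneg (⌊B * x.2⌋ / M)
  rw [abs_mul, abs_of_nonneg (mul_nonneg h3 h4)]
  by_cases hx : x ∈ Icc (-2 : ℝ) 2 ×ˢ (univ : Set ℝ)
  · rw [indicator_of_mem hx]
    have := mul_le_one₀ (tri_le_one (⌊A * x.1⌋ / N)) h4 (tri_le_one (⌊B * x.2⌋ / M))
    exact (mul_le_of_le_one_left (abs_nonneg v) this).trans hv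
  · rw [indicator_of_notMem hx]
    have h : x.1 ∉ Icc (-2 : ℝ) 2 := fun h => hx ⟨h, mem_univ _⟩
    rw [indicator_of_notMem h] at h1
    rw [le_antisymm h1 h3]; simp

lemma eventually_floor_pos {A : ℝ → ℝ} (hA : Tendsto A atTop atTop) : ∀ᶠ l in atTop, 0 < ⌊A l⌋ :=
  (tendsto_floor_atTop.comp hA).eventually_gt_atTop 0

lemma tendsto_div_floor_self {A : ℝ → ℝ} (hA : Tendsto A atTop atTop) :
    Tendsto (fun l => A l / (⌊A l⌋ : ℝ)) atTop (𝓝 1) := by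
  have := (tendsto_floor_div_self hA).inv₀ one_ne_zero
  simpa using this

/-- Passage from the normalization of the integral approximation to a power of the side. -/
lemma tendsto_boxSum_div {R : ℤ × ℤ → ℝ} {γ I : ℝ} (hγ : 0 < γ) {A B Λ E : ℝ → ℝ}
    (hA : Tendsto A atTop atTop) (hB : Tendsto B atTop atTop) (hΛ : Tendsto Λ atTop atTop)
    (h : Tendsto (fun l : ℝ => boxSum R ⌊l⌋ ⌊l ^ γ⌋ * Λ l / (⌊l⌋ * ⌊l ^ γ⌋ * (A l * B l))) atTop
      (𝓝 I))
    (hE : ∀ᶠ l : ℝ in atTop, E l * Λ l = l * l ^ γ * (A l * B l)) :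
    Tendsto (fun l : ℝ => boxSum R ⌊l⌋ ⌊l ^ γ⌋ / E l) atTop (𝓝 I) := by
  have hγt := tendsto_rpow_atTop hγ
  have h1 := (h.mul (tendsto_floor_div_self tendsto_id)).mul (tendsto_floor_div_self hγt)
  rw [mul_one, mul_one] at h1
  refine h1.congr' ?_
  filter_upwards [hE, eventually_floor_pos tendsto_id, eventually_floor_pos hγt,
    hA.eventually_gt_atTop 0, hB.eventually_gt_atTop 0, hΛ.eventually_gt_atTop 0,
    eventually_gt_atTop 0] with l hl hN hM hA0 hB0 hΛ0 hl0
  have hN' : (0 : ℝ) < ⌊l⌋ := by exact_mod_cast hN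
  have hM' : (0 : ℝ) < ⌊l ^ γ⌋ := by exact_mod_cast hM
  have hlγ := Real.rpow_pos_of_pos hl0 γ
  have hE' : E l = l * l ^ γ * (A l * B l) / Λ l := by rw [← hl]; field_simp
  rw [hE']
  simp only [id]
  field_simp

namespace HomogLimit

variable {α β : ℝ} {R : ℤ × ℤ → ℝ} {G : ℝ × ℝ → ℝ}

lemma tendsto_floorMap (h : HomogLimit α β R G) {x : ℝ × ℝ} (hx : x ≠ 0) :
    Tendsto (fun Λ : ℝ => Λ * R (floorMap (Λ ^ (1 / α)) (Λ ^ (1 / β)) x)) atTop (𝓝 (G x)) := by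
  have h3 : ∀ {q : ℝ}, 0 < q → Tendsto (fun Λ : ℝ => Λ ^ (1 / q)) atTop atTop := fun hq =>
    tendsto_rpow_atTop (by positivity)
  exact h.tendsto tendsto_id hx
    ((tendsto_floor_div (h3 h.α_pos) tendsto_const_nhds).prodMk_nhds
      (tendsto_floor_div (h3 h.β_pos) tendsto_const_nhds))

lemma exists_floorMap_le (h : HomogLimit α β R G) : ∃ C : ℝ, 0 ≤ C ∧ ∀ Λ : ℝ, 0 < Λ →
    ∀ x, x ≠ 0 → |Λ * R (floorMap (Λ ^ (1 / α)) (Λ ^ (1 / β)) x)| ≤ C * (eta α β x)⁻¹ := by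
  obtain ⟨C, hC0, hC⟩ := h.exists_le
  refine ⟨C * (2 ^ α + 2 ^ β), by positivity, fun Λ hΛ x hx => ?_⟩
  have h1 := hC (floorMap (Λ ^ (1 / α)) (Λ ^ (1 / β)) x)
  have h2 := mul_eta_le_floorMap h.α_pos h.β_pos hΛ x
  have h3 := eta_pos (α := α) (β := β) hx
  rw [abs_mul, abs_of_pos hΛ]
  set E := eta α β (((floorMap (Λ ^ (1 / α)) (Λ ^ (1 / β)) x).1 : ℝ),
        ((floorMap (Λ ^ (1 / α)) (Λ ^ (1 / β)) x).2 : ℝ)) with hE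
  have hE0 : 0 ≤ E := eta_nonneg _
  calc _ ≤ Λ * (C * (1 + E)⁻¹) := mul_le_mul_of_nonneg_left h1 hΛ.le
    _ = C * (Λ / (1 + E)) := by ring
    _ ≤ C * ((2 ^ α + 2 ^ β) / eta α β x) := by
        refine mul_le_mul_of_nonneg_left ?_ hC0
        rw [div_le_div_iff₀ (by positivity) h3]
        exact h2
    _ = _ := by ring

lemma exists_limit_le (h : HomogLimit α β R G) :
    ∃ C : ℝ, 0 ≤ C ∧ ∀ x, x ≠ 0 → G x ≤ C * (eta α β x)⁻¹ := by
  obtain ⟨C, hC0, hC⟩ := h.exists_floorMap_le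
  refine ⟨C, hC0, fun x hx => le_of_tendsto (h.tendsto_floorMap hx) ?_⟩
  filter_upwards [eventually_gt_atTop 0] with Λ hΛ
  exact (le_abs_self _).trans (hC Λ hΛ x hx)

/-! #### Integrability and positivity of the limits -/

lemma integrable_box (h : HomogLimit α β R G) :
    Integrable fun x : ℝ × ℝ => tri x.1 * tri x.2 * G x := by
  obtain ⟨C, hC0, hC⟩ := h.exists_limit_le
  have hS : MeasurableSet (Icc (-2 : ℝ) 2 ×ˢ Icc (-2 : ℝ) 2) :=
    measurableSet_Icc.prod measurableSet_Icc
  refine ((integrable_indicator_iff hS).2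
    ((integrableOn_inv_eta h.α_pos h.β_pos h.one_lt 2).const_mul C)).mono'
    (((continuous_tri.measurable.comp measurable_fst).mul
      (continuous_tri.measurable.comp measurable_snd)).mul h.meas).aestronglyMeasurable ?_
  filter_upwards [ae_ne_zero] with x hx
  have h1 := tri_nonneg x.1
  have h2 := tri_nonneg x.2
  have h3 := tri_le_indicator x.1
  have h4 := tri_le_indicator x.2
  rw [Real.norm_of_nonneg (mul_nonneg (mul_nonneg h1 h2) (h.nonneg x))]
  by_cases hxS : x ∈ Icc (-2 : ℝ) 2 ×ˢ Icc (-2 : ℝ) 2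
  · rw [indicator_of_mem hxS]
    exact (mul_le_of_le_one_left (h.nonneg x)
      (mul_le_one₀ (tri_le_one _) h2 (tri_le_one _))).trans (hC x hx)
  · rw [indicator_of_notMem hxS]
    rw [Set.mem_prod, not_and_or] at hxS
    rcases hxS with h5 | h5
    · rw [indicator_of_notMem h5] at h3
      rw [le_antisymm h3 h1]; simp
    · rw [indicator_of_notMem h5] at h4
      rw [le_antisymm h4 h2]; simp

lemma integrable_strip (h : HomogLimit α β R G) (hβ : 1 < β) :
    Integrable fun x : ℝ × ℝ => tri x.1 * G x := by
  obtain ⟨C, hC0, hC⟩ := h.exists_limit_le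
  have hS : MeasurableSet (Icc (-2 : ℝ) 2 ×ˢ (univ : Set ℝ)) :=
    measurableSet_Icc.prod MeasurableSet.univ
  refine ((integrable_indicator_iff hS).2
    ((integrableOn_inv_eta_strip h.α_pos hβ h.one_lt 2).const_mul C)).mono'
    ((continuous_tri.measurable.comp measurable_fst).mul h.meas).aestronglyMeasurable ?_
  filter_upwards [ae_ne_zero] with x hx
  have h1 := tri_nonneg x.1
  have h3 := tri_le_indicator x.1
  rw [Real.norm_of_nonneg (mul_nonneg h1 (h.nonneg x))]
  by_cases hxS : x ∈ Icc (-2 : ℝ) 2 ×ˢ (univ : Set ℝ)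
  · rw [indicator_of_mem hxS]
    exact (mul_le_of_le_one_left (h.nonneg x) (tri_le_one _)).trans (hC x hx)
  · rw [indicator_of_notMem hxS]
    have h5 : x.1 ∉ Icc (-2 : ℝ) 2 := fun h => hxS ⟨h, mem_univ _⟩
    rw [indicator_of_notMem h5] at h3
    rw [le_antisymm h3 h1]; simp

/-- On the axis the gauge bound reads |y|^(-β), integrable at 0 because β < 1. -/
lemma integrable_axis (h : HomogLimit α β R G) (hβ : β < 1) :
    Integrable fun y : ℝ => tri y * G (0, y) := by
  obtain ⟨C, hC0, hC⟩ := h.exists_limit_le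
  refine ((integrable_indicator_iff measurableSet_Icc).2
    ((integrableOn_abs_rpow (by linarith : -1 < -β) 2).const_mul C)).mono'
    (continuous_tri.measurable.mul (h.meas.comp measurable_prodMk_left)).aestronglyMeasurable ?_
  have h0 : ∀ᵐ x : ℝ, x ≠ 0 := by rw [ae_iff]; simp
  filter_upwards [h0] with y hy
  have hy' : ((0 : ℝ), y) ≠ 0 := fun h => hy (congrArg Prod.snd h)
  have h1 := tri_nonneg y
  have h3 := tri_le_indicator y
  rw [Real.norm_of_nonneg (mul_nonneg h1 (h.nonneg _))]
  by_cases hyS : y ∈ Icc (-2 : ℝ) 2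
  · rw [indicator_of_mem hyS]
    refine (mul_le_of_le_one_left (h.nonneg _) (tri_le_one _)).trans ((hC _ hy').trans_eq ?_)
    rw [Real.rpow_neg (abs_nonneg _), eta]
    simp [Real.zero_rpow h.α_pos.ne']
  · rw [indicator_of_notMem hyS]
    rw [indicator_of_notMem hyS] at h3
    rw [le_antisymm h3 h1]; simp

lemma integral_tri : ∫ x, tri x = 1 := by
  have h1 : ∫ x, tri x = ∫ x in Icc (-1 : ℝ) 1, tri x := by
    rw [← integral_indicator measurableSet_Icc]
    congr 1
    funext x
    by_cases hx : x ∈ Icc (-1 : ℝ) 1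
    · rw [indicator_of_mem hx]
    · rw [indicator_of_notMem hx, tri_eq_zero]
      by_contra! h
      have := abs_lt.1 h
      exact hx ⟨this.1.le, this.2.le⟩
  have h2 : IntervalIntegrable tri volume (-1) 0 := continuous_tri.intervalIntegrable _ _
  have h3 : IntervalIntegrable tri volume 0 1 := continuous_tri.intervalIntegrable _ _
  rw [h1, integral_Icc_eq_integral_Ioc, ← intervalIntegral.integral_of_le (by norm_num),
    ← intervalIntegral.integral_add_adjacent_intervals h2 h3]
  have h4 : ∫ x in (-1 : ℝ)..0, tri x = ∫ x in (-1 : ℝ)..0, (1 + x) := by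
    refine intervalIntegral.integral_congr fun x hx => ?_
    rw [uIcc_of_le (by norm_num)] at hx
    rw [tri, abs_of_nonpos hx.2, sub_neg_eq_add, max_eq_right (by linarith [hx.1])]
  have h5 : ∫ x in (0 : ℝ)..1, tri x = ∫ x in (0 : ℝ)..1, (1 - x) := by
    refine intervalIntegral.integral_congr fun x hx => ?_
    rw [uIcc_of_le (by norm_num)] at hx
    rw [tri, abs_of_nonneg hx.1, max_eq_right (by linarith [hx.2])]
  rw [h4, h5, intervalIntegral.integral_add (by simp) (by simp),
    intervalIntegral.integral_sub (by simp) (by simp)]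
  norm_num [integral_id]

/-- The axis regime can thus be treated as a planar limit that does not depend on the first variable
except through its weight. -/
lemma integral_tri_mul_axis (G : ℝ × ℝ → ℝ) :
    ∫ x : ℝ × ℝ, tri x.1 * tri x.2 * G (0, x.2) = ∫ y, tri y * G (0, y) := by
  simp_rw [mul_assoc]
  rw [Measure.volume_eq_prod, integral_prod_mul tri fun y => tri y * G (0, y), integral_tri,
    one_mul]

lemma integral_box_pos (h : HomogLimit α β R G) :
    0 < ∫ x : ℝ × ℝ, tri x.1 * tri x.2 * G x := by
  refine integral_pos_of_eventually_pos (x := (1 / 2, 1 / 2)) (fun x => mul_nonneg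
    (mul_nonneg (tri_nonneg _) (tri_nonneg _)) (h.nonneg x)) h.integrable_box ?_
  have h1 : ∀ᶠ y : ℝ × ℝ in 𝓝 (1 / 2, 1 / 2), |y.1| < 1 :=
    continuous_fst.abs.continuousAt.eventually_lt_const (by norm_num [abs_lt])
  have h2 : ∀ᶠ y : ℝ × ℝ in 𝓝 (1 / 2, 1 / 2), |y.2| < 1 :=
    continuous_snd.abs.continuousAt.eventually_lt_const (by norm_num [abs_lt])
  have h3 : ∀ᶠ y : ℝ × ℝ in 𝓝 (1 / 2, 1 / 2), y ≠ 0 :=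
    isOpen_ne.mem_nhds (by simp [Prod.ext_iff])
  filter_upwards [h1, h2, h3] with y hy1 hy2 hy3
  exact mul_pos (mul_pos (tri_pos hy1) (tri_pos hy2)) (h.pos y hy3)

lemma integral_strip_pos (h : HomogLimit α β R G) (hβ : 1 < β) :
    0 < ∫ x : ℝ × ℝ, tri x.1 * G x := by
  refine integral_pos_of_eventually_pos (x := (1 / 2, 1 / 2)) (fun x => mul_nonneg
    (tri_nonneg _) (h.nonneg x)) (h.integrable_strip hβ) ?_
  have h1 : ∀ᶠ y : ℝ × ℝ in 𝓝 (1 / 2, 1 / 2), |y.1| < 1 :=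
    continuous_fst.abs.continuousAt.eventually_lt_const (by norm_num [abs_lt])
  have h3 : ∀ᶠ y : ℝ × ℝ in 𝓝 (1 / 2, 1 / 2), y ≠ 0 :=
    isOpen_ne.mem_nhds (by simp [Prod.ext_iff])
  filter_upwards [h1, h3] with y hy1 hy3
  exact mul_pos (tri_pos hy1) (h.pos y hy3)

lemma integral_axis_pos (h : HomogLimit α β R G) (hβ : β < 1) :
    0 < ∫ y : ℝ, tri y * G (0, y) := by
  rw [integral_pos_iff_support_of_nonneg (fun y => mul_nonneg (tri_nonneg _) (h.nonneg _))
    (h.integrable_axis hβ)]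
  refine Measure.measure_pos_of_mem_nhds volume (x := (1 / 2 : ℝ)) ?_
  filter_upwards [Ioo_mem_nhds (by norm_num : (0 : ℝ) < 1 / 2) (by norm_num : (1 / 2 : ℝ) < 1)]
    with y hy
  exact (mul_pos (tri_pos (by rw [abs_of_pos hy.1]; exact hy.2))
    (h.pos _ fun h => hy.1.ne' (congrArg Prod.snd h))).ne'

/-! #### The three regimes -/

lemma tendsto_floorMap_rpow (h : HomogLimit α β R G) {x : ℝ × ℝ} (hx : x ≠ 0) :
    Tendsto (fun l : ℝ => l ^ α * R (floorMap l (l ^ (α / β)) x)) atTop (𝓝 (G x)) := by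
  refine ((h.tendsto_floorMap hx).comp (tendsto_rpow_atTop h.α_pos)).congr' ?_
  filter_upwards [eventually_ge_atTop 0] with l hl
  simp only [Function.comp]
  rw [← Real.rpow_mul hl, ← Real.rpow_mul hl, mul_one_div_cancel h.α_pos.ne', Real.rpow_one,
    mul_one_div]

lemma exists_floorMap_rpow_le (h : HomogLimit α β R G) : ∃ C : ℝ, 0 ≤ C ∧ ∀ l : ℝ, 0 < l →
    ∀ x, x ≠ 0 → |l ^ α * R (floorMap l (l ^ (α / β)) x)| ≤ C * (eta α β x)⁻¹ := by
  obtain ⟨C, hC0, hC⟩ := h.exists_floorMap_le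
  refine ⟨C, hC0, fun l hl x hx => ?_⟩
  have := hC (l ^ α) (Real.rpow_pos_of_pos hl α) x hx
  rwa [← Real.rpow_mul hl.le, ← Real.rpow_mul hl.le, mul_one_div_cancel h.α_pos.ne',
    Real.rpow_one, mul_one_div] at this

/-- The balanced regime. -/
lemma tendsto_boxSum_balanced (h : HomogLimit α β R G) :
    Tendsto (fun l : ℝ => boxSum R ⌊l⌋ ⌊l ^ (α / β)⌋ / l ^ (2 + 2 * (α / β) - α)) atTop
      (𝓝 (∫ x : ℝ × ℝ, tri x.1 * tri x.2 * G x)) := by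
  obtain ⟨C, hC0, hC⟩ := h.exists_floorMap_rpow_le
  have hγ : 0 < α / β := div_pos h.α_pos h.β_pos
  have hB := tendsto_rpow_atTop hγ
  have hS : MeasurableSet (Icc (-2 : ℝ) 2 ×ˢ Icc (-2 : ℝ) 2) :=
    measurableSet_Icc.prod measurableSet_Icc
  refine tendsto_boxSum_div hγ tendsto_id hB (tendsto_rpow_atTop h.α_pos)
    (tendsto_boxSum (eventually_floor_pos tendsto_id) (eventually_floor_pos hB)
      (eventually_gt_atTop 0) (hB.eventually_gt_atTop 0) ((integrable_indicator_iff hS).2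
      ((integrableOn_inv_eta h.α_pos h.β_pos h.one_lt 2).const_mul C)) ?_ ?_) ?_
  · filter_upwards [eventually_floor_pos tendsto_id, eventually_floor_pos hB,
      eventually_ge_atTop 1, hB.eventually_ge_atTop 1] with l hN hM hl hBl
    filter_upwards [ae_ne_zero] with x hx
    exact abs_tri_mul_le_box (b := fun x => C * (eta α β x)⁻¹) hl hN (Int.floor_le _) hBl hM
      (Int.floor_le _) (hC l (by linarith) x hx)
  · filter_upwards [ae_ne_zero] with x hx
    have h1 := tendsto_tri_floor tendsto_id (tendsto_div_floor_self tendsto_id) x.1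
    have h2 := tendsto_tri_floor hB (tendsto_div_floor_self hB) x.2
    rw [mul_one] at h1 h2
    exact (h1.mul h2).mul (h.tendsto_floorMap_rpow hx)
  · filter_upwards [eventually_gt_atTop 0] with l hl
    rw [id, ← Real.rpow_add hl, ← Real.rpow_one_add' hl.le (by positivity), ← Real.rpow_add hl]
    congr 1
    ring

/-- The unbalanced regime, summable along the long side. -/
lemma tendsto_boxSum_strip (h : HomogLimit α β R G) (hβ : 1 < β) {γ : ℝ} (hγ : α / β < γ) :
    Tendsto (fun l : ℝ => boxSum R ⌊l⌋ ⌊l ^ γ⌋ / l ^ (2 + γ + α / β - α)) atTop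
      (𝓝 (∫ x : ℝ × ℝ, tri x.1 * G x)) := by
  obtain ⟨C, hC0, hC⟩ := h.exists_floorMap_rpow_le
  have hγ₀ : 0 < α / β := div_pos h.α_pos h.β_pos
  have hγ0 : 0 < γ := hγ₀.trans hγ
  have hB := tendsto_rpow_atTop hγ₀
  have hM := tendsto_rpow_atTop hγ0
  have hS : MeasurableSet (Icc (-2 : ℝ) 2 ×ˢ (univ : Set ℝ)) :=
    measurableSet_Icc.prod MeasurableSet.univ
  -- The mesh l^(α/β) is much smaller than the height l^γ, so the vertical weight disappears in the
  -- limit.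
  have hBM : Tendsto (fun l : ℝ => l ^ (α / β) / (⌊l ^ γ⌋ : ℝ)) atTop (𝓝 0) := by
    have h1 := (tendsto_rpow_neg_atTop (sub_pos.2 hγ)).mul (tendsto_div_floor_self hM)
    rw [zero_mul] at h1
    refine h1.congr' ?_
    filter_upwards [eventually_gt_atTop 0] with l hl
    rw [← mul_div_assoc, ← Real.rpow_add hl]
    congr 2
    ring
  refine tendsto_boxSum_div hγ0 tendsto_id hB (tendsto_rpow_atTop h.α_pos)
    (tendsto_boxSum (eventually_floor_pos tendsto_id) (eventually_floor_pos hM)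
      (eventually_gt_atTop 0) (hB.eventually_gt_atTop 0) ((integrable_indicator_iff hS).2
      ((integrableOn_inv_eta_strip h.α_pos hβ h.one_lt 2).const_mul C)) ?_ ?_) ?_
  · filter_upwards [eventually_floor_pos tendsto_id, eventually_ge_atTop 1] with l hN hl
    filter_upwards [ae_ne_zero] with x hx
    exact abs_tri_mul_le_strip (b := fun x => C * (eta α β x)⁻¹) hl hN (Int.floor_le _)
      (hC l (by linarith) x hx)
  · filter_upwards [ae_ne_zero] with x hx
    have h1 := tendsto_tri_floor tendsto_id (tendsto_div_floor_self tendsto_id) x.1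
    have h2 := tendsto_tri_floor hB hBM x.2
    rw [mul_one] at h1
    rw [mul_zero, tri_zero] at h2
    have h3 := (h1.mul h2).mul (h.tendsto_floorMap_rpow hx)
    rwa [mul_one] at h3
  · filter_upwards [eventually_gt_atTop 0] with l hl
    rw [id, ← Real.rpow_add hl, ← Real.rpow_one_add' hl.le (by positivity),
      ← Real.rpow_one_add' hl.le (by positivity), ← Real.rpow_add hl]
    congr 1
    ring

/-- The unbalanced regime, dominated by the values on the long axis. -/
lemma tendsto_boxSum_axis (h : HomogLimit α β R G) (hβ : β < 1) {γ : ℝ} (hγ : α / β < γ) :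
    Tendsto (fun l : ℝ => boxSum R ⌊l⌋ ⌊l ^ γ⌋ / l ^ (2 + 2 * γ - γ * β)) atTop
      (𝓝 (∫ y : ℝ, tri y * G (0, y))) := by
  obtain ⟨C, hC0, hC⟩ := h.exists_le
  have hα0 := h.α_pos
  have hβ0 := h.β_pos
  have hγ0 : 0 < γ := (div_pos h.α_pos h.β_pos).trans hγ
  have hM := tendsto_rpow_atTop hγ0
  have hΛ := tendsto_rpow_atTop (mul_pos hγ0 hβ0)
  have hγα : α < γ * β := by rwa [div_lt_iff₀ hβ0] at hγ
  have hS : MeasurableSet (Icc (-2 : ℝ) 2 ×ˢ Icc (-2 : ℝ) 2) :=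
    measurableSet_Icc.prod measurableSet_Icc
  -- The horizontal term of the gauge is discarded: the vertical one alone is integrable at 0, since
  -- β < 1.
  have hD : IntegrableOn (fun x : ℝ × ℝ => C * 2 ^ β * |x.2| ^ (-β))
      (Icc (-2 : ℝ) 2 ×ˢ Icc (-2 : ℝ) 2) := by
    refine Integrable.const_mul ?_ _
    have h1 : IntegrableOn (fun _ : ℝ => (1 : ℝ)) (Icc (-2 : ℝ) 2) := integrableOn_const (by simp)
    have h2 := Integrable.mul_prod h1 (integrableOn_abs_rpow (by linarith : -1 < -β) 2)
    rw [Measure.prod_restrict, ← Measure.volume_eq_prod] at h2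
    simpa using h2
  rw [← integral_tri_mul_axis]
  refine tendsto_boxSum_div hγ0 tendsto_id hM hΛ
    (tendsto_boxSum (eventually_floor_pos tendsto_id) (eventually_floor_pos hM)
      (eventually_gt_atTop 0) (hM.eventually_gt_atTop 0) ((integrable_indicator_iff hS).2 hD)
      ?_ ?_) ?_
  · filter_upwards [eventually_floor_pos tendsto_id, eventually_floor_pos hM,
      eventually_ge_atTop 1, hM.eventually_ge_atTop 1, hΛ.eventually_gt_atTop 0]
      with l hN hM' hl hMl hΛl
    filter_upwards [ae_coord_ne_zero] with x hx
    refine abs_tri_mul_le_box (b := fun x => C * 2 ^ β * |x.2| ^ (-β)) hl hN (Int.floor_le _) hMl hM'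
      (Int.floor_le _) ?_
    have h1 := hC (floorMap l (l ^ γ) x)
    have h2 := abs_rpow_le_floor hβ0 (l ^ γ * x.2)
    rw [abs_mul, abs_of_pos (by linarith), Real.mul_rpow (by linarith) (abs_nonneg _),
      ← Real.rpow_mul (by linarith)] at h2
    have h3 : 0 < |x.2| ^ β := Real.rpow_pos_of_pos (abs_pos.2 hx.2) β
    have h4 : |(⌊l ^ γ * x.2⌋ : ℝ)| ^ β ≤ eta α β (((floorMap l (l ^ γ) x).1 : ℝ),
        ((floorMap l (l ^ γ) x).2 : ℝ)) := by
      unfold eta floorMap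
      dsimp only
      have : 0 ≤ |(⌊l * x.1⌋ : ℝ)| ^ α := by positivity
      linarith
    have h5 : 0 ≤ |(⌊l ^ γ * x.2⌋ : ℝ)| ^ β := by positivity
    rw [abs_mul, abs_of_pos hΛl, Real.rpow_neg (abs_nonneg _)]
    set E := eta α β (((floorMap l (l ^ γ) x).1 : ℝ), ((floorMap l (l ^ γ) x).2 : ℝ))
    calc _ ≤ l ^ (γ * β) * (C * (1 + E)⁻¹) := mul_le_mul_of_nonneg_left h1 hΛl.le
      _ = C * (l ^ (γ * β) / (1 + E)) := by ring
      _ ≤ C * (2 ^ β / |x.2| ^ β) := by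
          refine mul_le_mul_of_nonneg_left ?_ hC0
          rw [div_le_div_iff₀ (by linarith) h3]
          have : (0 : ℝ) < 2 ^ β := by positivity
          nlinarith
      _ = _ := by ring
  · filter_upwards [ae_coord_ne_zero] with x hx
    have h1 := tendsto_tri_floor tendsto_id (tendsto_div_floor_self tendsto_id) x.1
    have h2 := tendsto_tri_floor hM (tendsto_div_floor_self hM) x.2
    rw [mul_one] at h1 h2
    refine (h1.mul h2).mul (h.tendsto hΛ (fun h0 => hx.2 (congrArg Prod.snd h0)) ?_)
    -- The scale l^(γβ) is tuned to the long side. Its horizontal unit l^(γβ/α) is much larger than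
    -- l, so the first coordinate collapses to 0.
    have h3 : Tendsto (fun l : ℝ => (⌊l * x.1⌋ : ℝ) / (l ^ (γ * β)) ^ (1 / α)) atTop (𝓝 0) := by
      have h4 : 0 < γ * β / α - 1 := by rw [sub_pos, one_lt_div hα0]; exact hγα
      have h5 := (tendsto_floor_div tendsto_id (tendsto_const_nhds (x := x.1))).mul
        (tendsto_rpow_neg_atTop h4)
      rw [mul_zero] at h5
      refine h5.congr' ?_
      filter_upwards [eventually_gt_atTop 0] with l hl
      rw [← Real.rpow_mul hl.le, mul_one_div, id, div_mul_eq_mul_div, div_eq_div_iff hl.ne'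
        (Real.rpow_pos_of_pos hl _).ne', mul_assoc, ← Real.rpow_add hl]
      congr 1
      rw [show -(γ * β / α - 1) + γ * β / α = 1 by ring, Real.rpow_one]
    have h6 : Tendsto (fun l : ℝ => (⌊l ^ γ * x.2⌋ : ℝ) / (l ^ (γ * β)) ^ (1 / β)) atTop
        (𝓝 x.2) := by
      refine (tendsto_floor_div hM (tendsto_const_nhds (x := x.2))).congr' ?_
      filter_upwards [eventually_gt_atTop 0] with l hl
      rw [← Real.rpow_mul hl.le, mul_one_div, mul_div_cancel_right₀ _ hβ0.ne']
    exact h3.prodMk_nhds h6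
  · filter_upwards [eventually_gt_atTop 0] with l hl
    rw [id, ← Real.rpow_add hl, ← Real.rpow_one_add' hl.le (by positivity), ← Real.rpow_add hl]
    congr 1
    ring

/-! #### Long range dependence -/

/-- The box of sides n^(1/α) and n^(1/β) contains at least n^(1/α + 1/β) points, each contributing
at least 1/(3n); the total is unbounded. -/
lemma not_summable_inv_eta (hα : 0 < α) (hβ : 0 < β) (h : 1 < 1 / α + 1 / β) :
    ¬ Summable fun z : ℤ × ℤ => (1 + eta α β ((z.1 : ℝ), (z.2 : ℝ)))⁻¹ := by
  intro hs
  set T := ∑' z : ℤ × ℤ, (1 + eta α β ((z.1 : ℝ), (z.2 : ℝ)))⁻¹ with hT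
  have key : ∀ n : ℝ, 1 ≤ n → n ^ (1 / α + 1 / β - 1) ≤ 3 * T := by
    intro n hn
    have hn0 : 0 < n := by linarith
    set S : Finset (ℤ × ℤ) := Finset.Icc 0 ⌊n ^ (1 / α)⌋ ×ˢ Finset.Icc 0 ⌊n ^ (1 / β)⌋ with hS
    have h1 : ∑ z ∈ S, (1 + eta α β ((z.1 : ℝ), (z.2 : ℝ)))⁻¹ ≤ T :=
      hs.sum_le_tsum S fun z _ => by have := eta_nonneg (α := α) (β := β) ((z.1 : ℝ), (z.2 : ℝ)); positivity
    have hc : ∀ {p : ℝ} {m : ℤ}, 0 < p → m ∈ Finset.Icc 0 ⌊n ^ (1 / p)⌋ → |(m : ℝ)| ^ p ≤ n := by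
      intro p m hp hm
      rw [Finset.mem_Icc] at hm
      have h2 : |(m : ℝ)| ≤ n ^ (1 / p) := by
        rw [abs_of_nonneg (by exact_mod_cast hm.1)]
        exact (Int.cast_le.2 hm.2).trans (Int.floor_le _)
      have h3 := Real.rpow_le_rpow (abs_nonneg _) h2 hp.le
      rwa [← Real.rpow_mul hn0.le, one_div_mul_cancel hp.ne', Real.rpow_one] at h3
    have h2 : ∀ z ∈ S, (3 * n)⁻¹ ≤ (1 + eta α β ((z.1 : ℝ), (z.2 : ℝ)))⁻¹ := by
      intro z hz
      have hz' := Finset.mem_product.1 hz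
      have h3 := hc hα hz'.1
      have h4 := hc hβ hz'.2
      have h5 : 0 ≤ eta α β ((z.1 : ℝ), (z.2 : ℝ)) := eta_nonneg _
      refine inv_anti₀ (by positivity) ?_
      unfold eta
      dsimp only
      linarith
    have h3 := (Finset.card_nsmul_le_sum S _ _ h2).trans h1
    have hcard : ∀ {y : ℝ}, 0 < y → y ≤ ((Finset.Icc 0 ⌊y⌋).card : ℝ) := by
      intro y hy
      have h4 : 0 ≤ ⌊y⌋ := Int.floor_nonneg.2 hy.le
      rw [Int.card_Icc]
      have h5 : (((⌊y⌋ + 1 - 0).toNat : ℕ) : ℝ) = ⌊y⌋ + 1 := by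
        rw [← Int.cast_natCast, Int.toNat_of_nonneg (by omega)]
        push_cast
        ring
      rw [h5]
      exact (Int.lt_floor_add_one y).le
    have h4 : n ^ (1 / α) * n ^ (1 / β) ≤ (S.card : ℝ) := by
      rw [hS, Finset.card_product]
      push_cast
      exact mul_le_mul (hcard (by positivity)) (hcard (by positivity)) (by positivity)
        (by positivity)
    rw [nsmul_eq_mul] at h3
    have h5 : n ^ (1 / α + 1 / β - 1) * n = n ^ (1 / α) * n ^ (1 / β) := by
      rw [Real.rpow_sub hn0, Real.rpow_add hn0, Real.rpow_one]
      field_simp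
    rw [← div_eq_mul_inv, div_le_iff₀ (by positivity)] at h3
    nlinarith
  obtain ⟨n, hn, hn1⟩ := (((tendsto_rpow_atTop (by linarith : 0 < 1 / α + 1 / β - 1)
    ).eventually_gt_atTop (3 * T)).and (eventually_ge_atTop 1)).exists
  exact absurd (key n hn1) (not_le.2 hn)

/-- Divided by the number of sites, the double sum is a sum of R with weights tending to 1, and R
dominates a non-summable positive function off a finite set. No exclusion of boundary cases is
needed, so the variance equivalences hold for every γ. -/
lemma tendsto_boxSum_atTop (h : HomogLimit α β R G) {γ : ℝ} (hγ : 0 < γ) :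
    Tendsto (fun l : ℝ => boxSum R ⌊l⌋ ⌊l ^ γ⌋ / (⌊l⌋ * ⌊l ^ γ⌋ : ℝ)) atTop atTop := by
  obtain ⟨c, C, hc, hev⟩ := h.exists_eventually_bounds
  set g : ℤ × ℤ → ℝ := fun z => (1 + eta α β ((z.1 : ℝ), (z.2 : ℝ)))⁻¹ with hg
  have hg0 : ∀ z, 0 ≤ g z := fun z => by
    have := eta_nonneg (α := α) (β := β) ((z.1 : ℝ), (z.2 : ℝ))
    simp only [hg]; positivity
  have hev' : ∀ᶠ z in cofinite, c * g z ≤ R z := by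
    filter_upwards [hev] with z hz
    have h0 := eta_nonneg (α := α) (β := β) ((z.1 : ℝ), (z.2 : ℝ))
    simp only [hg]
    rw [← div_eq_mul_inv, div_le_iff₀ (by positivity)]
    have : 0 ≤ R z := by
      by_contra! hneg
      nlinarith [hz.1]
    nlinarith [hz.1]
  -- Only finitely many sites violate the lower bound; their total defect, denoted C₀ below, does
  -- not depend on l.
  set E := (show {z | ¬ c * g z ≤ R z}.Finite from hev').toFinset with hE
  have hle : ∀ z, c * g z - (if z ∈ E then |R z - c * g z| else 0) ≤ R z := by
    intro z
    split_ifs with hz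
    · linarith [neg_abs_le (R z - c * g z)]
    · rw [hE, Set.Finite.mem_toFinset] at hz
      have : c * g z ≤ R z := not_not.1 hz
      linarith
  set C₀ := ∑ z ∈ E, |R z - c * g z| with hC₀
  have hMt := tendsto_rpow_atTop hγ
  rw [tendsto_atTop]
  intro K
  obtain ⟨S, hS⟩ : ∃ S : Finset (ℤ × ℤ), (K + C₀) / c + 1 < ∑ z ∈ S, g z := by
    by_contra! hno
    exact not_summable_inv_eta h.α_pos h.β_pos h.one_lt (summable_of_sum_le hg0 hno)
  have hlim : Tendsto (fun l : ℝ => ∑ z ∈ S, tri (z.1 / ⌊l⌋) * tri (z.2 / ⌊l ^ γ⌋) * g z) atTop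
      (𝓝 (∑ z ∈ S, g z)) := by
    refine tendsto_finsetSum _ fun z _ => ?_
    have h1 : ∀ {A : ℝ → ℝ}, Tendsto A atTop atTop → ∀ m : ℤ,
        Tendsto (fun l => tri ((m : ℝ) / ⌊A l⌋)) atTop (𝓝 1) := by
      intro A hA m
      rw [← tri_zero]
      refine (continuous_tri.tendsto 0).comp (Tendsto.const_div_atTop ?_ _)
      exact tendsto_intCast_atTop_atTop.comp (tendsto_floor_atTop.comp hA)
    simpa using ((h1 tendsto_id z.1).mul (h1 hMt z.2)).mul_const (g z)
  filter_upwards [hlim.eventually (lt_mem_nhds ((lt_add_one _).trans hS)),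
    eventually_floor_pos tendsto_id, eventually_floor_pos hMt] with l hl hN hM
  have hN' : (0 : ℝ) < ⌊l⌋ := by exact_mod_cast hN
  have hM' : (0 : ℝ) < ⌊l ^ γ⌋ := by exact_mod_cast hM
  rw [id] at hN
  rw [boxSum_eq_tsum hN hM, mul_div_cancel_left₀ _ (by positivity)]
  have hw0 : ∀ z : ℤ × ℤ, 0 ≤ tri (z.1 / ⌊l⌋) * tri (z.2 / ⌊l ^ γ⌋) := fun z =>
    mul_nonneg (tri_nonneg _) (tri_nonneg _)
  have hw1 : ∀ z : ℤ × ℤ, tri (z.1 / ⌊l⌋) * tri (z.2 / ⌊l ^ γ⌋) ≤ 1 := fun z =>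
    mul_le_one₀ (tri_le_one _) (tri_nonneg _) (tri_le_one _)
  have hsg := summable_tri_mul hN hM g
  have hse : Summable fun z => if z ∈ E then |R z - c * g z| else 0 :=
    summable_of_ne_finset_zero (s := E) fun z hz => if_neg hz
  have h1 : ∑' z, (c * (tri (z.1 / ⌊l⌋) * tri (z.2 / ⌊l ^ γ⌋) * g z) -
      (if z ∈ E then |R z - c * g z| else 0)) ≤
      ∑' z : ℤ × ℤ, tri (z.1 / ⌊l⌋) * tri (z.2 / ⌊l ^ γ⌋) * R z := by
    refine ((hsg.mul_left c).sub hse).tsum_le_tsum (fun z => ?_) (summable_tri_mul hN hM R)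
    have h2 := mul_le_mul_of_nonneg_left (hle z) (hw0 z)
    have h3 : 0 ≤ if z ∈ E then |R z - c * g z| else 0 := by split_ifs <;> positivity
    have h4 := mul_le_mul_of_nonneg_right (hw1 z) h3
    nlinarith
  rw [(hsg.mul_left c).tsum_sub hse, tsum_mul_left, tsum_eq_sum (s := E) fun z hz => if_neg hz,
    Finset.sum_congr rfl fun z hz => if_pos hz] at h1
  have h5 := hsg.sum_le_tsum S fun z _ => mul_nonneg (hw0 z) (hg0 z)
  have h6 : (K + C₀) / c < ∑' z : ℤ × ℤ, tri (z.1 / ⌊l⌋) * tri (z.2 / ⌊l ^ γ⌋) * g z := hl.trans_le h5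
  rw [div_lt_iff₀ hc] at h6
  linarith

end HomogLimit

/-! ### The limit constants -/

lemma lintegral_fin_prod_eq_pow {n : ℕ} {f : ℝ × ℝ → ℝ≥0∞} (hf : Measurable f) :
    ∫⁻ w : Fin n → ℝ × ℝ, ∏ i, f (w i) = (∫⁻ x, f x) ^ n := by
  induction n with
  | zero => simp [volume_pi]
  | succ n ih =>
    rw [← (volume_preserving_piFinSuccAbove (fun _ : Fin (n + 1) => ℝ × ℝ) 0).symm.lintegral_comp_emb
      (MeasurableEquiv.measurableEmbedding _), pow_succ', ← ih, Measure.volume_eq_prod,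
      ← lintegral_prod_mul hf.aemeasurable]
    · refine lintegral_congr fun x => ?_
      rw [Fin.prod_univ_succ]
      rfl
    · exact (Finset.measurable_fun_prod _ fun i _ => hf.comp (measurable_pi_apply i)).aemeasurable

/-- The square is a double integral; after Tonelli the integral over w factors into k equal
integrals over the plane. -/
lemma lintegral_sq_lintegral_prod {S : Type*} [MeasurableSpace S] (ν : Measure S) [SFinite ν]
    (k : ℕ) {K : S → ℝ × ℝ → ℝ≥0∞} (hK : Measurable (Function.uncurry K)) :
    ∫⁻ w : Fin k → ℝ × ℝ, (∫⁻ s, ∏ i, K s (w i) ∂ν) ^ 2 =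
      ∫⁻ s, ∫⁻ s', (∫⁻ x, K s x * K s' x) ^ k ∂ν ∂ν := by
  have hP : Measurable fun p : S × (Fin k → ℝ × ℝ) => ∏ i, K p.1 (p.2 i) :=
    Finset.measurable_fun_prod _ fun i _ =>
      hK.comp (measurable_fst.prodMk ((measurable_pi_apply i).comp measurable_snd))
  have hPs : ∀ w : Fin k → ℝ × ℝ, Measurable fun s => ∏ i, K s (w i) := fun w =>
    hP.comp (measurable_id.prodMk measurable_const)
  have h1 : ∀ w : Fin k → ℝ × ℝ, (∫⁻ s, ∏ i, K s (w i) ∂ν) ^ 2 =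
      ∫⁻ s, ∫⁻ s', ∏ i, (K s (w i) * K s' (w i)) ∂ν ∂ν := by
    intro w
    simp_rw [Finset.prod_mul_distrib]
    simp_rw [lintegral_const_mul _ (hPs w)]
    rw [lintegral_mul_const _ (hPs w), sq]
  have hQ : Measurable fun p : (Fin k → ℝ × ℝ) × S × S =>
      ∏ i, (K p.2.1 (p.1 i) * K p.2.2 (p.1 i)) := by
    refine Finset.measurable_fun_prod _ fun i _ => ?_
    have h2 : Measurable fun p : (Fin k → ℝ × ℝ) × S × S => p.1 i :=
      (measurable_pi_apply i).comp measurable_fst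
    exact (hK.comp ((measurable_fst.comp measurable_snd).prodMk h2)).mul
      (hK.comp ((measurable_snd.comp measurable_snd).prodMk h2))
  have hQ1 : Measurable fun p : (Fin k → ℝ × ℝ) × S =>
      ∫⁻ s', ∏ i, (K p.2 (p.1 i) * K s' (p.1 i)) ∂ν := by
    have : Measurable fun q : ((Fin k → ℝ × ℝ) × S) × S =>
        ∏ i, (K q.1.2 (q.1.1 i) * K q.2 (q.1.1 i)) :=
      hQ.comp ((measurable_fst.comp measurable_fst).prodMk
        ((measurable_snd.comp measurable_fst).prodMk measurable_snd))
    exact this.lintegral_prod_right'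
  simp_rw [h1]
  rw [lintegral_lintegral_swap hQ1.aemeasurable]
  refine lintegral_congr fun s => ?_
  rw [lintegral_lintegral_swap]
  swap
  · have : Measurable fun q : (Fin k → ℝ × ℝ) × S => ∏ i, (K s (q.1 i) * K q.2 (q.1 i)) :=
      hQ.comp (measurable_fst.prodMk (measurable_const.prodMk measurable_snd))
    exact this.aemeasurable
  refine lintegral_congr fun s' => ?_
  have h3 : ∀ s, Measurable (K s) := fun s => hK.comp measurable_prodMk_left
  exact lintegral_fin_prod_eq_pow ((h3 s).mul (h3 s'))

/-- The squared norm of an integrated product kernel. -/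
lemma sqNorm_integral_prod {S : Type*} [MeasurableSpace S] (ν : Measure S) [SFinite ν]
    (k : ℕ) {K : S → ℝ × ℝ → ℝ} (hK : Measurable (Function.uncurry K)) (h0 : ∀ s x, 0 ≤ K s x)
    (hfin : ∫⁻ s, ∫⁻ s', (∫⁻ x, ENNReal.ofReal (K s x) * ENNReal.ofReal (K s' x)) ^ k ∂ν ∂ν ≠ ∞) :
    sqNorm k (fun w => ∫ s, ∏ i, K s (w i) ∂ν) =
      (∫⁻ s, ∫⁻ s', (∫⁻ x, ENNReal.ofReal (K s x) * ENNReal.ofReal (K s' x)) ^ k ∂ν ∂ν).toReal := by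
  have hK' : Measurable (Function.uncurry fun s x => ENNReal.ofReal (K s x)) := hK.ennreal_ofReal
  have hP : Measurable fun p : (Fin k → ℝ × ℝ) × S => ∏ i, K p.2 (p.1 i) :=
    Finset.measurable_fun_prod _ fun i _ =>
      hK.comp (measurable_snd.prodMk ((measurable_pi_apply i).comp measurable_fst))
  have hP0 : ∀ (w : Fin k → ℝ × ℝ) s, 0 ≤ ∏ i, K s (w i) := fun w s =>
    Finset.prod_nonneg fun i _ => h0 _ _
  have hPe : ∀ (w : Fin k → ℝ × ℝ) s, ENNReal.ofReal (∏ i, K s (w i)) =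
      ∏ i, ENNReal.ofReal (K s (w i)) := fun w s => ENNReal.ofReal_prod_of_nonneg fun i _ => h0 _ _
  have hPs : ∀ w : Fin k → ℝ × ℝ, Measurable fun s => ∏ i, K s (w i) := fun w =>
    hP.comp measurable_prodMk_left
  have hI : Measurable fun w : Fin k → ℝ × ℝ => ∫⁻ s, ∏ i, ENNReal.ofReal (K s (w i)) ∂ν := by
    simp_rw [← hPe]
    exact hP.ennreal_ofReal.lintegral_prod_right'
  rw [← lintegral_sq_lintegral_prod ν k hK'] at hfin ⊢
  have hm : AEStronglyMeasurable fun w : Fin k → ℝ × ℝ => (∫ s, ∏ i, K s (w i) ∂ν) ^ 2 :=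
    (hP.stronglyMeasurable.integral_prod_right'.pow 2).aestronglyMeasurable
  rw [sqNorm, integral_eq_lintegral_of_nonneg_ae (Eventually.of_forall fun w => sq_nonneg _) hm]
  congr 1
  refine lintegral_congr_ae ?_
  -- Where the inner lower integral is infinite the Bochner integral takes the default value 0;
  -- finiteness of the total confines this to a null set.
  filter_upwards [ae_lt_top (hI.pow_const 2) hfin] with w hw
  have hw' : ∫⁻ s, ∏ i, ENNReal.ofReal (K s (w i)) ∂ν ≠ ∞ := by
    intro h
    rw [h] at hw
    simp at hw
  rw [integral_eq_lintegral_of_nonneg_ae (Eventually.of_forall (hP0 w))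
    (hPs w).aestronglyMeasurable, ENNReal.ofReal_pow ENNReal.toReal_nonneg]
  simp_rw [hPe]
  rw [ENNReal.ofReal_toReal hw']

/-! #### Differences of uniform points -/

lemma volume_Ioc_inter_preimage (x : ℝ) :
    volume (Ioc (0 : ℝ) 1 ∩ (fun s => x + s) ⁻¹' Ioc 0 1) = ENNReal.ofReal (tri x) := by
  have : Ioc (0 : ℝ) 1 ∩ (fun s => x + s) ⁻¹' Ioc 0 1 = Ioc (max 0 (-x)) (min 1 (1 - x)) := by
    ext s
    simp only [mem_inter_iff, mem_Ioc, mem_preimage, max_lt_iff, le_min_iff]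
    constructor
    · rintro ⟨⟨h1, h2⟩, h3, h4⟩; exact ⟨⟨h1, by linarith⟩, h2, by linarith⟩
    · rintro ⟨⟨h1, h2⟩, h3, h4⟩; exact ⟨⟨h1, h3⟩, by linarith, by linarith⟩
  have hmax : ∀ y : ℝ, ENNReal.ofReal (max 0 y) = ENNReal.ofReal y := by
    intro y
    rcases le_total 0 y with h | h
    · rw [max_eq_right h]
    · rw [max_eq_left h, ENNReal.ofReal_zero, ENNReal.ofReal_of_nonpos h]
  rw [this, Real.volume_Ioc, tri, hmax]
  congr 1
  rcases abs_cases x with ⟨h1, h2⟩ | ⟨h1, h2⟩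
  · rw [max_eq_left (by linarith), min_eq_right (by linarith), h1]; ring
  · rw [max_eq_right (by linarith), min_eq_left (by linarith), h1]

/-- The difference of two independent uniform points of (0,1] has the triangular density. -/
lemma lintegral_Ioc_sub {g : ℝ → ℝ≥0∞} (hg : Measurable g) :
    ∫⁻ s in Ioc (0 : ℝ) 1, ∫⁻ s' in Ioc (0 : ℝ) 1, g (s' - s) =
      ∫⁻ x, ENNReal.ofReal (tri x) * g x := by
  have hind : Measurable ((Ioc (0 : ℝ) 1).indicator (1 : ℝ → ℝ≥0∞)) :=
    measurable_one.indicator measurableSet_Ioc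
  have h1 : ∀ s : ℝ, ∫⁻ s' in Ioc (0 : ℝ) 1, g (s' - s) =
      ∫⁻ x, (Ioc (0 : ℝ) 1).indicator 1 (x + s) * g x := by
    intro s
    rw [← lintegral_indicator measurableSet_Ioc, ← lintegral_add_right_eq_self _ s]
    refine lintegral_congr fun x => ?_
    by_cases hx : x + s ∈ Ioc (0 : ℝ) 1
    · rw [indicator_of_mem hx, indicator_of_mem hx, add_sub_cancel_right]; simp
    · rw [indicator_of_notMem hx, indicator_of_notMem hx, zero_mul]
  simp_rw [h1]
  rw [lintegral_lintegral_swap]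
  swap
  · exact ((hind.comp (measurable_snd.add measurable_fst)).mul
      (hg.comp measurable_snd)).aemeasurable
  refine lintegral_congr fun x => ?_
  rw [lintegral_mul_const _ (show Measurable fun s : ℝ => (Ioc (0 : ℝ) 1).indicator (1 : ℝ → ℝ≥0∞)
    (x + s) from hind.comp (measurable_const_add x))]
  congr 1
  rw [← volume_Ioc_inter_preimage, ← lintegral_indicator measurableSet_Ioc,
    ← lintegral_indicator_one (measurableSet_Ioc.inter (measurable_const_add x measurableSet_Ioc))]
  refine lintegral_congr fun s => ?_
  by_cases hs : s ∈ Ioc (0 : ℝ) 1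
  · rw [indicator_of_mem hs]
    by_cases hs' : x + s ∈ Ioc (0 : ℝ) 1
    · rw [indicator_of_mem hs',
        indicator_of_mem (show s ∈ Ioc (0 : ℝ) 1 ∩ (fun s => x + s) ⁻¹' Ioc 0 1 from ⟨hs, hs'⟩)]
      rfl
    · rw [indicator_of_notMem hs', indicator_of_notMem
        fun h : s ∈ Ioc (0 : ℝ) 1 ∩ (fun s => x + s) ⁻¹' Ioc 0 1 => hs' h.2]
  · rw [indicator_of_notMem hs, indicator_of_notMem
      fun h : s ∈ Ioc (0 : ℝ) 1 ∩ (fun s => x + s) ⁻¹' Ioc 0 1 => hs h.1]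

lemma lintegral_box_sub {g : ℝ × ℝ → ℝ≥0∞} (hg : Measurable g) :
    ∫⁻ z in Ioc (0 : ℝ) 1 ×ˢ Ioc (0 : ℝ) 1, ∫⁻ z' in Ioc (0 : ℝ) 1 ×ˢ Ioc (0 : ℝ) 1, g (z' - z) =
      ∫⁻ x : ℝ × ℝ, ENNReal.ofReal (tri x.1 * tri x.2) * g x := by
  have hin : ∀ z : ℝ × ℝ, ∫⁻ z' in Ioc (0 : ℝ) 1 ×ˢ Ioc (0 : ℝ) 1, g (z' - z) =
      ∫⁻ t' in Ioc (0 : ℝ) 1, ∫⁻ s' in Ioc (0 : ℝ) 1, g (t' - z.1, s' - z.2) := by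
    intro z
    rw [Measure.volume_eq_prod, setLIntegral_prod _ (show Measurable fun z' => g (z' - z) from
      hg.comp (measurable_id.sub_const z)).aemeasurable]
    rfl
  have hm1 : Measurable fun p : ((ℝ × ℝ) × ℝ) × ℝ => g (p.1.2 - p.1.1.1, p.2 - p.1.1.2) := by
    fun_prop
  have hm2 : Measurable fun p : (ℝ × ℝ) × ℝ =>
      ∫⁻ s' in Ioc (0 : ℝ) 1, g (p.2 - p.1.1, s' - p.1.2) := hm1.lintegral_prod_right'
  have hm3 : Measurable fun p : ℝ × ℝ =>
      ∫⁻ t' in Ioc (0 : ℝ) 1, ∫⁻ s' in Ioc (0 : ℝ) 1, g (t' - p.1, s' - p.2) :=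
    hm2.lintegral_prod_right'
  have hT : Measurable fun y : ℝ => ENNReal.ofReal (tri y) := continuous_tri.measurable.ennreal_ofReal
  have hm4 : Measurable fun p : ℝ × ℝ => ENNReal.ofReal (tri p.2) * g p :=
    (hT.comp measurable_snd).mul hg
  have hm5 : Measurable fun x : ℝ => ∫⁻ y, ENNReal.ofReal (tri y) * g (x, y) :=
    hm4.lintegral_prod_right'
  simp_rw [hin]
  rw [Measure.volume_eq_prod, setLIntegral_prod _ hm3.aemeasurable]
  have h1 : ∀ t : ℝ, ∫⁻ s in Ioc (0 : ℝ) 1, ∫⁻ t' in Ioc (0 : ℝ) 1, ∫⁻ s' in Ioc (0 : ℝ) 1,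
      g (t' - t, s' - s) = ∫⁻ t' in Ioc (0 : ℝ) 1, ∫⁻ y, ENNReal.ofReal (tri y) * g (t' - t, y) := by
    intro t
    rw [lintegral_lintegral_swap]
    swap
    · have : Measurable fun p : ℝ × ℝ => ∫⁻ s' in Ioc (0 : ℝ) 1, g (p.2 - t, s' - p.1) :=
        hm2.comp ((measurable_const.prodMk measurable_fst).prodMk measurable_snd)
      exact this.aemeasurable
    refine lintegral_congr fun t' => ?_
    exact lintegral_Ioc_sub (hg.comp (measurable_const.prodMk measurable_id))
  simp_rw [h1]
  rw [lintegral_Ioc_sub (g := fun x => ∫⁻ y, ENNReal.ofReal (tri y) * g (x, y)) hm5,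
    lintegral_prod]
  · refine lintegral_congr fun x => ?_
    rw [← lintegral_const_mul _ (show Measurable fun y => ENNReal.ofReal (tri y) * g (x, y) from
      hT.mul (hg.comp measurable_prodMk_left))]
    refine lintegral_congr fun y => ?_
    rw [ENNReal.ofReal_mul (tri_nonneg _), mul_assoc]
  · exact (((continuous_tri.measurable.comp measurable_fst).mul
      (continuous_tri.measurable.comp measurable_snd)).ennreal_ofReal.mul hg).aemeasurable

/-- Integration over a strip of differences. -/
lemma setIntegral_strip_eq {G : ℝ × ℝ → ℝ} (hG : Measurable G) (h0 : ∀ x, 0 ≤ G x) :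
    ∫ x in (Ioc (0 : ℝ) 1 ×ˢ Ioc (0 : ℝ) 1) ×ˢ (univ : Set ℝ), G (x.1.1 - x.1.2, x.2) =
      ∫ x : ℝ × ℝ, tri x.1 * G x := by
  have hm1 : Measurable fun x : (ℝ × ℝ) × ℝ => G (x.1.1 - x.1.2, x.2) := by fun_prop
  have hm2 : Measurable fun x : ℝ => ∫⁻ y, ENNReal.ofReal (G (x, y)) :=
    hG.ennreal_ofReal.lintegral_prod_right'
  have hm3 : Measurable fun x : ℝ × ℝ => ∫⁻ y, ENNReal.ofReal (G (x.1 - x.2, y)) :=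
    hm2.comp (measurable_fst.sub measurable_snd)
  rw [integral_eq_lintegral_of_nonneg_ae (Eventually.of_forall fun x => h0 _)
      hm1.aestronglyMeasurable,
    integral_eq_lintegral_of_nonneg_ae (Eventually.of_forall fun x => mul_nonneg (tri_nonneg _) (h0 _))
      ((continuous_tri.measurable.comp measurable_fst).mul hG).aestronglyMeasurable]
  congr 1
  rw [Measure.volume_eq_prod, setLIntegral_prod _ hm1.ennreal_ofReal.aemeasurable]
  simp only [Measure.restrict_univ]
  rw [Measure.volume_eq_prod, setLIntegral_prod_symm _ hm3.aemeasurable,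
    lintegral_Ioc_sub (g := fun x => ∫⁻ y, ENNReal.ofReal (G (x, y))) hm2, lintegral_prod]
  · refine lintegral_congr fun x => ?_
    rw [← lintegral_const_mul _ (show Measurable fun y => ENNReal.ofReal (G (x, y)) from
      hG.ennreal_ofReal.comp measurable_prodMk_left)]
    refine lintegral_congr fun y => ?_
    rw [ENNReal.ofReal_mul (tri_nonneg _)]
  · exact ((continuous_tri.measurable.comp measurable_fst).mul hG).ennreal_ofReal.aemeasurable

/-! #### The kernels -/

section Kernels

variable {q₁ q₂ : ℝ} {L₀ : ℝ → ℝ} {a : ℤ × ℤ → ℝ} (ha : CoefAssumption q₁ q₂ L₀ a)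
include ha

/-- The origin is excluded because the two singularities merge there and integrability may fail. -/
lemma CoefAssumption.lintegral_aInf_mul {ζ : ℝ × ℝ} (hζ : ζ ≠ 0) :
    ∫⁻ w, ENNReal.ofReal (aInf q₁ q₂ L₀ w) * ENNReal.ofReal (aInf q₁ q₂ L₀ (ζ + w)) =
      ENNReal.ofReal (corrInf q₁ q₂ L₀ ζ) := by
  rw [corrInf, planeConv, ofReal_integral_eq_lintegral_ofReal (ha.integrable_aInf_mul hζ)
    (Eventually.of_forall fun w => mul_nonneg (ha.aInf_nonneg _) (ha.aInf_nonneg _))]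
  simp_rw [ENNReal.ofReal_mul (ha.aInf_nonneg _)]

lemma CoefAssumption.measurable_lintegral_aInf_mul : Measurable fun ζ : ℝ × ℝ =>
    ∫⁻ w, ENNReal.ofReal (aInf q₁ q₂ L₀ w) * ENNReal.ofReal (aInf q₁ q₂ L₀ (ζ + w)) := by
  have h := ha.measurable_aInf.ennreal_ofReal
  have : Measurable fun x : (ℝ × ℝ) × (ℝ × ℝ) =>
      ENNReal.ofReal (aInf q₁ q₂ L₀ x.2) * ENNReal.ofReal (aInf q₁ q₂ L₀ (x.1 + x.2)) :=
    (h.comp measurable_snd).mul (h.comp (measurable_fst.add measurable_snd))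
  exact this.lintegral_prod_right'

/-- The integral over w of two shifted kernels depends only on z' - z, and the difference of two
points of the unit square has a product of triangular densities. -/
lemma CoefAssumption.sqNorm_hKer {k : ℕ}
    (hi : Integrable fun x : ℝ × ℝ => tri x.1 * tri x.2 * corrInf q₁ q₂ L₀ x ^ k) :
    sqNorm k (hKer q₁ q₂ L₀ k 1 1) =
      ∫ x : ℝ × ℝ, tri x.1 * tri x.2 * corrInf q₁ q₂ L₀ x ^ k := by
  set e : ℝ × ℝ → ℝ≥0∞ := fun ζ =>
    ∫⁻ w, ENNReal.ofReal (aInf q₁ q₂ L₀ w) * ENNReal.ofReal (aInf q₁ q₂ L₀ (ζ + w)) with he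
  have hem : Measurable e := ha.measurable_lintegral_aInf_mul
  have h1 : ∀ z z' : ℝ × ℝ, ∫⁻ w, ENNReal.ofReal (aInf q₁ q₂ L₀ (z - w)) *
      ENNReal.ofReal (aInf q₁ q₂ L₀ (z' - w)) = e (z' - z) := by
    intro z z'
    rw [he]
    dsimp only
    rw [← lintegral_sub_left_eq_self (fun w => ENNReal.ofReal (aInf q₁ q₂ L₀ w) *
      ENNReal.ofReal (aInf q₁ q₂ L₀ (z' - z + w))) z]
    refine lintegral_congr fun w => ?_
    rw [sub_add_sub_cancel]
  have h2 : ∫⁻ z in Ioc (0 : ℝ) 1 ×ˢ Ioc (0 : ℝ) 1, ∫⁻ z' in Ioc (0 : ℝ) 1 ×ˢ Ioc (0 : ℝ) 1,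
      (∫⁻ w, ENNReal.ofReal (aInf q₁ q₂ L₀ (z - w)) *
      ENNReal.ofReal (aInf q₁ q₂ L₀ (z' - w))) ^ k =
      ENNReal.ofReal (∫ x : ℝ × ℝ, tri x.1 * tri x.2 * corrInf q₁ q₂ L₀ x ^ k) := by
    simp_rw [h1]
    rw [lintegral_box_sub (hem.pow_const k), ofReal_integral_eq_lintegral_ofReal hi
      (Eventually.of_forall fun x => mul_nonneg (mul_nonneg (tri_nonneg _) (tri_nonneg _))
        (pow_nonneg (ha.corrInf_nonneg x) k))]
    refine lintegral_congr_ae ?_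
    filter_upwards [ae_ne_zero] with x hx
    rw [he]
    dsimp only
    rw [ha.lintegral_aInf_mul hx, ← ENNReal.ofReal_pow (ha.corrInf_nonneg x),
      ENNReal.ofReal_mul (mul_nonneg (tri_nonneg _) (tri_nonneg _))]
  have h3 : Measurable (Function.uncurry fun z w : ℝ × ℝ => aInf q₁ q₂ L₀ (z - w)) :=
    ha.measurable_aInf.comp (measurable_fst.sub measurable_snd)
  have h4 := sqNorm_integral_prod (volume.restrict (Ioc (0 : ℝ) 1 ×ˢ Ioc (0 : ℝ) 1)) k h3
    (fun z w => ha.aInf_nonneg _) (by rw [h2]; exact ENNReal.ofReal_ne_top)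
  rw [h2, ENNReal.toReal_ofReal (integral_nonneg fun x => mul_nonneg
    (mul_nonneg (tri_nonneg _) (tri_nonneg _)) (pow_nonneg (ha.corrInf_nonneg x) k))] at h4
  exact h4

/-- Only second coordinates are shifted, so the correlation enters through its values on the
vertical axis. -/
lemma CoefAssumption.sqNorm_hKerPlus {k : ℕ}
    (hi : Integrable fun y : ℝ => tri y * corrInf q₁ q₂ L₀ (0, y) ^ k) :
    sqNorm k (hKerPlus q₁ q₂ L₀ k 1) = ∫ y : ℝ, tri y * corrInf q₁ q₂ L₀ (0, y) ^ k := by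
  set e : ℝ × ℝ → ℝ≥0∞ := fun ζ =>
    ∫⁻ w, ENNReal.ofReal (aInf q₁ q₂ L₀ w) * ENNReal.ofReal (aInf q₁ q₂ L₀ (ζ + w)) with he
  have hem : Measurable e := ha.measurable_lintegral_aInf_mul
  have hm := ha.measurable_aInf.ennreal_ofReal
  have h1 : ∀ s s' : ℝ, ∫⁻ w : ℝ × ℝ, ENNReal.ofReal (aInf q₁ q₂ L₀ (w.1, s - w.2)) *
      ENNReal.ofReal (aInf q₁ q₂ L₀ (w.1, s' - w.2)) = e (0, s' - s) := by
    intro s s'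
    rw [he]
    dsimp only
    rw [Measure.volume_eq_prod, lintegral_prod, lintegral_prod]
    · refine lintegral_congr fun u => ?_
      rw [← lintegral_sub_left_eq_self (fun v => ENNReal.ofReal (aInf q₁ q₂ L₀ (u, v)) *
        ENNReal.ofReal (aInf q₁ q₂ L₀ ((0, s' - s) + (u, v)))) s]
      refine lintegral_congr fun v => ?_
      simp only [Prod.mk_add_mk, zero_add, sub_add_sub_cancel]
    · exact (hm.mul (hm.comp (measurable_const_add _))).aemeasurable
    · have : Measurable fun w : ℝ × ℝ => ENNReal.ofReal (aInf q₁ q₂ L₀ (w.1, s - w.2)) *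
        ENNReal.ofReal (aInf q₁ q₂ L₀ (w.1, s' - w.2)) := by
        exact (hm.comp (measurable_fst.prodMk (measurable_snd.const_sub s))).mul
          (hm.comp (measurable_fst.prodMk (measurable_snd.const_sub s')))
      exact this.aemeasurable
  have h2 : ∫⁻ s in Ioc (0 : ℝ) 1, ∫⁻ s' in Ioc (0 : ℝ) 1,
      (∫⁻ w : ℝ × ℝ, ENNReal.ofReal (aInf q₁ q₂ L₀ (w.1, s - w.2)) *
      ENNReal.ofReal (aInf q₁ q₂ L₀ (w.1, s' - w.2))) ^ k =
      ENNReal.ofReal (∫ y : ℝ, tri y * corrInf q₁ q₂ L₀ (0, y) ^ k) := by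
    simp_rw [h1]
    rw [lintegral_Ioc_sub (g := fun y => e (0, y) ^ k)
        ((hem.comp measurable_prodMk_left).pow_const k), ofReal_integral_eq_lintegral_ofReal hi
      (Eventually.of_forall fun x => mul_nonneg (tri_nonneg _)
        (pow_nonneg (ha.corrInf_nonneg _) k))]
    refine lintegral_congr_ae ?_
    have h0 : ∀ᵐ x : ℝ, x ≠ 0 := by rw [ae_iff]; simp
    filter_upwards [h0] with y hy
    rw [he]
    dsimp only
    rw [ha.lintegral_aInf_mul fun h => hy (congrArg Prod.snd h),
      ← ENNReal.ofReal_pow (ha.corrInf_nonneg _), ENNReal.ofReal_mul (tri_nonneg _)]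
  have h3 : Measurable (Function.uncurry fun (s : ℝ) (w : ℝ × ℝ) =>
      aInf q₁ q₂ L₀ (w.1, s - w.2)) :=
    ha.measurable_aInf.comp ((measurable_fst.comp measurable_snd).prodMk
      (measurable_fst.sub (measurable_snd.comp measurable_snd)))
  have h4 := sqNorm_integral_prod (volume.restrict (Ioc (0 : ℝ) 1)) k h3
    (fun z w => ha.aInf_nonneg _) (by rw [h2]; exact ENNReal.ofReal_ne_top)
  rw [h2, ENNReal.toReal_ofReal (integral_nonneg fun x => mul_nonneg
    (tri_nonneg _) (pow_nonneg (ha.corrInf_nonneg _) k))] at h4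
  exact h4

lemma CoefAssumption.sqNorm_hKerMinus {k : ℕ}
    (hi : Integrable fun y : ℝ => tri y * corrInf q₁ q₂ L₀ (y, 0) ^ k) :
    sqNorm k (hKerMinus q₁ q₂ L₀ k 1) = ∫ y : ℝ, tri y * corrInf q₁ q₂ L₀ (y, 0) ^ k := by
  set e : ℝ × ℝ → ℝ≥0∞ := fun ζ =>
    ∫⁻ w, ENNReal.ofReal (aInf q₁ q₂ L₀ w) * ENNReal.ofReal (aInf q₁ q₂ L₀ (ζ + w)) with he
  have hem : Measurable e := ha.measurable_lintegral_aInf_mul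
  have hm := ha.measurable_aInf.ennreal_ofReal
  have h1 : ∀ s s' : ℝ, ∫⁻ w : ℝ × ℝ, ENNReal.ofReal (aInf q₁ q₂ L₀ (s - w.1, w.2)) *
      ENNReal.ofReal (aInf q₁ q₂ L₀ (s' - w.1, w.2)) = e (s' - s, 0) := by
    intro s s'
    rw [he]
    dsimp only
    rw [Measure.volume_eq_prod, lintegral_prod_symm, lintegral_prod_symm]
    · refine lintegral_congr fun v => ?_
      rw [← lintegral_sub_left_eq_self (fun u => ENNReal.ofReal (aInf q₁ q₂ L₀ (u, v)) *
        ENNReal.ofReal (aInf q₁ q₂ L₀ ((s' - s, 0) + (u, v)))) s]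
      refine lintegral_congr fun v => ?_
      simp only [Prod.mk_add_mk, zero_add, sub_add_sub_cancel]
    · exact (hm.mul (hm.comp (measurable_const_add _))).aemeasurable
    · have : Measurable fun w : ℝ × ℝ => ENNReal.ofReal (aInf q₁ q₂ L₀ (s - w.1, w.2)) *
        ENNReal.ofReal (aInf q₁ q₂ L₀ (s' - w.1, w.2)) := by
        exact (hm.comp ((measurable_fst.const_sub s).prodMk measurable_snd)).mul
          (hm.comp ((measurable_fst.const_sub s').prodMk measurable_snd))
      exact this.aemeasurable
  have h2 : ∫⁻ s in Ioc (0 : ℝ) 1, ∫⁻ s' in Ioc (0 : ℝ) 1,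
      (∫⁻ w : ℝ × ℝ, ENNReal.ofReal (aInf q₁ q₂ L₀ (s - w.1, w.2)) *
      ENNReal.ofReal (aInf q₁ q₂ L₀ (s' - w.1, w.2))) ^ k =
      ENNReal.ofReal (∫ y : ℝ, tri y * corrInf q₁ q₂ L₀ (y, 0) ^ k) := by
    simp_rw [h1]
    rw [lintegral_Ioc_sub (g := fun y => e (y, 0) ^ k)
        ((hem.comp measurable_prodMk_right).pow_const k), ofReal_integral_eq_lintegral_ofReal hi
      (Eventually.of_forall fun x => mul_nonneg (tri_nonneg _)
        (pow_nonneg (ha.corrInf_nonneg _) k))]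
    refine lintegral_congr_ae ?_
    have h0 : ∀ᵐ x : ℝ, x ≠ 0 := by rw [ae_iff]; simp
    filter_upwards [h0] with y hy
    rw [he]
    dsimp only
    rw [ha.lintegral_aInf_mul fun h => hy (congrArg Prod.fst h),
      ← ENNReal.ofReal_pow (ha.corrInf_nonneg _), ENNReal.ofReal_mul (tri_nonneg _)]
  have h3 : Measurable (Function.uncurry fun (s : ℝ) (w : ℝ × ℝ) =>
      aInf q₁ q₂ L₀ (s - w.1, w.2)) :=
    ha.measurable_aInf.comp ((measurable_fst.sub (measurable_fst.comp measurable_snd)).prodMk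
      (measurable_snd.comp measurable_snd))
  have h4 := sqNorm_integral_prod (volume.restrict (Ioc (0 : ℝ) 1)) k h3
    (fun z w => ha.aInf_nonneg _) (by rw [h2]; exact ENNReal.ofReal_ne_top)
  rw [h2, ENNReal.toReal_ofReal (integral_nonneg fun x => mul_nonneg
    (tri_nonneg _) (pow_nonneg (ha.corrInf_nonneg _) k))] at h4
  exact h4

end Kernels

/-! ### The exponent and the constant -/

section Exponent

variable {q₁ q₂ : ℝ} {L₀ : ℝ → ℝ} {a : ℤ × ℤ → ℝ} {k : ℕ} {γ : ℝ}

lemma CoefAssumption.gamma₀_eq (ha : CoefAssumption q₁ q₂ L₀ a) (hk : 1 ≤ k) :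
    gamma₀ q₁ q₂ = k * expP₁ q₁ q₂ / (k * expP₂ q₁ q₂) := by
  have hk0 : (k : ℝ) ≠ 0 := by positivity
  have hQ : 2 - expQ q₁ q₂ ≠ 0 := by linarith [ha.lt_two] 
  rw [gamma₀, expP₁, expP₂]
  have := ha.q₂_pos.ne'
  field_simp

/-- The lower bound is α < 1 + α/β or β < 1 + β/α, both equivalent to 1/α + 1/β > 1, except in the
axis regimes, where the relevant exponent is below 1. The upper bound uses positivity of the
exponents or the position of γ relative to γ₀. -/
lemma hurst_mem {α β : ℝ} (hα : 0 < α) (hβ : 0 < β) (h : 1 < 1 / α + 1 / β) (hγ : 0 < γ)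
    (hα' : k * expP₁ q₁ q₂ = α) (hβ' : k * expP₂ q₁ q₂ = β) (hγ₀ : gamma₀ q₁ q₂ = α / β) :
    hurst q₁ q₂ k γ ∈ Ioo ((1 + γ) / 2) (1 + γ) := by
  have h1 : α < 1 + α / β := by
    have := mul_lt_mul_of_pos_left h hα
    rw [mul_add, mul_one_div_cancel hα.ne', mul_one, mul_one_div] at this
    exact this
  have h2 : β < 1 + β / α := by
    have := mul_lt_mul_of_pos_left h hβ
    rw [mul_add, mul_one_div_cancel hβ.ne', mul_one, mul_one_div] at this
    linarith
  have h3 : 0 < α / β := div_pos hα hβ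
  rw [hurst, hα', hβ', hγ₀]
  split_ifs with c1 c2 c3 c4
  · subst c1
    constructor <;> linarith
  · constructor <;> nlinarith
  · constructor <;> linarith
  · constructor <;> linarith
  · have h4 : γ < α / β := lt_of_le_of_ne (not_lt.1 c2) c1
    have h5 : 1 / (2 * (α / β)) = β / α / 2 := by field_simp
    have h6 : γ * (β / α) < 1 := by
      have := mul_lt_mul_of_pos_right h4 (div_pos hβ hα)
      rwa [div_mul_div_cancel₀ hβ.ne', div_self hα.ne'] at this
    rw [h5]
    constructor <;> nlinarith [mul_pos hγ (sub_pos.2 h2), mul_pos hγ hβ]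

/-- After exchanging the coordinates, l^γ is the base length and 1/γ the exponent, and γ < α/β
becomes β/α < 1/γ. -/
lemma HomogLimit.tendsto_boxSum_strip_swap {α β : ℝ} {R : ℤ × ℤ → ℝ} {G : ℝ × ℝ → ℝ}
    (h : HomogLimit α β R G) (hα : 1 < α) (hγ : 0 < γ) (hγ' : γ < α / β) :
    Tendsto (fun l : ℝ => boxSum R ⌊l⌋ ⌊l ^ γ⌋ / l ^ (γ * (2 + β / α - β) + 1)) atTop
      (𝓝 (∫ x : ℝ × ℝ, tri x.1 * G x.swap)) := by
  have h1 : β / α < 1 / γ := by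
    rw [div_lt_div_iff₀ h.α_pos hγ, one_mul, mul_comm]
    exact (lt_div_iff₀ h.β_pos).1 hγ'
  refine ((h.swap.tendsto_boxSum_strip hα h1).comp (tendsto_rpow_atTop hγ)).congr' ?_
  filter_upwards [eventually_ge_atTop 0] with l hl
  simp only [Function.comp]
  rw [← Real.rpow_mul hl, ← Real.rpow_mul hl, mul_one_div_cancel hγ.ne', Real.rpow_one,
    boxSum_swap R]
  congr 2
  field_simp
  ring

lemma HomogLimit.tendsto_boxSum_axis_swap {α β : ℝ} {R : ℤ × ℤ → ℝ} {G : ℝ × ℝ → ℝ}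
    (h : HomogLimit α β R G) (hα : α < 1) (hγ : 0 < γ) (hγ' : γ < α / β) :
    Tendsto (fun l : ℝ => boxSum R ⌊l⌋ ⌊l ^ γ⌋ / l ^ (2 * γ + 2 - α)) atTop
      (𝓝 (∫ y : ℝ, tri y * G (y, 0))) := by
  have h1 : β / α < 1 / γ := by
    rw [div_lt_div_iff₀ h.α_pos hγ, one_mul, mul_comm]
    exact (lt_div_iff₀ h.β_pos).1 hγ'
  refine ((h.swap.tendsto_boxSum_axis hα h1).comp (tendsto_rpow_atTop hγ)).congr' ?_
  filter_upwards [eventually_ge_atTop 0] with l hl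
  simp only [Function.comp]
  rw [← Real.rpow_mul hl, ← Real.rpow_mul hl, mul_one_div_cancel hγ.ne', Real.rpow_one,
    boxSum_swap R]
  congr 2
  field_simp

/-- The double sums of the powers of the correlation, away from the boundary cases. -/
lemma CoefAssumption.tendsto_boxSum_corr (ha : CoefAssumption q₁ q₂ L₀ a)
    (hL₀ : ¬ ∀ᵐ u ∂(volume.restrict (Icc (-1 : ℝ) 1)), L₀ u = 0) (hk : 1 ≤ k)
    (hkP : (k : ℝ) < expP q₁ q₂) (hγ : 0 < γ) (hb : ¬ IsBoundary q₁ q₂ k γ) :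
    ∃ I : ℝ, 0 < I ∧ asympConst q₁ q₂ L₀ k γ = k.factorial * I ∧
      Tendsto (fun l : ℝ => boxSum (fun z => corr a z ^ k) ⌊l⌋ ⌊l ^ γ⌋ /
        l ^ (2 * hurst q₁ q₂ k γ)) atTop (𝓝 I) := by
  have h := ha.homogLimit hL₀ hk hkP
  have hγ₀ := ha.gamma₀_eq hk
  rw [IsBoundary, not_or, not_and, not_and] at hb
  obtain ⟨hb1, hb2⟩ := hb
  rw [asympConst, hurst]
  rw [hγ₀] at hb1 hb2 ⊢
  have hα0 := h.α_pos
  have hβ0 := h.β_pos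
  set α := k * expP₁ q₁ q₂ with hα
  set β := k * expP₂ q₁ q₂ with hβ
  split_ifs with c1 c2 c3 c4
  · refine ⟨_, h.integral_box_pos, by rw [ha.sqNorm_hKer h.integrable_box], ?_⟩
    rw [c1]
    convert h.tendsto_boxSum_balanced using 5
    ring
  · refine ⟨_, h.integral_axis_pos c3, by rw [ha.sqNorm_hKerPlus (h.integrable_axis c3)], ?_⟩
    convert h.tendsto_boxSum_axis c3 c2 using 5
    ring
  · have hβ1 : 1 < β := lt_of_le_of_ne (not_lt.1 c3) (Ne.symm (hb1 c2))
    refine ⟨_, h.integral_strip_pos hβ1, ?_, ?_⟩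
    · rw [← setIntegral_strip_eq h.meas h.nonneg]
      rfl
    · convert h.tendsto_boxSum_strip hβ1 c2 using 5
      ring
  · have c5 : γ < α / β := lt_of_le_of_ne (not_lt.1 c2) c1
    refine ⟨_, h.swap.integral_axis_pos c4,
      by rw [ha.sqNorm_hKerMinus (h.swap.integrable_axis c4)]; rfl, ?_⟩
    convert h.tendsto_boxSum_axis_swap c4 hγ c5 using 5
    · ring
    · rfl
  · have c5 : γ < α / β := lt_of_le_of_ne (not_lt.1 c2) c1
    have hα1 : 1 < α := lt_of_le_of_ne (not_lt.1 c4) (Ne.symm (hb2 c5))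
    refine ⟨_, h.swap.integral_strip_pos hα1, ?_, ?_⟩
    · rw [← setIntegral_strip_eq h.swap.meas h.swap.nonneg, Measure.volume_eq_prod,
        ← setIntegral_prod_swap, ← Measure.volume_eq_prod]
      rfl
    · convert h.tendsto_boxSum_strip_swap hα1 hγ c5 using 5
      field_simp

end Exponent

/-! ### Variances of the partial sums -/

section Variance

variable {Ω : Type*} [MeasurableSpace Ω] {μ : Measure Ω} [IsProbabilityMeasure μ]
  {q₁ q₂ : ℝ} {L₀ : ℝ → ℝ} {a : ℤ × ℤ → ℝ} {ε : ℤ × ℤ → Ω → ℝ} {k : ℕ} {γ : ℝ}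

/-- The number of sites of the box. -/
def boxCard (γ l : ℝ) : ℝ :=
  (Finset.Icc (1 : ℤ) ⌊l⌋ ×ˢ Finset.Icc (1 : ℤ) ⌊l ^ γ⌋).card

lemma boxCard_eq {l : ℝ} (hN : 0 < ⌊l⌋) (hM : 0 < ⌊l ^ γ⌋) :
    boxCard γ l = ⌊l⌋ * ⌊l ^ γ⌋ := by
  have h : ∀ {n : ℤ}, 0 < n → (((n + 1 - 1).toNat : ℕ) : ℝ) = n := by
    intro n hn
    rw [← Int.cast_natCast, Int.toNat_of_nonneg (by omega)]
    simp
  rw [boxCard, Finset.card_product, Int.card_Icc, Int.card_Icc, Nat.cast_mul, h hN, h hM]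

lemma boxCard_isBigO (hγ : 0 < γ) : boxCard γ =O[atTop] fun l : ℝ => l ^ (1 + γ) := by
  refine IsBigO.of_bound 1 ?_
  filter_upwards [eventually_floor_pos tendsto_id, eventually_floor_pos (tendsto_rpow_atTop hγ),
    eventually_gt_atTop 0] with l hN hM hl
  rw [id] at hN
  have hN' : (0 : ℝ) < ⌊l⌋ := by exact_mod_cast hN
  have hM' : (0 : ℝ) < ⌊l ^ γ⌋ := by exact_mod_cast hM
  rw [boxCard_eq hN hM, Real.norm_of_nonneg (by positivity), Real.norm_of_nonneg (by positivity),
    one_mul, Real.rpow_add hl, Real.rpow_one]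
  exact mul_le_mul (Int.floor_le _) (Int.floor_le _) hM'.le hl.le

lemma boxCard_isLittleO (ha : CoefAssumption q₁ q₂ L₀ a)
    (hL₀ : ¬ ∀ᵐ u ∂(volume.restrict (Icc (-1 : ℝ) 1)), L₀ u = 0) (hk : 1 ≤ k)
    (hkP : (k : ℝ) < expP q₁ q₂) (hγ : 0 < γ) :
    boxCard γ =o[atTop] fun l : ℝ => boxSum (fun z => corr a z ^ k) ⌊l⌋ ⌊l ^ γ⌋ := by
  have ht := (ha.homogLimit hL₀ hk hkP).tendsto_boxSum_atTop hγ
  have heq : ∀ᶠ l in atTop, boxCard γ l = ⌊l⌋ * ⌊l ^ γ⌋ := by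
    filter_upwards [eventually_floor_pos tendsto_id, eventually_floor_pos (tendsto_rpow_atTop hγ)]
      with l hN hM
    exact boxCard_eq hN hM
  refine isLittleO_of_tendsto' ?_ (ht.inv_tendsto_atTop.congr' ?_)
  · filter_upwards [ht.eventually_gt_atTop 0] with l hl h0
    rw [h0, zero_div] at hl
    exact absurd hl (lt_irrefl _)
  · filter_upwards [heq] with l hl
    rw [hl, Pi.inv_apply, inv_div]

lemma variance_offDiagonal_isEquivalent (hε : NoiseAssumption μ ε k)
    (ha : CoefAssumption q₁ q₂ L₀ a)
    (hL₀ : ¬ ∀ᵐ u ∂(volume.restrict (Icc (-1 : ℝ) 1)), L₀ u = 0) (hk : 1 ≤ k)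
    (hkP : (k : ℝ) < expP q₁ q₂) (hγ : 0 < γ) :
    (fun l : ℝ => variance (partialSum (offDiagonal μ a ε k) l γ) μ) ~[atTop]
      fun l : ℝ => k.factorial * boxSum (fun z => corr a z ^ k) ⌊l⌋ ⌊l ^ γ⌋ := by
  obtain ⟨C, hC⟩ := boxCoeff_not_injective_le ha.summable_sq k
  have hO : (fun l : ℝ => variance (partialSum (offDiagonal μ a ε k) l γ) μ -
      k.factorial * boxSum (fun z => corr a z ^ k) ⌊l⌋ ⌊l ^ γ⌋) =O[atTop] boxCard γ := by
    refine IsBigO.of_bound (k.factorial * C) (Eventually.of_forall fun l => ?_)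
    have h1 := variance_sum_offDiagonal_eq_sub hε hk ha.summable_sq
      (Finset.Icc (1 : ℤ) ⌊l⌋ ×ˢ Finset.Icc (1 : ℤ) ⌊l ^ γ⌋)
    have h2 : variance (partialSum (offDiagonal μ a ε k) l γ) μ -
        k.factorial * boxSum (fun z => corr a z ^ k) ⌊l⌋ ⌊l ^ γ⌋ =
        -(k.factorial * ∑' w : {w : Fin k → ℤ × ℤ | ¬ Function.Injective w},
          boxCoeff a (Finset.Icc (1 : ℤ) ⌊l⌋ ×ˢ Finset.Icc (1 : ℤ) ⌊l ^ γ⌋) w.1 ^ 2) := by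
      refine (congrArg (· - _) h1).trans ?_
      rw [boxSum]
      ring
    have h3 : 0 ≤ ∑' w : {w : Fin k → ℤ × ℤ | ¬ Function.Injective w},
        boxCoeff a (Finset.Icc (1 : ℤ) ⌊l⌋ ×ˢ Finset.Icc (1 : ℤ) ⌊l ^ γ⌋) w.1 ^ 2 :=
      tsum_nonneg fun _ => sq_nonneg _
    rw [h2, norm_neg, Real.norm_of_nonneg (by positivity), mul_assoc, boxCard,
      Real.norm_of_nonneg (by positivity)]
    exact mul_le_mul_of_nonneg_left (hC _) (by positivity)
  have hfac : (k.factorial : ℝ) ≠ 0 := by positivity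
  exact hO.trans_isLittleO ((boxCard_isLittleO ha hL₀ hk hkP hγ).trans_isBigO
    ((isBigO_refl _ _).const_mul_right hfac))

lemma variance_diagonal_isBigO (hε : NoiseAssumption μ ε k)
    (ha : CoefAssumption q₁ q₂ L₀ a) (hk : 1 ≤ k) :
    (fun l : ℝ => variance (partialSum (diagonal μ a ε k) l γ) μ) =O[atTop] boxCard γ := by
  obtain ⟨C, hC⟩ := variance_sum_diagonal_le hε hk ha.summable_sq
  refine IsBigO.of_bound C (Eventually.of_forall fun l => ?_)
  rw [Real.norm_of_nonneg (variance_nonneg _ _), boxCard, Real.norm_of_nonneg (by positivity)]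
  exact hC _

/-- By orthogonality the difference of the two variances is exactly the diagonal variance, which is
of the order of the number of sites at most. -/
lemma variance_appellField_isEquivalent (hε : NoiseAssumption μ ε k)
    (ha : CoefAssumption q₁ q₂ L₀ a)
    (hL₀ : ¬ ∀ᵐ u ∂(volume.restrict (Icc (-1 : ℝ) 1)), L₀ u = 0) (hk : 1 ≤ k)
    (hkP : (k : ℝ) < expP q₁ q₂) (hγ : 0 < γ) :
    (fun l : ℝ => variance (partialSum (appellField μ a ε k) l γ) μ) ~[atTop]
      fun l : ℝ => variance (partialSum (offDiagonal μ a ε k) l γ) μ := by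
  have h1 : (fun l : ℝ => variance (partialSum (appellField μ a ε k) l γ) μ) -
      (fun l : ℝ => variance (partialSum (offDiagonal μ a ε k) l γ) μ) =
      fun l : ℝ => variance (partialSum (diagonal μ a ε k) l γ) μ := by
    funext l
    exact sub_eq_of_eq_add' (variance_sum_appellField hε hk ha.summable_sq _)
  have hfac : (k.factorial : ℝ) ≠ 0 := by positivity
  rw [IsEquivalent, h1]
  exact ((variance_diagonal_isBigO hε ha hk).trans_isLittleO
    ((boxCard_isLittleO ha hL₀ hk hkP hγ).trans_isBigO
      ((isBigO_refl _ _).const_mul_right hfac))).trans_isBigO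
    (variance_offDiagonal_isEquivalent hε ha hL₀ hk hkP hγ).isBigO_symm

end Variance

end AppellField

end

theorem mainTheorem8 {Ω : Type*} [MeasurableSpace Ω] (μ : Measure Ω) [IsProbabilityMeasure μ]
    (q₁ q₂ : ℝ) (L₀ : ℝ → ℝ) (a : ℤ × ℤ → ℝ) (ε : ℤ × ℤ → Ω → ℝ) (k : ℕ)
    (hε : AppellField.NoiseAssumption μ ε k)
    (ha : AppellField.CoefAssumption q₁ q₂ L₀ a)
    (hL₀ : ¬ ∀ᵐ u ∂(volume.restrict (Icc (-1 : ℝ) 1)), L₀ u = 0)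
    (hk : 1 ≤ k) (hkP : (k : ℝ) < AppellField.expP q₁ q₂) :
    (∀ z : ℤ × ℤ, ∀ᵐ ω ∂μ, AppellField.appellField μ a ε k z ω =
      AppellField.offDiagonal μ a ε k z ω + AppellField.diagonal μ a ε k z ω) ∧
    ∀ γ : ℝ, 0 < γ →
      ((fun l : ℝ => variance (AppellField.partialSum (AppellField.appellField μ a ε k) l γ) μ)
        ~[atTop]
        fun l : ℝ => variance (AppellField.partialSum (AppellField.offDiagonal μ a ε k) l γ) μ) ∧
      (¬ AppellField.IsBoundary q₁ q₂ k γ →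
        AppellField.hurst q₁ q₂ k γ ∈ Ioo ((1 + γ) / 2) (1 + γ) ∧
        0 < AppellField.asympConst q₁ q₂ L₀ k γ ∧
        (fun l : ℝ => variance (AppellField.partialSum (AppellField.offDiagonal μ a ε k) l γ) μ)
          ~[atTop]
          fun l : ℝ => AppellField.asympConst q₁ q₂ L₀ k γ *
            l ^ (2 * AppellField.hurst q₁ q₂ k γ)) ∧
      (fun l : ℝ => variance (AppellField.partialSum (AppellField.diagonal μ a ε k) l γ) μ)
        =O[atTop] fun l : ℝ => l ^ (1 + γ) := by
  have hs := ha.summable_sq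
  have h := ha.homogLimit hL₀ hk hkP
  refine ⟨fun z => AppellField.appellField_eq_add hε hk hs z, fun γ hγ =>
    ⟨AppellField.variance_appellField_isEquivalent hε ha hL₀ hk hkP hγ, fun hb => ?_,
      (AppellField.variance_diagonal_isBigO hε ha hk).trans (AppellField.boxCard_isBigO hγ)⟩⟩
  obtain ⟨I, hI, hc, hlim⟩ := ha.tendsto_boxSum_corr hL₀ hk hkP hγ hb
  refine ⟨AppellField.hurst_mem h.α_pos h.β_pos h.one_lt hγ rfl rfl (ha.gamma₀_eq hk), ?_, ?_⟩
  · rw [hc]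
    positivity
  · refine (AppellField.variance_offDiagonal_isEquivalent hε ha hL₀ hk hkP hγ).trans ?_
    rw [hc]
    simp_rw [mul_assoc]
    refine IsEquivalent.mul IsEquivalent.refl ?_
    refine isEquivalent_of_tendsto_one ?_
    have h1 := hlim.div_const I
    rw [div_self hI.ne'] at h1
    refine h1.congr fun l => ?_
    rw [Pi.div_apply, div_div, mul_comm I]
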